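/- Let $f(s)=1+\sum_{n\ge 1}a_n e^{-\lambda_n s}$ be a non-constant Dirichlet series, $a_n\in\mathbb C$, $0<\lambda_1<\lambda_2<\cdots$, $\lambda_n\to+\infty$ (finitely many frequencies are included by taking all but finitely many $a_n$ to be $0$), which converges absolutely in some half plane and has a meromorphic extension $f$ of finite order to $\mathbb C$. For $\rho\in\mathbb C$ let $n_\rho\in\mathbb Z$ be the multiplicity of $\rho$ (positive at zeros, negative at poles, $0$ otherwise), and let $d$ be the convergence exponent of $f$, the least integer $d\ge 0$ with $\sum_{\rho\ne0}|n_\rho||\rho|^{-d}<\infty$. Fix $\sigma\in\mathbb C$. Then $d\ge1$; for $t\ge 0$ the series $$K_{d,\sigma}(t)=n_\sigma\frac{t^d}{d!}+\sum_{\rho\neq\sigma}\frac{n_\rho}{(\rho-\sigma)^d}e^{(\rho-\sigma)t}$$ converges absolutely, and $(K_{d,\sigma}(t)-K_{d,\sigma}(0))\mathbf 1_{[0,\infty)}(t)$ is continuous on $\mathbb R$. The Newton-Cramer distribution on $\mathbb R$ is $$W_\sigma(f)=e^{\sigma t}\frac{D^d}{Dt^d}\Big((K_{d,\sigma}(t)-K_{d,\sigma}(0))\mathbf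 1_{[0,\infty)}(t)\Big),$$ and its symmetric version with parameters $\alpha>0$, $\beta\in\mathbb R$ is, by definition of the left hand side, $$e^{-\frac{\beta}{\alpha}|t|}\,\widehat W_\sigma(f)(t/\alpha):=e^{-\frac{\beta}{\alpha}t}\,W_\sigma(f)(t/\alpha)+e^{\frac{\beta}{\alpha}t}\,W_\sigma(f)(-t/\alpha).$$ There is a polynomial $Q$ such that, with $m=d-1$ and $E_m(z)=(1-z)e^{z+z^2/2+\cdots+z^m/m}$, $$f(s)=(s-\sigma)^{n_\sigma}e^{Q(s)}\prod_{\rho\ne\sigma}E_m\Big(\frac{s-\sigma}{\rho-\sigma}\Big)^{n_\rho}$$ (Hadamard factorization with origin at $\sigma$). For any such $Q$, let $g=\max(\deg Q,m)$ be the genus, and let $-Q'(s)=c_0+c_1s+\dots+c_{g-1}s^{g-1}$ be the discrepancy polynomial. Define $c'_0,\dots,c'_{g-1}$ by $$c_0'+c_1's+\dots+c_{g-1}'s^{g-1}=\alpha\big(c_0+c_1(\alpha s+\beta)+\dots+c_{g-1}(\alpha s+\beta)^{g-1}\big).$$ Let $\Lambda$ be the set of nonzero finitely supported sequences $\mathbf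 k=(k_n)_{n\ge1}$ of natural numbers, $\|\mathbf k\|=\sum_n k_n$, $\langle\lambda,\mathbf k\rangle=\sum_n\lambda_nk_n$, and $$b_{\mathbf k}=\frac{(-1)^{\|\mathbf k\|}}{\|\mathbf k\|}\,\frac{\|\mathbf k\|!}{\prod_jk_j!}\,\prod_ja_j^{k_j},$$ and for $\mathbf k\in-\Lambda$ put $|\mathbf k|=-\mathbf k$, while $|\mathbf k|=\mathbf k$ for $\mathbf k\in\Lambda$. Then, as distributions on $\mathbb R$, $$e^{-\frac{\beta}{\alpha}|t|}\,\widehat W_\sigma(f)(t/\alpha)=2\sum_{0\le 2l\le g-1}c'_{2l}\,\delta_0^{(2l)}+\sum_{\mathbf k\in\Lambda\cup(-\Lambda)}\alpha\,\langle\lambda,|\mathbf k|\rangle\,e^{-\langle\lambda,|\mathbf k|\rangle\beta}\,b_{|\mathbf k|}\,\delta_{\alpha\langle\lambda,\mathbf k\rangle},$$ where the last series converges unconditionally in the weak (pointwise) topology of distributions. -/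

import Mathlib

open Set Filter Topology TopologicalSpace MeasureTheory
open scoped Distributions ContDiff Pointwise

noncomputable section

namespace PoissonNewton

/-! ### Complex distributions on the real line -/

/-- The space `C_c^∞(ℝ, ℂ)` of test functions with its LF topology. -/
abbrev TestFn : Type := 𝓓((⊤ : Opens ℝ), ℂ)

/-- The space of distributions on `ℝ`: continuous `ℂ`-linear functionals on the test functions,
with the topology of pointwise (weak-*) convergence. -/
abbrev Distr : Type := TestFn →Lₚₜ[ℂ] ℂ

/-- Multiplication of test functions by a fixed smooth function `h`. -/
def testMul (h : ℝ → ℂ) (hh : ContDiff ℝ ∞ h) : TestFn →L[ℂ] TestFn :=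
  TestFunction.limitCLM ℂ
    (fun φ => ⟨fun t => φ t * h t, φ.contDiff.mul hh, φ.hasCompactSupport.mul_right,
      fun _ _ => trivial⟩)
    (fun _ hK => TestFunction.ofSupportedInCLM ℂ hK ∘L
      ContDiffMapSupportedIn.bilinLeftCLM (n := ⊤) (ContinuousLinearMap.mul ℂ ℂ) hh)
    (fun _ _ _ => rfl)

@[simp]
lemma testMul_apply (h : ℝ → ℂ) (hh : ContDiff ℝ ∞ h) (φ : TestFn) (t : ℝ) :
    testMul h hh φ t = φ t * h t := rfl

/-- The rescaling `φ ↦ φ (c ·)` from functions supported in `K` to functions supported in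
`c⁻¹ K`. -/
def supportedScale (c : ℝ) (hc : c ≠ 0) (K : Compacts ℝ) :
    𝓓^{⊤}_{K}(ℝ, ℂ) →L[ℂ]
      𝓓^{⊤}_{K.map (fun t => c⁻¹ * t) (continuous_const_mul _)}(ℝ, ℂ) :=
  ContDiffMapSupportedIn.mkCLM ℂ (fun φ t => φ (c * t)) (fun _ _ _ => rfl) (fun _ _ _ => rfl)
    (fun φ => φ.contDiff.comp (contDiff_const.mul contDiff_id))
    (fun φ t ht => by
      refine φ.zero_on_compl (fun hK => ht ?_)
      exact ⟨c * t, hK, inv_mul_cancel_left₀ hc t⟩)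
    (fun i _ => ⟨{i}, |c| ^ i, by positivity, fun φ t _ => by
      have hφ : ContDiff ℝ i φ := φ.contDiff.of_le (by exact_mod_cast le_top)
      rw [norm_iteratedFDeriv_eq_norm_iteratedDeriv, iteratedDeriv_comp_const_smul hφ c,
        norm_smul, norm_pow, Real.norm_eq_abs, Finset.sup_singleton,
        ← norm_iteratedFDeriv_eq_norm_iteratedDeriv]
      exact mul_le_mul_of_nonneg_left
        (ContDiffMapSupportedIn.norm_iteratedFDeriv_apply_le_seminorm ℂ
          (by exact_mod_cast le_top)) (by positivity)⟩)

/-- The rescaling `φ ↦ φ (c ·)` of test functions, for `c ≠ 0`. -/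
def testScale (c : ℝ) (hc : c ≠ 0) : TestFn →L[ℂ] TestFn :=
  TestFunction.limitCLM ℂ
    (fun φ => ⟨fun t => φ (c * t), φ.contDiff.comp (contDiff_const.mul contDiff_id),
      φ.hasCompactSupport.comp_homeomorph (Homeomorph.mulLeft₀ c hc), fun _ _ => trivial⟩)
    (fun K _ => TestFunction.ofSupportedInCLM ℂ (fun _ _ => trivial) ∘L supportedScale c hc K)
    (fun _ _ _ => rfl)

@[simp]
lemma testScale_apply (c : ℝ) (hc : c ≠ 0) (φ : TestFn) (t : ℝ) :
    testScale c hc φ t = φ (c * t) := rfl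

/-- The transpose of an endomorphism of the space of test functions. -/
def Distr.precomp (T : Distr) (A : TestFn →L[ℂ] TestFn) : Distr :=
  PointwiseConvergenceCLM.precomp ℂ A T

/-- The Dirac distribution `δ_x`. -/
def dirac (x : ℝ) : Distr :=
  UniformConvergenceCLM.ofFun (RingHom.id ℂ) ℂ _
    { toFun := fun φ => φ x
      map_add' := fun _ _ => rfl
      map_smul' := fun _ _ => rfl
      cont := continuous_eval_const x }

/-- The regular distribution `φ ↦ ∫ φ F` of a locally integrable function `F`. -/
def regular (F : ℝ → ℂ) : Distr :=
  UniformConvergenceCLM.ofFun (RingHom.id ℂ) ℂ _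
    (TestFunction.integralAgainstBilinCLM (ContinuousLinearMap.mul ℂ ℂ) volume F)

/-- The distributional derivative `⟨T', φ⟩ = -⟨T, φ'⟩`. -/
def Distr.deriv (T : Distr) : Distr :=
  T.precomp (-TestFunction.lineDerivCLM ℂ (1 : ℝ))

/-- The product `e^{c t} T`. -/
def Distr.expMul (c : ℂ) (T : Distr) : Distr :=
  T.precomp (testMul (fun t : ℝ => Complex.exp (c * t))
    ((contDiff_const.mul Complex.ofRealCLM.contDiff).cexp))

/-- The change of variables `T(c t)`, that is `⟨T(c t), φ⟩ = |c|⁻¹ ⟨T, φ(c⁻¹ t)⟩`, for `c ≠ 0`. -/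
def Distr.scale (c : ℝ) (hc : c ≠ 0) (T : Distr) : Distr :=
  ((|c|⁻¹ : ℝ) : ℂ) • T.precomp (testScale c⁻¹ (inv_ne_zero hc))

/-! ### Divisors, order, convergence exponent -/

/-- The multiplicity `n_ρ`: positive at zeros, negative at poles, zero elsewhere. -/
def mult (f : ℂ → ℂ) (ρ : ℂ) : ℤ := (meromorphicOrderAt f ρ).untop₀

/-- The set of zeros and poles of `f`. -/
def divisorSet (f : ℂ → ℂ) : Set ℂ := {ρ | mult f ρ ≠ 0}

/-- Finite order: the Nevanlinna characteristic `T(r, f)` is `O(r^A)` for some `A`. -/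
def HasFiniteOrder (f : ℂ → ℂ) : Prop :=
  ∃ A : ℝ, ValueDistribution.characteristic f ⊤ =O[atTop] fun r : ℝ => r ^ A

/-- The convergence exponent: the least `d ≥ 0` with `∑_{ρ ≠ 0} |n_ρ| |ρ|^{-d} < ∞`. -/
def convergenceExponent (f : ℂ → ℂ) : ℕ :=
  sInf {d : ℕ | Summable fun ρ : ↥(divisorSet f \ {0}) => |(mult f ρ : ℝ)| / ‖(ρ : ℂ)‖ ^ d}

/-! ### The Newton-Cramer distribution -/

/-- The summand `n_ρ (ρ - σ)^{-d} e^{(ρ - σ) t}`, for `ρ ≠ σ`. -/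
def primitiveTerm (f : ℂ → ℂ) (σ : ℂ) (t : ℝ) (ρ : ↥(divisorSet f \ {σ})) : ℂ :=
  (mult f ρ : ℂ) / ((ρ : ℂ) - σ) ^ convergenceExponent f * Complex.exp (((ρ : ℂ) - σ) * t)

/-- `K_{d,σ}(t) = n_σ t^d / d! + ∑_{ρ ≠ σ} n_ρ (ρ - σ)^{-d} e^{(ρ - σ) t}`, to be used for
`t ≥ 0`; here `d` is the convergence exponent. -/
def primitiveSum (f : ℂ → ℂ) (σ : ℂ) (t : ℝ) : ℂ :=
  (mult f σ : ℂ) * (t : ℂ) ^ convergenceExponent f / ((convergenceExponent f).factorial : ℂ) +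
    ∑' ρ : ↥(divisorSet f \ {σ}), primitiveTerm f σ t ρ

/-- The function `(K_{d,σ}(t) - K_{d,σ}(0)) 1_{[0,∞)}(t)`. -/
def newtonCramerPrimitive (f : ℂ → ℂ) (σ : ℂ) : ℝ → ℂ :=
  (Ici (0 : ℝ)).indicator fun t => primitiveSum f σ t - primitiveSum f σ 0

/-- The Newton-Cramer distribution
`W_σ(f) = e^{σ t} D^d ((K_{d,σ}(t) - K_{d,σ}(0)) 1_{[0,∞)}(t))`. -/
def newtonCramer (f : ℂ → ℂ) (σ : ℂ) : Distr :=
  (Distr.deriv^[convergenceExponent f] (regular (newtonCramerPrimitive f σ))).expMul σ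

/-- The symmetric Newton-Cramer distribution with parameters `α > 0` and `β`, written
`e^{-β|t|/α} Ŵ_σ(f)(t/α)` and meaning
`e^{-(β/α) t} W_σ(f)(t/α) + e^{(β/α) t} W_σ(f)(-t/α)`. -/
def symmNewtonCramer (f : ℂ → ℂ) (σ : ℂ) (α β : ℝ) (hα : 0 < α) : Distr :=
  ((newtonCramer f σ).scale α⁻¹ (inv_ne_zero hα.ne')).expMul (-((β / α : ℝ) : ℂ)) +
    ((newtonCramer f σ).scale (-α⁻¹) (neg_ne_zero.mpr (inv_ne_zero hα.ne'))).expMul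
      ((β / α : ℝ) : ℂ)

/-! ### Hadamard factorization and discrepancy polynomial -/

/-- The Weierstrass factor `E_m(z) = (1 - z) exp (z + z²/2 + ⋯ + z^m/m)`. -/
def weierstrassFactor (m : ℕ) (z : ℂ) : ℂ :=
  (1 - z) * Complex.exp (∑ j ∈ Finset.Icc 1 m, z ^ j / j)

/-- The polynomial `Q` gives the Hadamard factorization of `f` with origin at `σ`,
`f(s) = (s - σ)^{n_σ} e^{Q(s)} ∏_{ρ ≠ σ} E_m((s - σ)/(ρ - σ))^{n_ρ}` with `m = d - 1`. The identity
is asked for at all points outside of the divisor where `f` is holomorphic. -/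
def IsHadamardExponent (f : ℂ → ℂ) (σ : ℂ) (Q : Polynomial ℂ) : Prop :=
  ∀ s : ℂ, AnalyticAt ℂ f s → f s ≠ 0 →
    Multipliable (fun ρ : ↥(divisorSet f \ {σ}) =>
      weierstrassFactor (convergenceExponent f - 1) ((s - σ) / ((ρ : ℂ) - σ)) ^ mult f ρ) ∧
    f s = (s - σ) ^ mult f σ * Complex.exp (Q.eval s) *
      ∏' ρ : ↥(divisorSet f \ {σ}),
        weierstrassFactor (convergenceExponent f - 1) ((s - σ) / ((ρ : ℂ) - σ)) ^ mult f ρ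

/-- The genus `g = max (deg Q) m`, where `m = d - 1`. -/
def genus (f : ℂ → ℂ) (Q : Polynomial ℂ) : ℕ := max Q.natDegree (convergenceExponent f - 1)

/-- The discrepancy polynomial `P = -Q'`, whose coefficients are the `c_j(σ)`. -/
def discrepancy (Q : Polynomial ℂ) : Polynomial ℂ := -Polynomial.derivative Q

/-- The polynomial `∑ c'_j s^j = α ∑ c_j (α s + β)^j`. -/
def paramDiscrepancy (Q : Polynomial ℂ) (α β : ℝ) : Polynomial ℂ :=
  Polynomial.C (α : ℂ) *
    (discrepancy Q).comp (Polynomial.C (α : ℂ) * Polynomial.X + Polynomial.C (β : ℂ))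

/-! ### Dirichlet series -/

/-- The index set `Λ` of nonzero finitely supported families of natural numbers, inside the
finitely supported families of integers. -/
def indexSet : Set (ℕ →₀ ℤ) := {k | 0 ≤ k ∧ k ≠ 0}

/-- `|k|`, equal to `k` on `Λ` and to `-k` on `-Λ`. -/
def absIndex (k : ℕ →₀ ℤ) : ℕ →₀ ℕ := k.mapRange Int.natAbs rfl

/-- `⟨λ, k⟩ = ∑ λ_n k_n`. -/
def pairing (lam : ℕ → ℝ) (k : ℕ →₀ ℤ) : ℝ := k.sum fun n m => lam n * m

/-- `⟨λ, k⟩ = ∑ λ_n k_n` for natural number families. -/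
def natPairing (lam : ℕ → ℝ) (k : ℕ →₀ ℕ) : ℝ := k.sum fun n m => lam n * m

/-- `b_k = ((-1)^{‖k‖} / ‖k‖) (‖k‖! / ∏ k_j!) ∏ a_j^{k_j}`, the coefficients of the formal
expansion `-log (1 + ∑ a_n e^{-λ_n s}) = ∑_k b_k e^{-⟨λ, k⟩ s}`. -/
def logCoeff (a : ℕ → ℂ) (k : ℕ →₀ ℕ) : ℂ :=
  (-1) ^ k.degree / (k.degree : ℂ) * ((k.degree.factorial : ℂ) / k.prod fun _ m => (m.factorial : ℂ)) *
    k.prod fun j m => a j ^ m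

/-- The term
`α ⟨λ, |k|⟩ e^{-⟨λ, |k|⟩ β} b_{|k|} δ_{α ⟨λ, k⟩}` of the right hand side of the formula. -/
def frequencyTerm (lam : ℕ → ℝ) (a : ℕ → ℂ) (α β : ℝ) (k : ℕ →₀ ℤ) : Distr :=
  (((α * natPairing lam (absIndex k) * Real.exp (-(natPairing lam (absIndex k) * β)) : ℝ) : ℂ) *
    logCoeff a (absIndex k)) • dirac (α * pairing lam k)

end PoissonNewton

end

open Set Filter Topology TopologicalSpace MeasureTheory
open scoped Distributions ContDiff Pointwise

noncomputable section

namespace PoissonNewton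

/-! ### Weierstrass factors -/

/-! The formula equates two expressions for f'/f and inverts a Laplace transform. Fix c₀ with ∑
|a_n| e^{-λ_n c₀} < 1. For Re s > c₀ the function f is analytic without zeros. Expanding log(1 + ∑
a_n e^{-λ_n s}) by the multinomial theorem gives f'/f = ∑ ⟨λ,k⟩ b_k e^{-⟨λ,k⟩ s}
(`dirichlet_logDeriv`). Differentiating the Hadamard product gives f'/f = Q' + n_σ/(s-σ) + ∑ n_ρ
(s-σ)^{d-1} / ((ρ-σ)^{d-1} (s-ρ)) (`IsHadamardExponent.hasSum_logDeriv`).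

Let F be the continuous primitive (K - K(0)) 1_{[0,∞)}. Apart from Q', the second expression at s +
σ is s^d times the Laplace transform of F (`hasSum_laplace_exponentialPrimitive`): subtracting 1
from e^{τt} yields the transform τ/(s(s-τ)), hence the exponent d - 1 of the Weierstrass factors.
So, on a vertical line, s^d ∫ F e^{-st} is a polynomial plus a Dirichlet series. Fourier inversion
against a test function turns the polynomial into derivatives of δ_0 and each exponential into a
Dirac mass (`hasSum_of_laplace_eq`). With the twist by e^{σt} this gives W_σ(f) = ∑ c_j δ_0^{(j)} +
∑ ⟨λ,k⟩ b_k δ_{⟨λ,k⟩} (`hasSum_newtonCramer`). The parameters α, β act by an affine change of symbol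
(`diffEval_comp`), and adding the reflected copy cancels odd derivatives and doubles even ones
(`diffEval_add_diffEval_neg`).

Two inputs remain. The factorization (`exists_isHadamardExponent`) comes from Nevanlinna theory:
finite order bounds the counting functions, so the canonical products of zeros and poles converge.
The zero-free quotient is e^Q with polynomial circle averages of (Re Q)⁺, which forces Q to be a
polynomial. Finally d ≥ 1 (`one_le_convergenceExponent`): if d = 0 the divisor is finite and f'/f is
rational, whereas along the positive axis it decays like a nonzero multiple of an exponential. -/

lemma differentiable_weierstrassFactor (m : ℕ) : Differentiable ℂ (weierstrassFactor m) := by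
  unfold weierstrassFactor
  fun_prop

lemma weierstrassFactor_eq_zero_iff {m : ℕ} {z : ℂ} : weierstrassFactor m z = 0 ↔ z = 1 := by
  simp only [weierstrassFactor, mul_eq_zero, Complex.exp_ne_zero, or_false, sub_eq_zero]
  exact eq_comm

/-- The exponent in `weierstrassFactor` is minus the Taylor polynomial of log(1 - z), so L is the
Taylor remainder. The constant 2 bounds (1 - ‖z‖)⁻¹ on the half disc. -/
lemma exists_weierstrassFactor_eq_exp (m : ℕ) {z : ℂ} (hz : ‖z‖ ≤ 1 / 2) :
    ∃ L : ℂ, weierstrassFactor m z = Complex.exp L ∧ ‖L‖ ≤ 2 * ‖z‖ ^ (m + 1) := by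
  have hz1 : ‖-z‖ < 1 := by rw [norm_neg]; linarith
  have h1 : 1 - z ≠ 0 := by
    intro h
    rw [sub_eq_zero] at h
    rw [← h, norm_one] at hz
    norm_num at hz
  refine ⟨Complex.log (1 + -z) - Complex.logTaylor (m + 1) (-z), ?_, ?_⟩
  · rw [Complex.exp_sub, ← sub_eq_add_neg, Complex.exp_log h1, weierstrassFactor, div_eq_mul_inv,
      ← Complex.exp_neg]
    congr 2
    rw [Complex.logTaylor, Finset.sum_range_succ']
    simp only [Nat.cast_zero, div_zero, add_zero]
    rw [← Finset.sum_neg_distrib, Finset.range_eq_Ico, Finset.sum_Ico_add' (fun j : ℕ =>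
      -((-1 : ℂ) ^ (j + 1) * (-z) ^ j / (j : ℂ))) 0 m 1]
    refine Finset.sum_congr rfl fun j _ => ?_
    have : ((-1 : ℂ) ^ (j + 1) * (-z) ^ j) = - z ^ j := by
      rw [neg_pow z, pow_succ, ← mul_assoc, mul_assoc ((-1 : ℂ) ^ j), mul_comm (-1 : ℂ),
        ← mul_assoc, ← mul_pow]
      simp
    rw [this]
    ring
  · refine (Complex.norm_log_sub_logTaylor_le m hz1).trans ?_
    rw [norm_neg]
    have h2 : (1 - ‖z‖)⁻¹ ≤ 2 := by
      rw [inv_le_comm₀ (by linarith) (by norm_num)]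
      linarith
    have h3 : (1 : ℝ) ≤ m + 1 := by linarith [(Nat.cast_nonneg m : (0 : ℝ) ≤ m)]
    calc ‖z‖ ^ (m + 1) * (1 - ‖z‖)⁻¹ / (m + 1) ≤ ‖z‖ ^ (m + 1) * (1 - ‖z‖)⁻¹ :=
          div_le_self (mul_nonneg (by positivity) (inv_nonneg.2 (by linarith))) h3
      _ ≤ ‖z‖ ^ (m + 1) * 2 := by gcongr
      _ = _ := by ring

/-- The constant in the growth estimate of `weierstrassFactor m`. -/
def factorConst (m : ℕ) : ℝ := (m + 2) * 2 ^ (m + 1)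

lemma factorConst_nonneg (m : ℕ) : 0 ≤ factorConst m := by unfold factorConst; positivity

/-- Near 0 the Taylor remainder suffices. For ‖z‖ ≥ 1/2 every power of degree at most m + 1 is
bounded by (2‖z‖)^(m+1); the m summands of the exponent and the factor 1 - z (counted twice) produce
m + 2. -/
lemma norm_weierstrassFactor_le (m : ℕ) (z : ℂ) :
    ‖weierstrassFactor m z‖ ≤ Real.exp (factorConst m * ‖z‖ ^ (m + 1)) := by
  rcases le_total ‖z‖ (1 / 2) with hz | hz
  · obtain ⟨L, hL, hL'⟩ := exists_weierstrassFactor_eq_exp m hz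
    rw [hL, Complex.norm_exp]
    refine Real.exp_le_exp.2 ((Complex.re_le_norm L).trans (hL'.trans ?_))
    refine mul_le_mul_of_nonneg_right ?_ (by positivity)
    have h1 : (1 : ℝ) ≤ 2 ^ (m + 1) := one_le_pow₀ (by norm_num)
    have h3 : (2 : ℝ) ≤ m + 2 := by linarith [(Nat.cast_nonneg m : (0 : ℝ) ≤ m)]
    unfold factorConst
    nlinarith
  · have key : ∀ j ≤ m + 1, ‖z‖ ^ j ≤ 2 ^ (m + 1) * ‖z‖ ^ (m + 1) := by
      intro j hj
      have h1 : (1 : ℝ) ≤ 2 * ‖z‖ := by linarith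
      have h2 : (1 : ℝ) ≤ 2 ^ j := one_le_pow₀ (by norm_num)
      calc ‖z‖ ^ j ≤ 2 ^ j * ‖z‖ ^ j := le_mul_of_one_le_left (by positivity) h2
        _ = (2 * ‖z‖) ^ j := (mul_pow _ _ _).symm
        _ ≤ (2 * ‖z‖) ^ (m + 1) := pow_le_pow_right₀ h1 hj
        _ = _ := mul_pow _ _ _
    have h1 : ‖1 - z‖ ≤ Real.exp ((2 ^ (m + 1) * ‖z‖ ^ (m + 1)) * 2) := by
      calc ‖1 - z‖ ≤ 1 + ‖z‖ := by simpa using norm_sub_le 1 z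
        _ = ‖z‖ + 1 := add_comm _ _
        _ ≤ Real.exp ‖z‖ := Real.add_one_le_exp _
        _ ≤ _ := by
          refine Real.exp_le_exp.2 ?_
          have := key 1 (by omega)
          have h0 := norm_nonneg z
          rw [pow_one] at this
          linarith
    have h2 : ‖∑ j ∈ Finset.Icc 1 m, z ^ j / (j : ℂ)‖ ≤ m * (2 ^ (m + 1) * ‖z‖ ^ (m + 1)) := by
      refine (norm_sum_le _ _).trans ?_
      have : ∀ j ∈ Finset.Icc 1 m, ‖z ^ j / (j : ℂ)‖ ≤ 2 ^ (m + 1) * ‖z‖ ^ (m + 1) := by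
        intro j hj
        rw [Finset.mem_Icc] at hj
        rw [norm_div, norm_pow, Complex.norm_natCast]
        have hj1 : (1 : ℝ) ≤ j := by exact_mod_cast hj.1
        exact (div_le_self (by positivity) hj1).trans (key j (by omega))
      refine (Finset.sum_le_sum this).trans ?_
      simp
    rw [weierstrassFactor, norm_mul, Complex.norm_exp]
    calc _ ≤ Real.exp ((2 ^ (m + 1) * ‖z‖ ^ (m + 1)) * 2) *
          Real.exp (m * (2 ^ (m + 1) * ‖z‖ ^ (m + 1))) := by
          refine mul_le_mul h1 (Real.exp_le_exp.2 ((Complex.re_le_norm _).trans h2))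
            (Real.exp_nonneg _) (Real.exp_nonneg _)
      _ = _ := by
        rw [← Real.exp_add]
        unfold factorConst
        ring_nf

/-- The second smallness condition gives ‖nL‖ ≤ 1, where ‖e^w - 1‖ ≤ 2‖w‖ applies. It must involve n
because a zero is treated as one factor with its full multiplicity. -/
lemma norm_weierstrassFactor_pow_sub_one_le (m n : ℕ) {z : ℂ} (hz : ‖z‖ ≤ 1 / 2)
    (hn : n * ‖z‖ ^ (m + 1) ≤ 1 / 2) :
    ‖weierstrassFactor m z ^ n - 1‖ ≤ 4 * (n * ‖z‖ ^ (m + 1)) := by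
  obtain ⟨L, hL, hL'⟩ := exists_weierstrassFactor_eq_exp m hz
  have h1 : ‖(n : ℂ) * L‖ ≤ 2 * (n * ‖z‖ ^ (m + 1)) := by
    rw [norm_mul, Complex.norm_natCast]
    calc _ ≤ (n : ℝ) * (2 * ‖z‖ ^ (m + 1)) := by gcongr
      _ = _ := by ring
  rw [hL, ← Complex.exp_nat_mul]
  refine (Complex.norm_exp_sub_one_le (by linarith)).trans (by linarith)

lemma meromorphicOrderAt_weierstrassFactor_pow (m n : ℕ) {τ : ℂ} (hτ : τ ≠ 0) :
    meromorphicOrderAt (fun z => weierstrassFactor m (z / τ) ^ n) τ = n := by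
  have hfac : (fun z => weierstrassFactor m (z / τ)) =
      (fun z => -τ⁻¹ * Complex.exp (∑ j ∈ Finset.Icc 1 m, (z / τ) ^ j / j)) *
        (fun z => z - τ) := by
    ext z
    simp only [weierstrassFactor, Pi.mul_apply]
    have : 1 - z / τ = -τ⁻¹ * (z - τ) := by field_simp; ring
    rw [this]
    ring
  have hd : Differentiable ℂ
      (fun z => -τ⁻¹ * Complex.exp (∑ j ∈ Finset.Icc 1 m, (z / τ) ^ j / j)) := by fun_prop
  have h1 : meromorphicOrderAt (fun z => weierstrassFactor m (z / τ)) τ = 1 := by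
    rw [hfac, meromorphicOrderAt_mul_of_ne_zero (hd.analyticAt τ), meromorphicOrderAt_id_sub_const]
    simp [hτ, Complex.exp_ne_zero]
  have hmer : MeromorphicAt (fun z => weierstrassFactor m (z / τ)) τ := by
    have : Differentiable ℂ (fun z => weierstrassFactor m (z / τ)) :=
      (differentiable_weierstrassFactor m).comp (differentiable_id.div_const τ)
    exact (this.analyticAt τ).meromorphicAt
  rw [fun_meromorphicOrderAt_pow hmer, h1]
  simp

/-- The derivative of the exponent is a geometric sum, which cancels all but the tail of the
expansion of 1/(z - τ) in powers of z/τ. -/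
lemma logDeriv_weierstrassFactor_div (m : ℕ) {τ z : ℂ} (hτ : τ ≠ 0) (hz : z ≠ τ) :
    logDeriv (fun z => weierstrassFactor m (z / τ)) z = z ^ m / (τ ^ m * (z - τ)) := by
  have hz1 : z / τ ≠ 1 := by rwa [ne_eq, div_eq_one_iff_eq hτ]
  have hz2 : z - τ ≠ 0 := sub_ne_zero.2 hz
  have hz3 : 1 - z / τ ≠ 0 := sub_ne_zero.2 hz1.symm
  have h1 : HasDerivAt (fun z => 1 - z / τ) (-(1 / τ)) z := by
    simpa using ((hasDerivAt_id z).div_const τ).const_sub 1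
  have h2 : HasDerivAt (fun z => ∑ j ∈ Finset.Icc 1 m, (z / τ) ^ j / (j : ℂ))
      (∑ j ∈ Finset.Icc 1 m, (z / τ) ^ (j - 1) * (1 / τ)) z := by
    refine HasDerivAt.fun_sum fun j hj => ?_
    rw [Finset.mem_Icc] at hj
    have hj0 : (j : ℂ) ≠ 0 := by exact_mod_cast (by omega : j ≠ 0)
    refine ((((hasDerivAt_id z).div_const τ).fun_pow j).div_const (j : ℂ)).congr_deriv ?_
    rw [mul_assoc, mul_div_cancel_left₀ _ hj0]
    rfl
  have h3 := h1.mul h2.cexp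
  have h4 : logDeriv (fun z => weierstrassFactor m (z / τ)) z =
      -(1 / τ) / (1 - z / τ) + ∑ j ∈ Finset.Icc 1 m, (z / τ) ^ (j - 1) * (1 / τ) := by
    have he : (fun z => weierstrassFactor m (z / τ)) = (fun z => 1 - z / τ) *
      fun z => Complex.exp (∑ j ∈ Finset.Icc 1 m, (z / τ) ^ j / (j : ℂ)) := rfl
    rw [logDeriv_apply, he, h3.deriv]
    have hne : weierstrassFactor m (z / τ) ≠ 0 := weierstrassFactor_eq_zero_iff.not.2 hz1
    rw [div_eq_iff hne, weierstrassFactor, add_mul, ← mul_assoc (-(1 / τ) / (1 - z / τ)),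
      div_mul_cancel₀ _ hz3]
    ring
  rw [h4, ← Finset.sum_mul]
  have h5 : ∑ j ∈ Finset.Icc 1 m, (z / τ) ^ (j - 1) = ∑ j ∈ Finset.range m, (z / τ) ^ j := by
    rw [Finset.range_eq_Ico, Finset.sum_Ico_eq_sum_range, ← Finset.Ico_add_one_right_eq_Icc,
      Finset.sum_Ico_eq_sum_range]
    simp
  have h6 := geom_sum_mul (z / τ) m
  have h7 : ∑ j ∈ Finset.range m, (z / τ) ^ j = ((z / τ) ^ m - 1) / (z / τ - 1) := by
    rw [eq_div_iff (sub_ne_zero.2 hz1), h6]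
  have h8 : z / τ - 1 = (z - τ) / τ := by field_simp
  have h9 : 1 - z / τ = -((z - τ) / τ) := by field_simp; ring
  rw [h5, h7, h8, h9, div_pow]
  field_simp
  ring

/-! ### Weierstrass products -/

/-- The product `∏ E_m(z / τ_i)^{n_i}`. -/
def weierstrassProduct {ι : Type*} (m : ℕ) (τ : ι → ℂ) (n : ι → ℕ) (z : ℂ) : ℂ :=
  ∏' i, weierstrassFactor m (z / τ i) ^ n i

section Product

variable {ι : Type*} {m : ℕ} {τ : ι → ℂ} {n : ι → ℕ}

/-- The majorant for the Weierstrass M-test on the disc of radius R. Almost all τ_i lie beyond 2R,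
and the terms of the summable series become small enough to control the multiplicities. -/
lemma eventually_norm_factor_sub_one_le (hlim : Tendsto (fun i => ‖τ i‖) cofinite atTop)
    (hs : Summable fun i => (n i : ℝ) / ‖τ i‖ ^ (m + 1)) {R : ℝ} (hR : 0 < R) :
    ∀ᶠ i in cofinite, ∀ z : ℂ, ‖z‖ ≤ R →
      ‖weierstrassFactor m (z / τ i) ^ n i - 1‖ ≤
        4 * R ^ (m + 1) * ((n i : ℝ) / ‖τ i‖ ^ (m + 1)) := by
  have h0 := (hs.tendsto_cofinite_zero).eventually
    (gt_mem_nhds (show (0 : ℝ) < 1 / 2 / R ^ (m + 1) by positivity))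
  filter_upwards [hlim.eventually_ge_atTop (2 * R), h0] with i h1 h2 z hz
  have hτ : 0 < ‖τ i‖ := by linarith
  have h3 : ‖z / τ i‖ ≤ 1 / 2 := by
    rw [norm_div, div_le_iff₀ hτ]
    linarith
  have h4 : (n i : ℝ) * ‖z / τ i‖ ^ (m + 1) ≤ R ^ (m + 1) * (n i / ‖τ i‖ ^ (m + 1)) := by
    rw [norm_div, div_pow, mul_div_assoc', mul_div_assoc', mul_comm]
    gcongr
  have h5 : R ^ (m + 1) * (n i / ‖τ i‖ ^ (m + 1)) ≤ 1 / 2 := by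
    rw [lt_div_iff₀ (by positivity)] at h2
    linarith
  refine (norm_weierstrassFactor_pow_sub_one_le m (n i) h3 (h4.trans h5)).trans ?_
  linarith

lemma differentiable_factor (i : ι) :
    Differentiable ℂ (fun z => weierstrassFactor m (z / τ i) ^ n i) :=
  ((differentiable_weierstrassFactor m).comp (differentiable_id.div_const (τ i))).pow _

lemma multipliableLocallyUniformlyOn_factor (hlim : Tendsto (fun i => ‖τ i‖) cofinite atTop)
    (hs : Summable fun i => (n i : ℝ) / ‖τ i‖ ^ (m + 1)) :
    MultipliableLocallyUniformlyOn (fun i z => weierstrassFactor m (z / τ i) ^ n i) univ := by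
  refine multipliableLocallyUniformlyOn_of_of_forall_exists_nhds fun x _ =>
    ⟨Metric.closedBall 0 (‖x‖ + 1), ?_, ?_⟩
  · rw [nhdsWithin_univ]
    exact mem_of_superset (Metric.isOpen_ball.mem_nhds (by simp : x ∈ Metric.ball 0 (‖x‖ + 1)))
      Metric.ball_subset_closedBall
  · have hev := eventually_norm_factor_sub_one_le hlim hs (show 0 < ‖x‖ + 1 by positivity)
    have := Summable.multipliableUniformlyOn_one_add
      (isCompact_closedBall (0 : ℂ) (‖x‖ + 1)) (hs.mul_left (4 * (‖x‖ + 1) ^ (m + 1)))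
      (f := fun i z => weierstrassFactor m (z / τ i) ^ n i - 1)
      (by filter_upwards [hev] with i hi z hz using hi z (by simpa using hz))
      (fun i => ((differentiable_factor i).continuous.sub continuous_const).continuousOn)
    simpa using this

lemma hasProd_weierstrassProduct (hlim : Tendsto (fun i => ‖τ i‖) cofinite atTop)
    (hs : Summable fun i => (n i : ℝ) / ‖τ i‖ ^ (m + 1)) (z : ℂ) :
    HasProd (fun i => weierstrassFactor m (z / τ i) ^ n i) (weierstrassProduct m τ n z) :=
  ((multipliableLocallyUniformlyOn_factor hlim hs).multipliable (mem_univ z)).hasProd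

lemma differentiable_weierstrassProduct (hlim : Tendsto (fun i => ‖τ i‖) cofinite atTop)
    (hs : Summable fun i => (n i : ℝ) / ‖τ i‖ ^ (m + 1)) :
    Differentiable ℂ (weierstrassProduct m τ n) := by
  have h := (multipliableLocallyUniformlyOn_factor hlim hs).hasProdLocallyUniformlyOn
  rw [← differentiableOn_univ]
  refine TendstoLocallyUniformlyOn.differentiableOn h (Eventually.of_forall fun s => ?_) isOpen_univ
  exact DifferentiableOn.fun_finsetProd fun i _ => (differentiable_factor i).differentiableOn

/-- An absolutely convergent product of nonzero factors is nonzero. Indices with n i = 0 are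
unconstrained, so zeros and poles can share the whole divisor as index set. -/
lemma weierstrassProduct_ne_zero (hlim : Tendsto (fun i => ‖τ i‖) cofinite atTop)
    (hs : Summable fun i => (n i : ℝ) / ‖τ i‖ ^ (m + 1)) {z : ℂ}
    (hz : ∀ i, n i ≠ 0 → z / τ i ≠ 1) : weierstrassProduct m τ n z ≠ 0 := by
  have hev := eventually_norm_factor_sub_one_le hlim hs (show 0 < ‖z‖ + 1 by positivity)
  have hsum : Summable fun i => ‖weierstrassFactor m (z / τ i) ^ n i - 1‖ := by
    refine (hs.mul_left (4 * (‖z‖ + 1) ^ (m + 1))).of_norm_bounded_eventually ?_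
    filter_upwards [hev] with i hi
    rw [norm_norm]
    exact hi z (by linarith)
  have := tprod_one_add_ne_zero_of_summable
    (f := fun i => weierstrassFactor m (z / τ i) ^ n i - 1) (fun i => ?_) hsum
  · simpa [weierstrassProduct] using this
  · rw [add_sub_cancel]
    rcases eq_or_ne (n i) 0 with h | h
    · simp [h]
    · exact pow_ne_zero _ (weierstrassFactor_eq_zero_iff.not.2 (hz i h))

lemma norm_weierstrassProduct_le (hlim : Tendsto (fun i => ‖τ i‖) cofinite atTop)
    (hs : Summable fun i => (n i : ℝ) / ‖τ i‖ ^ (m + 1)) (z : ℂ) :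
    ‖weierstrassProduct m τ n z‖ ≤
      Real.exp (factorConst m * (∑' i, (n i : ℝ) / ‖τ i‖ ^ (m + 1)) * ‖z‖ ^ (m + 1)) := by
  have h1 := (hasProd_weierstrassProduct hlim hs z).norm
  refine le_of_tendsto h1 (Eventually.of_forall fun s => ?_)
  calc ∏ i ∈ s, ‖weierstrassFactor m (z / τ i) ^ n i‖
      ≤ ∏ i ∈ s, Real.exp (factorConst m * ‖z‖ ^ (m + 1) * ((n i : ℝ) / ‖τ i‖ ^ (m + 1))) := by
        refine Finset.prod_le_prod (fun i _ => norm_nonneg _) fun i _ => ?_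
        rw [norm_pow]
        refine (pow_le_pow_left₀ (norm_nonneg _) (norm_weierstrassFactor_le m _) _).trans ?_
        rw [← Real.exp_nat_mul, norm_div, div_pow]
        refine Real.exp_le_exp.2 (le_of_eq (by ring))
    _ = Real.exp (factorConst m * ‖z‖ ^ (m + 1) * ∑ i ∈ s, ((n i : ℝ) / ‖τ i‖ ^ (m + 1))) := by
        rw [← Real.exp_sum, Finset.mul_sum]
    _ ≤ _ := by
        refine Real.exp_le_exp.2 ?_
        have := hs.sum_le_tsum s fun i _ => by positivity
        have h0 := factorConst_nonneg m
        calc _ ≤ factorConst m * ‖z‖ ^ (m + 1) * ∑' i, (n i : ℝ) / ‖τ i‖ ^ (m + 1) := by gcongr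
          _ = _ := by ring

lemma meromorphicOrderAt_weierstrassProduct (hlim : Tendsto (fun i => ‖τ i‖) cofinite atTop)
    (hs : Summable fun i => (n i : ℝ) / ‖τ i‖ ^ (m + 1)) (hinj : Function.Injective τ) {i : ι}
    (hi : τ i ≠ 0) : meromorphicOrderAt (weierstrassProduct m τ n) (τ i) = n i := by
  classical
  -- Removing the multiplicity at i splits off the only factor vanishing at τ i; by injectivity of τ
  -- the remaining product is nonzero there.
  set n' := Function.update n i 0
  have hs' : Summable fun j => (n' j : ℝ) / ‖τ j‖ ^ (m + 1) := by
    refine hs.of_nonneg_of_le (fun j => by positivity) fun j => ?_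
    have : n' j ≤ n j := by
      by_cases h : j = i
      · subst h; simp [n']
      · simp [n', h]
    gcongr
  have hsplit : weierstrassProduct m τ n = weierstrassProduct m τ n' *
      fun z => weierstrassFactor m (z / τ i) ^ n i := by
    ext z
    have h1 := hasProd_weierstrassProduct hlim hs' z
    have h2 : HasProd (fun j => if j = i then weierstrassFactor m (z / τ i) ^ n i else 1)
        (weierstrassFactor m (z / τ i) ^ n i) := hasProd_ite_eq i _
    refine (hasProd_weierstrassProduct hlim hs z).unique ((h1.mul h2).congr_fun ?_)
    intro j
    by_cases h : j = i
    · subst h; simp [n']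
    · simp [n', h]
  rw [hsplit, meromorphicOrderAt_mul_of_ne_zero
    ((differentiable_weierstrassProduct hlim hs').analyticAt _),
    meromorphicOrderAt_weierstrassFactor_pow m _ hi]
  refine weierstrassProduct_ne_zero hlim hs' fun j hj => ?_
  have hji : j ≠ i := by rintro rfl; simp [n'] at hj
  intro h
  have hj0 : τ j ≠ 0 := by rintro h0; simp [h0] at h
  rw [div_eq_one_iff_eq hj0] at h
  exact hji (hinj h.symm)

lemma logDeriv_weierstrassProduct (hlim : Tendsto (fun i => ‖τ i‖) cofinite atTop)
    (hs : Summable fun i => (n i : ℝ) / ‖τ i‖ ^ (m + 1)) (hτ : ∀ i, τ i ≠ 0) {z : ℂ}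
    (hz : ∀ i, z ≠ τ i) :
    HasSum (fun i => (n i : ℂ) * (z ^ m / (τ i ^ m * (z - τ i))))
      (logDeriv (weierstrassProduct m τ n) z) := by
  have hne : ∀ i, z / τ i ≠ 1 := fun i => by rw [ne_eq, div_eq_one_iff_eq (hτ i)]; exact hz i
  have hf : ∀ i, weierstrassFactor m (z / τ i) ^ n i ≠ 0 := fun i =>
    pow_ne_zero _ (weierstrassFactor_eq_zero_iff.not.2 (hne i))
  have hl : ∀ i, logDeriv (fun z => weierstrassFactor m (z / τ i) ^ n i) z =
      (n i : ℂ) * (z ^ m / (τ i ^ m * (z - τ i))) := fun i => by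
    rw [← logDeriv_weierstrassFactor_div m (hτ i) (hz i)]
    exact logDeriv_fun_pow
      (((differentiable_weierstrassFactor m).comp (differentiable_id.div_const (τ i))) z) _
  have hsum : Summable (fun i => (n i : ℂ) * (z ^ m / (τ i ^ m * (z - τ i)))) := by
    refine (hs.mul_left (2 * ‖z‖ ^ m)).of_norm_bounded_eventually ?_
    filter_upwards [hlim.eventually_ge_atTop (2 * ‖z‖ + 1)] with i hi
    have h0 : 0 < ‖τ i‖ := norm_pos_iff.2 (hτ i)
    have h1 : ‖τ i‖ / 2 ≤ ‖z - τ i‖ := by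
      have := norm_sub_norm_le (τ i) z
      rw [norm_sub_rev] at this
      linarith
    rw [norm_mul, norm_div, norm_mul, norm_pow, norm_pow, Complex.norm_natCast]
    calc (n i : ℝ) * (‖z‖ ^ m / (‖τ i‖ ^ m * ‖z - τ i‖))
        ≤ (n i : ℝ) * (‖z‖ ^ m / (‖τ i‖ ^ m * (‖τ i‖ / 2))) := by gcongr
      _ = 2 * ‖z‖ ^ m * (n i / ‖τ i‖ ^ (m + 1)) := by
        rw [pow_succ]
        field_simp
  have hsum' : Summable fun i => logDeriv (fun z => weierstrassFactor m (z / τ i) ^ n i) z := by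
    simpa only [hl] using hsum
  have := logDeriv_tprod_eq_tsum isOpen_univ (mem_univ z) hf
    (fun i => (differentiable_factor i).differentiableOn) hsum'
    (multipliableLocallyUniformlyOn_factor hlim hs)
    (weierstrassProduct_ne_zero hlim hs fun i _ => hne i)
  simp only [hl] at this
  exact this ▸ hsum.hasSum

end Product

/-! ### Entire functions with polynomially bounded real part -/

lemma norm_circleAverage_le {f : ℂ → ℂ} {c : ℂ} {R : ℝ} :
    ‖Real.circleAverage f c R‖ ≤ Real.circleAverage (fun z => ‖f z‖) c R := by
  rw [Real.circleAverage, Real.circleAverage, norm_smul, smul_eq_mul, Real.norm_of_nonneg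
    (inv_nonneg.2 Real.two_pi_pos.le)]
  gcongr
  exact intervalIntegral.norm_integral_le_integral_norm Real.two_pi_pos.le

/-- A Borel–Carathéodory estimate in terms of averages. The conjugate of Q is orthogonal to z^n on
the circle, so the n-th coefficient is the average of z^{-n} · 2 Re Q. Then 2|x| = 4 max(x, 0) - 2x,
and Re Q has mean Re Q(0). -/
lemma norm_taylorCoeff_mul_pow_le {Q : ℂ → ℂ} (hQ : Differentiable ℂ Q) {n : ℕ} (hn : n ≠ 0)
    {r : ℝ} (hr : 0 < r) :
    ‖(n.factorial : ℂ)⁻¹ * iteratedDeriv n Q 0‖ * r ^ n ≤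
      4 * Real.circleAverage (fun z => max (Q z).re 0) 0 r - 2 * (Q 0).re := by
  have hci : ∀ {f : ℂ → ℂ}, Continuous f → CircleIntegrable f 0 r := fun hf =>
    hf.continuousOn.circleIntegrable hr.le
  have hsph : ∀ {z : ℂ}, z ∈ Metric.sphere (0 : ℂ) |r| → z ≠ 0 ∧ ‖z‖ = r := by
    intro z hz
    rw [abs_of_pos hr, mem_sphere_zero_iff_norm] at hz
    exact ⟨norm_pos_iff.1 (by rw [hz]; exact hr), hz⟩
  have hcon : ContinuousOn (fun z : ℂ => (1 / z ^ n)) (Metric.sphere 0 |r|) := by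
    refine ContinuousOn.div continuousOn_const (by fun_prop) fun z hz => ?_
    exact pow_ne_zero _ (hsph hz).1
  have h1 : Real.circleAverage (fun z => (1 / z ^ n) * Q z) 0 r =
      (n.factorial : ℂ)⁻¹ * iteratedDeriv n Q 0 := by
    rw [Real.circleAverage_eq_circleIntegral hr.ne']
    have := (hQ.differentiableOn (s := Metric.closedBall 0 r)).circleIntegral_one_div_sub_center_pow_smul
      hr n
    have h2 : (∮ z in C(0, r), (z - 0)⁻¹ • (1 / z ^ n * Q z)) =
        ∮ z in C(0, r), (1 / (z - 0) ^ (n + 1)) • Q z := by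
      congr 1
      ext z
      simp only [sub_zero, smul_eq_mul]
      rw [pow_succ]
      field_simp
    rw [h2, this, smul_smul, smul_eq_mul]
    congr 1
    have := Complex.two_pi_I_ne_zero
    field_simp
  -- On the circle z^{-n} is r^{-2n} times the conjugate of z^n, so this is a multiple of the
  -- conjugate of the mean of z^n Q, which is its value at 0.
  have h2 : Real.circleAverage (fun z => (1 / z ^ n) * (starRingEnd ℂ) (Q z)) 0 r = 0 := by
    have hd : Differentiable ℂ fun z => z ^ n * Q z := by fun_prop
    have h3 := (hd.diffContOnCl (s := Metric.ball 0 |r|)).circleAverage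
    simp only [ne_eq, hn, not_false_eq_true, zero_pow, zero_mul] at h3
    have h4 := (Complex.conjCLE : ℂ →L[ℝ] ℂ).circleAverage_comp_comm (hci hd.continuous)
    rw [h3, map_zero] at h4
    have h5 : EqOn (fun z => (1 / z ^ n) * (starRingEnd ℂ) (Q z))
        ((((r : ℂ) ^ (2 * n))⁻¹) • ((Complex.conjCLE : ℂ →L[ℝ] ℂ) ∘ fun z => z ^ n * Q z))
        (Metric.sphere 0 |r|) := by
      intro z hz
      obtain ⟨hz0, hzr⟩ := hsph hz
      have h6 : (r : ℂ) ^ (2 * n) = z ^ n * (starRingEnd ℂ) z ^ n := by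
        rw [← mul_pow, Complex.mul_conj, Complex.normSq_eq_norm_sq, hzr, pow_mul]
        push_cast
        rfl
      simp only [Pi.smul_apply, Function.comp, ContinuousLinearEquiv.coe_coe,
        Complex.conjCLE_apply, map_mul, map_pow, smul_eq_mul, h6]
      have : (starRingEnd ℂ) z ≠ 0 := (map_ne_zero _).2 hz0
      field_simp
    rw [Real.circleAverage_congr_sphere h5, Real.circleAverage_smul, h4, smul_zero]
  have hmulci : ∀ {g : ℂ → ℂ}, Continuous g → CircleIntegrable (fun z => (1 / z ^ n) * g z) 0 r := by
    intro g hg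
    refine ContinuousOn.circleIntegrable hr.le ?_
    have := hcon.mul hg.continuousOn
    rwa [abs_of_pos hr] at this
  have h3 : (n.factorial : ℂ)⁻¹ * iteratedDeriv n Q 0 =
      Real.circleAverage (fun z => (1 / z ^ n) * (2 * ((Q z).re : ℂ))) 0 r := by
    have h4 := Real.circleAverage_fun_add (hmulci hQ.continuous)
      (hmulci (g := fun z => (starRingEnd ℂ) (Q z)) (Complex.continuous_conj.comp hQ.continuous))
    rw [h1, h2, add_zero] at h4
    rw [← h4]
    congr 1
    ext z
    rw [← mul_add, Complex.add_conj]
    push_cast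
    rfl
  have hre : Continuous fun z => (Q z).re := Complex.continuous_re.comp hQ.continuous
  have hcr : ∀ {f : ℂ → ℝ}, Continuous f → CircleIntegrable f 0 r := fun hf =>
    hf.continuousOn.circleIntegrable hr.le
  have h4 : Real.circleAverage (fun z => (Q z).re) 0 r = (Q 0).re := by
    have := Complex.reCLM.circleAverage_comp_comm (hci hQ.continuous)
    rw [(hQ.diffContOnCl (s := Metric.ball 0 |r|)).circleAverage] at this
    exact this
  have h5 : Real.circleAverage (fun z => 2 * |(Q z).re|) 0 r =
      4 * Real.circleAverage (fun z => max (Q z).re 0) 0 r - 2 * (Q 0).re := by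
    rw [← h4, ← smul_eq_mul (4 : ℝ), ← smul_eq_mul (2 : ℝ), ← Real.circleAverage_fun_smul,
      ← Real.circleAverage_fun_smul, ← Real.circleAverage_fun_sub]
    · congr 1
      ext z
      simp only [smul_eq_mul]
      rcases le_total (Q z).re 0 with h | h
      · rw [abs_of_nonpos h, max_eq_right h]; ring
      · rw [abs_of_nonneg h, max_eq_left h]; ring
    · exact hcr ((hre.max continuous_const).fun_const_smul _)
    · exact hcr (hre.fun_const_smul _)
  have hrn : 0 < r ^ n := by positivity
  rw [h3, ← h5, ← le_div_iff₀ hrn, div_eq_inv_mul, ← smul_eq_mul (r ^ n)⁻¹,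
    ← Real.circleAverage_fun_smul]
  refine norm_circleAverage_le.trans (le_of_eq (Real.circleAverage_congr_sphere fun z hz => ?_))
  obtain ⟨hz0, hzr⟩ := hsph hz
  simp [hzr]

/-- An entire function whose real part has positive part of polynomially bounded circle averages
is a polynomial. -/
lemma exists_polynomial_of_circleAverage_re_le {Q : ℂ → ℂ} (hQ : Differentiable ℂ Q) {C : ℝ} {B : ℕ}
    (h : ∀ᶠ r in atTop, Real.circleAverage (fun z => max (Q z).re 0) 0 r ≤ C * r ^ B) :
    ∃ p : Polynomial ℂ, ∀ z, Q z = p.eval z := by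
  have hz : ∀ n, B < n → (n.factorial : ℂ)⁻¹ * iteratedDeriv n Q 0 = 0 := by
    intro n hn
    set c := ‖(n.factorial : ℂ)⁻¹ * iteratedDeriv n Q 0‖ with hc
    -- Since n ≥ B + 1, dividing the coefficient estimate by r^B keeps c * r bounded, which is
    -- impossible for c > 0.
    have h1 : ∀ᶠ r : ℝ in atTop, c * r ≤ 4 * C + 2 * |(Q 0).re| := by
      filter_upwards [h, eventually_ge_atTop 1] with r h1 hr
      have h2 := norm_taylorCoeff_mul_pow_le hQ (by omega : n ≠ 0) (by linarith : 0 < r)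
      have h3 : (1 : ℝ) ≤ r ^ B := one_le_pow₀ hr
      have h4 : r * r ^ B ≤ r ^ n := by
        rw [← pow_succ']
        exact pow_le_pow_right₀ hr hn
      have h5 : c * (r * r ^ B) ≤ (4 * C + 2 * |(Q 0).re|) * r ^ B := by
        calc c * (r * r ^ B) ≤ c * r ^ n := by gcongr
          _ ≤ _ := h2
          _ ≤ 4 * (C * r ^ B) + 2 * |(Q 0).re| * 1 := by
            linarith [neg_abs_le (Q 0).re]
          _ ≤ 4 * (C * r ^ B) + 2 * |(Q 0).re| * r ^ B := by gcongr
          _ = _ := by ring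
      rw [← mul_assoc] at h5
      exact le_of_mul_le_mul_right h5 (by linarith)
    by_contra hne
    have hc0 : 0 < c := norm_pos_iff.2 hne
    have h6 := (tendsto_id.const_mul_atTop hc0).eventually_gt_atTop (4 * C + 2 * |(Q 0).re|)
    obtain ⟨r, hr1, hr2⟩ := (h1.and h6).exists
    simp only [id] at hr2
    linarith
  refine ⟨∑ n ∈ Finset.range (B + 1), Polynomial.C ((n.factorial : ℂ)⁻¹ * iteratedDeriv n Q 0) *
    Polynomial.X ^ n, fun z => ?_⟩
  rw [← Complex.taylorSeries_eq_of_entire' 0 z hQ, tsum_eq_sum (s := Finset.range (B + 1))]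
  · simp [Polynomial.eval_finsetSum]
  · intro n hn
    rw [hz n (by simpa using hn), zero_mul]

/-- An entire function without zeros is the exponential of an entire function. -/
lemma exists_differentiable_eq_exp {g : ℂ → ℂ} (hg : Differentiable ℂ g) (h0 : ∀ z, g z ≠ 0) :
    ∃ Q : ℂ → ℂ, Differentiable ℂ Q ∧ ∀ z, g z = Complex.exp (Q z) := by
  have hd : Differentiable ℂ fun z => deriv g z / g z := hg.deriv.div hg h0
  obtain ⟨G, hG⟩ := hd.isExactOn_univ
  have hG' : ∀ z, HasDerivAt G (deriv g z / g z) z := fun z => hG z (mem_univ z)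
  have hc : ∀ z, g z * Complex.exp (-G z) = g 0 * Complex.exp (-G 0) := by
    have hder : ∀ z, HasDerivAt (fun z => g z * Complex.exp (-G z)) 0 z := by
      intro z
      refine ((hg z).hasDerivAt.mul (hG' z).neg.cexp).congr_deriv ?_
      have := h0 z
      field_simp
      ring
    intro z
    exact is_const_of_deriv_eq_zero (fun z => (hder z).differentiableAt) (fun z => (hder z).deriv) z 0
  refine ⟨fun z => G z + Complex.log (g 0 * Complex.exp (-G 0)), fun z => ?_, fun z => ?_⟩
  · exact ((hG' z).differentiableAt).add_const _
  · rw [Complex.exp_add, Complex.exp_log (mul_ne_zero (h0 0) (Complex.exp_ne_zero _)), ← hc z,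
      mul_left_comm, ← Complex.exp_add, add_neg_cancel, Complex.exp_zero, mul_one]

/-! ### From logarithmic counting functions to summability -/

open Function.locallyFinsuppWithin in
-- A point z contributes D(z) log(r/‖z‖) to the counting function, at least D(z) log 2 when 2‖z‖ ≤
-- r; all other contributions are nonnegative because r ≥ 1.
lemma log_two_mul_sum_le_logCounting {D : Function.locallyFinsupp ℂ ℤ} (hD : 0 ≤ D) {r : ℝ}
    (hr : 1 ≤ r) {S : Finset ℂ} (hS : ∀ z ∈ S, z ≠ 0 ∧ 2 * ‖z‖ ≤ r) :
    Real.log 2 * ∑ z ∈ S, (D z : ℝ) ≤ logCounting D r := by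
  have hr0 : |r| = r := abs_of_pos (by linarith)
  have hfin : (toClosedBall r D).support.Finite :=
    Function.locallyFinsuppWithin.finiteSupport _ (isCompact_closedBall 0 |r|)
  have hDz : ∀ z, 0 ≤ (D z : ℝ) := fun z => by exact_mod_cast hD z
  have hbd : ∀ z, 0 ≤ (toClosedBall r D z : ℝ) * Real.log (r * ‖z‖⁻¹) := by
    intro z
    by_cases hz : z ∈ Metric.closedBall (0 : ℂ) |r|
    · rw [toClosedBall_eval_within D hz]
      refine mul_nonneg (hDz z) ?_
      rcases eq_or_ne z 0 with rfl | h0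
      · simp
      · have h1 : 0 < ‖z‖ := norm_pos_iff.2 h0
        refine Real.log_nonneg ?_
        rw [← div_eq_mul_inv, le_div_iff₀ h1]
        simpa [hr0] using hz
    · rw [Function.locallyFinsuppWithin.apply_eq_zero_of_notMem _ hz]
      simp
  have h1 : ∑ z ∈ S, (D z : ℝ) * Real.log 2 ≤
      ∑ᶠ z, (toClosedBall r D z : ℝ) * Real.log (r * ‖z‖⁻¹) := by
    rw [finsum_eq_sum_of_support_subset (s := S ∪ hfin.toFinset)]
    · refine le_trans ?_ (Finset.sum_le_sum_of_subset_of_nonneg Finset.subset_union_left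
        fun z _ _ => hbd z)
      refine Finset.sum_le_sum fun z hz => ?_
      obtain ⟨h0, h2⟩ := hS z hz
      have h3 : 0 < ‖z‖ := norm_pos_iff.2 h0
      rw [toClosedBall_eval_within D (by rw [hr0]; simp; linarith)]
      refine mul_le_mul_of_nonneg_left (Real.log_le_log (by norm_num) ?_) (hDz z)
      rw [← div_eq_mul_inv, le_div_iff₀ h3]
      exact h2
    · intro z hz
      have : toClosedBall r D z ≠ 0 := by
        intro h
        simp [h] at hz
      simp [this]
  have h2 : 0 ≤ (D 0 : ℝ) * Real.log r := mul_nonneg (hDz 0) (Real.log_nonneg hr)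
  rw [mul_comm, Finset.sum_mul]
  refine h1.trans ?_
  simpa [logCounting] using h2

/-- Dyadic decomposition: the shell where ρ lies between 2^k and 2^(k+1) contributes at most C
2^(kA) / 2^(k(A+1)) = C 2^(-k), and these bounds sum to 2C. -/
lemma summable_div_pow_of_sum_le {ι : Type*} {n ρ : ι → ℝ} (hn : ∀ i, 0 ≤ n i)
    (hρ : ∀ i, 1 ≤ ρ i) {C : ℝ} {A : ℕ}
    (h : ∀ k : ℕ, ∀ S : Finset ι, (∀ i ∈ S, ρ i ≤ 2 ^ (k + 1)) → ∑ i ∈ S, n i ≤ C * 2 ^ (k * A)) :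
    Summable fun i => n i / ρ i ^ (A + 1) := by
  classical
  have hC : 0 ≤ C := by simpa using h 0 ∅ (by simp)
  have hρ0 : ∀ i, 0 < ρ i := fun i => by linarith [hρ i]
  refine summable_of_sum_le (c := C * 2) (fun i => div_nonneg (hn i) (pow_pos (hρ0 i) _).le)
    fun S => ?_
  set κ : ι → ℕ := fun i => Nat.log 2 ⌊ρ i⌋₊
  have hκ1 : ∀ i, (2 : ℝ) ^ κ i ≤ ρ i := fun i => by
    have h1 : ⌊ρ i⌋₊ ≠ 0 := (Nat.floor_pos.2 (hρ i)).ne'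
    refine le_trans ?_ (Nat.floor_le (hρ0 i).le)
    exact_mod_cast Nat.pow_log_le_self 2 h1
  have hκ2 : ∀ i, ρ i ≤ (2 : ℝ) ^ (κ i + 1) := fun i => by
    refine (Nat.lt_floor_add_one (ρ i)).le.trans ?_
    exact_mod_cast Nat.lt_pow_succ_log_self (by norm_num) ⌊ρ i⌋₊
  rw [← Finset.sum_fiberwise_of_maps_to (s := S) (t := S.image κ) (g := κ)
    fun i hi => Finset.mem_image_of_mem κ hi]
  have h1 : ∀ k ∈ S.image κ, ∑ i ∈ S with κ i = k, n i / ρ i ^ (A + 1) ≤ C * (1 / 2) ^ k := by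
    intro k _
    calc ∑ i ∈ S with κ i = k, n i / ρ i ^ (A + 1)
        ≤ ∑ i ∈ S with κ i = k, n i * ((2 : ℝ) ^ (k * (A + 1)))⁻¹ := by
          refine Finset.sum_le_sum fun i hi => ?_
          rw [Finset.mem_filter] at hi
          rw [div_eq_mul_inv, pow_mul, ← hi.2]
          have := hκ1 i
          have := hn i
          gcongr
      _ = (∑ i ∈ S with κ i = k, n i) * ((2 : ℝ) ^ (k * (A + 1)))⁻¹ := by rw [Finset.sum_mul]
      _ ≤ (C * 2 ^ (k * A)) * ((2 : ℝ) ^ (k * (A + 1)))⁻¹ := by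
          refine mul_le_mul_of_nonneg_right (h k _ fun i hi => ?_) (by positivity)
          rw [Finset.mem_filter] at hi
          rw [← hi.2]
          exact hκ2 i
      _ = C * (1 / 2) ^ k := by
          rw [mul_add, pow_add, mul_one, one_div, inv_pow]
          field_simp
  refine (Finset.sum_le_sum h1).trans ?_
  rw [← Finset.mul_sum]
  refine mul_le_mul_of_nonneg_left ?_ hC
  refine (summable_geometric_two.sum_le_tsum _ fun _ _ => by positivity).trans ?_
  rw [tsum_geometric_two]

/-! ### The divisor of a meromorphic function -/

section Divisor

variable {f : ℂ → ℂ}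

lemma divisor_univ_apply (hf : Meromorphic f) (z : ℂ) :
    MeromorphicOn.divisor f univ z = mult f z := by
  rw [MeromorphicOn.divisor_apply (fun z _ => hf z) (mem_univ z)]
  rfl

lemma finite_divisorSet_inter_closedBall (hf : Meromorphic f) (R : ℝ) :
    (divisorSet f ∩ Metric.closedBall 0 R).Finite := by
  refine ((Function.locallyFinsuppWithin.toClosedBall R (MeromorphicOn.divisor f univ)).finiteSupport
    (isCompact_closedBall 0 |R|)).subset fun z hz => ?_
  have hz2 : z ∈ Metric.closedBall (0 : ℂ) |R| := Metric.closedBall_subset_closedBall (le_abs_self R) hz.2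
  rw [Function.mem_support, Function.locallyFinsuppWithin.toClosedBall_eval_within _ hz2,
    divisor_univ_apply hf]
  exact hz.1

lemma tendsto_norm_sub_divisorSet (hf : Meromorphic f) (σ : ℂ) (s : Set ℂ) (hs : s ⊆ divisorSet f) :
    Tendsto (fun ρ : s => ‖(ρ : ℂ) - σ‖) cofinite atTop := by
  rw [tendsto_atTop]
  intro R
  rw [eventually_cofinite]
  refine Finite.of_finite_image (f := Subtype.val) ((finite_divisorSet_inter_closedBall hf
    (R + ‖σ‖)).subset ?_) Subtype.val_injective.injOn
  rintro _ ⟨ρ, hρ, rfl⟩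
  refine ⟨hs ρ.2, ?_⟩
  simp only [mem_ofPred_eq, not_le] at hρ
  rw [mem_closedBall_zero_iff]
  have := norm_sub_norm_le (ρ : ℂ) σ
  linarith

lemma exists_characteristic_le (h : HasFiniteOrder f) :
    ∃ C : ℝ, ∃ A : ℕ, ∃ r₀ : ℝ, 0 ≤ C ∧ 1 ≤ r₀ ∧
      ∀ r, r₀ ≤ r → ValueDistribution.characteristic f ⊤ r ≤ C * r ^ A := by
  obtain ⟨A, hA⟩ := h
  obtain ⟨C, hC⟩ := hA.bound
  obtain ⟨r₀, hr₀⟩ := eventually_atTop.1 hC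
  obtain ⟨N, hN⟩ := exists_nat_ge A
  refine ⟨|C|, N, max r₀ 1, abs_nonneg _, le_max_right _ _, fun r hr => ?_⟩
  have h1 : 1 ≤ r := (le_max_right _ _).trans hr
  have h2 := hr₀ r ((le_max_left _ _).trans hr)
  refine (le_abs_self _).trans (h2.trans ?_)
  rw [Real.norm_of_nonneg (Real.rpow_nonneg (by linarith) _), ← Real.rpow_natCast]
  refine mul_le_mul (le_abs_self C) (Real.rpow_le_rpow_of_exponent_le h1 hN)
    (Real.rpow_nonneg (by linarith) _) (abs_nonneg _)

open ValueDistribution in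
-- The pole count is part of T(r, f) and the zero count is part of T(r, 1/f); by the first main
-- theorem the two characteristics differ by at most the constant M.
lemma exists_logCounting_le (hf : Meromorphic f) (h : HasFiniteOrder f) :
    ∃ C : ℝ, ∃ A : ℕ, ∃ r₀ : ℝ, 0 ≤ C ∧ 1 ≤ r₀ ∧
      ∀ r, r₀ ≤ r → logCounting f 0 r + logCounting f ⊤ r ≤ C * r ^ A := by
  obtain ⟨C, A, r₀, hC, hr₀, hb⟩ := exists_characteristic_le h
  set M := max |Real.log ‖f 0‖| |Real.log ‖meromorphicTrailingCoeffAt f 0‖| with hM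
  refine ⟨2 * C + M, A, r₀, by positivity, hr₀, fun r hr => ?_⟩
  have h1 : 1 ≤ r ^ A := one_le_pow₀ (hr₀.trans hr)
  have h2 : logCounting f ⊤ r ≤ characteristic f ⊤ r := by
    have : 0 ≤ proximity f ⊤ r := proximity_nonneg r
    simp only [characteristic, Pi.add_apply]
    linarith
  have h3 : logCounting f 0 r ≤ characteristic f⁻¹ ⊤ r := by
    have : 0 ≤ proximity f⁻¹ ⊤ r := proximity_nonneg r
    simp only [characteristic, Pi.add_apply, logCounting_inv]
    linarith
  have h4 := (abs_le.1 (characteristic_sub_characteristic_inv_le hf (R := r))).1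
  have h5 := hb r hr
  have h6 : M ≤ M * r ^ A := le_mul_of_one_le_right (le_max_of_le_left (abs_nonneg _)) h1
  linarith

lemma exists_sum_abs_mult_le (hf : Meromorphic f) (h : HasFiniteOrder f) :
    ∃ C : ℝ, ∃ A : ℕ, ∀ k : ℕ, ∀ S : Finset ℂ, (∀ z ∈ S, z ≠ 0 ∧ ‖z‖ ≤ 2 ^ (k + 1)) →
      ∑ z ∈ S, |(mult f z : ℝ)| ≤ C * 2 ^ (k * A) := by
  obtain ⟨C, A, r₀, hC, hr₀, hb⟩ := exists_logCounting_le hf h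
  obtain ⟨k₀, hk₀⟩ := pow_unbounded_of_one_lt r₀ (one_lt_two)
  refine ⟨(Real.log 2)⁻¹ * (C * 2 ^ ((k₀ + 2) * A)), A, fun k S hS => ?_⟩
  set D := MeromorphicOn.divisor f univ with hD
  -- The summand k₀ pushes the radius beyond r₀; the summand 2 guarantees that it is at least 2‖z‖
  -- for every z in S.
  have hr : r₀ ≤ 2 ^ (k + k₀ + 2) :=
    hk₀.le.trans (pow_le_pow_right₀ one_le_two (by omega))
  -- The positive part counts zeros and the negative part counts poles, so the sum takes the value
  -- |n_ρ| at ρ.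
  have h1 := log_two_mul_sum_le_logCounting (D := D⁺ + D⁻)
    (add_nonneg (posPart_nonneg _) (negPart_nonneg _)) (hr₀.trans hr) (S := S) (fun z hz =>
      ⟨(hS z hz).1, by
        have : (2 : ℝ) ^ (k + 1) ≤ 2 ^ (k + k₀ + 1) := pow_le_pow_right₀ one_le_two (by omega)
        have := (hS z hz).2
        rw [pow_succ _ (k + k₀ + 1)]
        linarith⟩)
  rw [map_add, Pi.add_apply, hD, ← ValueDistribution.logCounting_zero,
    ← ValueDistribution.logCounting_top] at h1
  have h2 := h1.trans (hb _ hr)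
  have h3 : ∀ z, (((D⁺ + D⁻) z : ℤ) : ℝ) = |(mult f z : ℝ)| := by
    intro z
    rw [← divisor_univ_apply hf z, ← hD, ← Int.cast_abs, Function.locallyFinsuppWithin.coe_add,
      Pi.add_apply, Function.locallyFinsuppWithin.posPart_apply,
      Function.locallyFinsuppWithin.negPart_apply, posPart_add_negPart]
  simp only [← hD, h3] at h2
  have hlog : 0 < Real.log 2 := Real.log_pos one_lt_two
  rw [mul_assoc, le_inv_mul_iff₀ hlog]
  refine h2.trans (le_of_eq ?_)
  rw [← pow_mul, add_assoc, add_mul, pow_add]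
  ring

lemma exists_summable_mult_div_pow (hf : Meromorphic f) (h : HasFiniteOrder f) :
    ∃ d : ℕ, Summable fun ρ : ↥(divisorSet f \ {0}) => |(mult f ρ : ℝ)| / ‖(ρ : ℂ)‖ ^ d := by
  obtain ⟨C, A, hb⟩ := exists_sum_abs_mult_le hf h
  refine ⟨A + 1, ?_⟩
  -- The dyadic lemma needs sizes at least 1; replacing ‖ρ‖ by its maximum with 1 changes only
  -- finitely many terms.
  have h1 := summable_div_pow_of_sum_le (ι := ↥(divisorSet f \ {0}))
    (n := fun ρ => |(mult f ρ : ℝ)|) (ρ := fun ρ => max ‖(ρ : ℂ)‖ 1) (fun _ => abs_nonneg _)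
    (fun _ => le_max_right _ _) (C := C) (A := A) (fun k S hS => by
      have := hb k (S.map (Function.Embedding.subtype _)) (fun z hz => by
        obtain ⟨ρ, hρ, rfl⟩ := Finset.mem_map.1 hz
        exact ⟨ρ.2.2, (le_max_left _ _).trans (hS ρ hρ)⟩)
      simpa using this)
  refine h1.of_norm_bounded_eventually ?_
  have := tendsto_norm_sub_divisorSet hf 0 (divisorSet f \ {0}) sdiff_subset
  filter_upwards [this.eventually_ge_atTop 1] with ρ hρ
  rw [sub_zero] at hρ
  rw [max_eq_left hρ, Real.norm_of_nonneg (by positivity)]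

/-- Finite order makes the set of admissible exponents nonempty, so the infimum is attained and is
not the default value 0 of `sInf ∅`. -/
lemma summable_convergenceExponent (hf : Meromorphic f) (h : HasFiniteOrder f) :
    Summable fun ρ : ↥(divisorSet f \ {0}) =>
      |(mult f ρ : ℝ)| / ‖(ρ : ℂ)‖ ^ convergenceExponent f :=
  Nat.sInf_mem (s := {d : ℕ | Summable fun ρ : ↥(divisorSet f \ {0}) =>
    |(mult f ρ : ℝ)| / ‖(ρ : ℂ)‖ ^ d}) (exists_summable_mult_div_pow hf h)

/-- Outside a finite part of the divisor ‖ρ‖ ≤ 2‖ρ - σ‖, so the origin can be moved to σ. Indicators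
on ℂ are used because the two sums omit different points. -/
lemma summable_mult_div_norm_sub_pow (hf : Meromorphic f) (h : HasFiniteOrder f) (σ : ℂ) {p : ℕ}
    (hp : convergenceExponent f ≤ p) :
    Summable fun ρ : ↥(divisorSet f \ {σ}) => |(mult f ρ : ℝ)| / ‖(ρ : ℂ) - σ‖ ^ p := by
  have h1 := summable_convergenceExponent hf h
  replace h1 := (summable_subtype_iff_indicator (f := fun ρ : ℂ => |(mult f ρ : ℝ)| /
    ‖ρ‖ ^ convergenceExponent f)).1 h1
  refine (summable_subtype_iff_indicator (f := fun ρ : ℂ =>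
    |(mult f ρ : ℝ)| / ‖ρ - σ‖ ^ p)).2 ?_
  refine (h1.mul_left (2 ^ p)).of_norm_bounded_eventually ?_
  have hfin := finite_divisorSet_inter_closedBall hf (2 * ‖σ‖ + 1)
  filter_upwards [hfin.compl_mem_cofinite] with ρ hρ
  by_cases hρD : ρ ∈ divisorSet f
  · have h2 : 2 * ‖σ‖ + 1 < ‖ρ‖ := by
      by_contra hcon
      exact hρ ⟨hρD, by simpa using hcon⟩
    have h0 := norm_nonneg σ
    have h3 : ρ ≠ 0 := norm_pos_iff.1 (by linarith)
    have h4 : ρ ≠ σ := by rintro rfl; linarith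
    have h5 := norm_sub_norm_le ρ σ
    rw [indicator_of_mem (show ρ ∈ divisorSet f \ {σ} from ⟨hρD, h4⟩),
      indicator_of_mem (show ρ ∈ divisorSet f \ {0} from ⟨hρD, h3⟩),
      Real.norm_of_nonneg (by positivity), mul_div_assoc', div_le_div_iff₀
        (pow_pos (by linarith) _) (pow_pos (by linarith) _)]
    have h6 : ‖ρ‖ ^ convergenceExponent f ≤ (2 * ‖ρ - σ‖) ^ p :=
      (pow_le_pow_right₀ (by linarith) hp).trans (pow_le_pow_left₀ (by linarith) (by linarith) _)
    rw [mul_pow] at h6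
    calc _ ≤ |(mult f ρ : ℝ)| * (2 ^ p * ‖ρ - σ‖ ^ p) := by gcongr
      _ = _ := by ring
  · rw [indicator_of_notMem (fun h => hρD h.1), indicator_of_notMem (fun h => hρD h.1)]
    simp

end Divisor

/-! ### Hadamard factorization -/

/-! ### Characteristics of entire functions -/

section Entire

open ValueDistribution

lemma logCounting_top_of_differentiable {g : ℂ → ℂ} (hg : Differentiable ℂ g) :
    logCounting g ⊤ = 0 := by
  have han : AnalyticOnNhd ℂ g univ := fun z _ => hg.analyticAt z
  rw [logCounting_top, negPart_eq_zero.2 (MeromorphicOn.AnalyticOnNhd.divisor_nonneg han), map_zero]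

lemma characteristic_top_le_of_norm_le {g : ℂ → ℂ} (hg : Differentiable ℂ g) {r M : ℝ}
    (hM : 0 ≤ M) (h : ∀ z, ‖z‖ = |r| → ‖g z‖ ≤ Real.exp M) : characteristic g ⊤ r ≤ M := by
  have hmer : Meromorphic g := fun z => (hg.analyticAt z).meromorphicAt
  rw [characteristic, Pi.add_apply, logCounting_top_of_differentiable hg, Pi.zero_apply, add_zero,
    proximity_top]
  refine Real.circleAverage_mono_on_of_le_circle ?_ fun z hz => ?_
  · exact (MeromorphicOn.circleIntegrable_posLog_norm fun z _ => hmer z)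
  · rw [Real.posLog_def]
    refine max_le hM ?_
    rcases eq_or_ne (g z) 0 with h0 | h0
    · simpa [h0] using hM
    · rw [Real.log_le_iff_le_exp (norm_pos_iff.2 h0)]
      exact h z (by simpa using hz)

lemma exists_characteristic_inv_le {g : ℂ → ℂ} (hg : Differentiable ℂ g) :
    ∃ c : ℝ, ∀ r, characteristic g⁻¹ ⊤ r ≤ characteristic g ⊤ r + c := by
  have hmer : Meromorphic g := fun z => (hg.analyticAt z).meromorphicAt
  refine ⟨max |Real.log ‖g 0‖| |Real.log ‖meromorphicTrailingCoeffAt g 0‖|, fun r => ?_⟩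
  have := (abs_le.1 (characteristic_sub_characteristic_inv_le hmer (R := r))).1
  linarith

/-- Here log⁺ |e^Q| = max (Re Q) 0, so the average is exactly the proximity function. -/
lemma circleAverage_max_re_le_characteristic {Q g : ℂ → ℂ} (hg : ∀ z, g z = Complex.exp (Q z))
    {r : ℝ} (hr : 1 ≤ r) :
    Real.circleAverage (fun z => max (Q z).re 0) 0 r ≤ characteristic g ⊤ r := by
  have h1 : 0 ≤ logCounting g ⊤ r := logCounting_nonneg hr
  have h2 : Real.circleAverage (fun z => max (Q z).re 0) 0 r = proximity g ⊤ r := by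
    rw [proximity_top]
    congr 1
    ext z
    change _ = max 0 (Real.log ‖g z‖)
    rw [hg, Complex.norm_exp, Real.log_exp, max_comm]
  rw [h2, characteristic, Pi.add_apply]
  linarith

end Entire

/-! ### Canonical products and the factorization -/

section Hadamard

variable {f : ℂ → ℂ} {σ : ℂ}

/-- The entire function `(s - σ)^{k_σ} ∏_{ρ ≠ σ} E_m((s - σ)/(ρ - σ))^{k_ρ}`, the product being
over the divisor of `f`. -/
def canonicalProduct (f : ℂ → ℂ) (σ : ℂ) (k : ℂ → ℕ) (s : ℂ) : ℂ :=
  (s - σ) ^ k σ * weierstrassProduct (convergenceExponent f - 1)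
    (fun ρ : ↥(divisorSet f \ {σ}) => (ρ : ℂ) - σ) (fun ρ => k ρ) (s - σ)

/-- With truncated subtraction the exponent is max d 1, at least d in every case. The products
therefore converge before d ≥ 1 is known, which the proof of d ≥ 1 relies on. -/
lemma summable_natCast_div (hf : Meromorphic f) (h : HasFiniteOrder f) (σ : ℂ) {k : ℂ → ℕ}
    (hk : ∀ s, (k s : ℝ) ≤ |(mult f s : ℝ)|) :
    Summable fun ρ : ↥(divisorSet f \ {σ}) =>
      (k ρ : ℝ) / ‖(ρ : ℂ) - σ‖ ^ (convergenceExponent f - 1 + 1) := by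
  refine (summable_mult_div_norm_sub_pow hf h σ
    (show convergenceExponent f ≤ convergenceExponent f - 1 + 1 by omega)).of_nonneg_of_le
    (fun ρ => by positivity) fun ρ => ?_
  have := hk ρ
  gcongr

lemma tendsto_norm_sub (hf : Meromorphic f) (σ : ℂ) :
    Tendsto (fun ρ : ↥(divisorSet f \ {σ}) => ‖(ρ : ℂ) - σ‖) cofinite atTop :=
  tendsto_norm_sub_divisorSet hf σ _ sdiff_subset

lemma differentiable_canonicalProduct (hf : Meromorphic f) (h : HasFiniteOrder f) {k : ℂ → ℕ}
    (hk : ∀ s, (k s : ℝ) ≤ |(mult f s : ℝ)|) : Differentiable ℂ (canonicalProduct f σ k) := by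
  have := differentiable_weierstrassProduct (tendsto_norm_sub hf σ) (summable_natCast_div hf h σ hk)
  unfold canonicalProduct
  fun_prop

lemma weierstrassProduct_sub_ne_zero (hf : Meromorphic f) (h : HasFiniteOrder f) {k : ℂ → ℕ}
    (hk : ∀ s, (k s : ℝ) ≤ |(mult f s : ℝ)|) {s : ℂ} (hs : s = σ ∨ k s = 0) :
    weierstrassProduct (convergenceExponent f - 1)
      (fun ρ : ↥(divisorSet f \ {σ}) => (ρ : ℂ) - σ) (fun ρ => k ρ) (s - σ) ≠ 0 := by
  refine weierstrassProduct_ne_zero (tendsto_norm_sub hf σ) (summable_natCast_div hf h σ hk)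
    fun ρ hρ => ?_
  have hρσ : (ρ : ℂ) - σ ≠ 0 := sub_ne_zero.2 ρ.2.2
  rw [ne_eq, div_eq_one_iff_eq hρσ, sub_left_inj]
  rintro rfl
  rcases hs with hs | hs
  · exact ρ.2.2 hs
  · exact hρ hs

lemma canonicalProduct_ne_zero (hf : Meromorphic f) (h : HasFiniteOrder f) {k : ℂ → ℕ}
    (hk : ∀ s, (k s : ℝ) ≤ |(mult f s : ℝ)|) {s : ℂ} (hs : k s = 0) :
    canonicalProduct f σ k s ≠ 0 := by
  refine mul_ne_zero ?_ (weierstrassProduct_sub_ne_zero hf h hk (Or.inr hs))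
  rcases eq_or_ne s σ with rfl | hne
  · simp [hs]
  · exact pow_ne_zero _ (sub_ne_zero.2 hne)

lemma meromorphicOrderAt_canonicalProduct (hf : Meromorphic f) (h : HasFiniteOrder f) {k : ℂ → ℕ}
    (hk : ∀ s, (k s : ℝ) ≤ |(mult f s : ℝ)|) (s : ℂ) :
    meromorphicOrderAt (canonicalProduct f σ k) s = k s := by
  have hd := differentiable_weierstrassProduct (tendsto_norm_sub hf σ)
    (summable_natCast_div hf h σ hk)
  by_cases hs : k s = 0
  · have han := (differentiable_canonicalProduct (σ := σ) hf h hk).analyticAt s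
    rw [han.meromorphicNFAt.meromorphicOrderAt_eq_zero_iff.2 (canonicalProduct_ne_zero hf h hk hs),
      hs]
    rfl
  rcases eq_or_ne s σ with rfl | hne
  · have : canonicalProduct f s k = (fun z => weierstrassProduct (convergenceExponent f - 1)
        (fun ρ : ↥(divisorSet f \ {s}) => (ρ : ℂ) - s) (fun ρ => k ρ) (z - s)) *
          fun z => (z - s) ^ k s := by
      ext z
      exact mul_comm _ _
    rw [this, meromorphicOrderAt_mul_of_ne_zero, fun_meromorphicOrderAt_pow_id_sub_const]
    · exact (hd.comp (differentiable_id.sub_const s)).analyticAt s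
    · exact weierstrassProduct_sub_ne_zero hf h hk (Or.inl rfl)
  · have hsD : s ∈ divisorSet f \ {σ} := by
      refine ⟨fun h0 => hs ?_, hne⟩
      have := hk s
      rw [h0] at this
      simp only [Int.cast_zero, abs_zero] at this
      exact_mod_cast le_antisymm this (Nat.cast_nonneg _)
    have : canonicalProduct f σ k = (fun z => (z - σ) ^ k σ) *
        fun z => weierstrassProduct (convergenceExponent f - 1)
        (fun ρ : ↥(divisorSet f \ {σ}) => (ρ : ℂ) - σ) (fun ρ => k ρ) (z - σ) := rfl
    rw [this, meromorphicOrderAt_mul_of_ne_zero]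
    · refine (meromorphicOrderAt_comp_sub_const_eq_meromorphicOrderAt (c := σ)
        (f := weierstrassProduct (convergenceExponent f - 1)
        (fun ρ : ↥(divisorSet f \ {σ}) => (ρ : ℂ) - σ) (fun ρ => k ρ)) (x := s)).trans ?_
      exact meromorphicOrderAt_weierstrassProduct (tendsto_norm_sub hf σ)
        (summable_natCast_div hf h σ hk) (fun a b hab => Subtype.ext (sub_left_injective hab))
        (i := ⟨s, hsD⟩) (sub_ne_zero.2 hne)
    · exact Differentiable.analyticAt (by fun_prop) s
    · exact pow_ne_zero _ (sub_ne_zero.2 hne)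

open ValueDistribution in
lemma exists_characteristic_canonicalProduct_le (hf : Meromorphic f) (h : HasFiniteOrder f)
    {k : ℂ → ℕ} (hk : ∀ s, (k s : ℝ) ≤ |(mult f s : ℝ)|) :
    ∃ C : ℝ, ∃ A : ℕ, 0 ≤ C ∧
      ∀ r, 1 ≤ r → characteristic (canonicalProduct f σ k) ⊤ r ≤ C * r ^ A := by
  set m := convergenceExponent f - 1 with hm
  have hs := summable_natCast_div hf h σ hk
  set T := ∑' ρ : ↥(divisorSet f \ {σ}), (k ρ : ℝ) / ‖(ρ : ℂ) - σ‖ ^ (m + 1) with hT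
  have hT0 : 0 ≤ T := tsum_nonneg fun _ => by positivity
  have hc0 := factorConst_nonneg m
  -- The power of z - σ costs k σ and the product costs the other term, both measured against ((1 +
  -- ‖σ‖) r)^(m+1).
  set K := k σ + factorConst m * T with hK
  have hK0 : 0 ≤ K := by positivity
  refine ⟨K * (1 + ‖σ‖) ^ (m + 1), m + 1, by positivity, fun r hr => ?_⟩
  have hr0 : 0 ≤ r := by linarith
  refine characteristic_top_le_of_norm_le (differentiable_canonicalProduct hf h hk)
    (by positivity) fun z hz => ?_
  rw [abs_of_nonneg hr0] at hz
  have h1 : ‖z - σ‖ ≤ (1 + ‖σ‖) * r := by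
    refine (norm_sub_le _ _).trans ?_
    rw [hz]
    nlinarith [norm_nonneg σ]
  have h2 : 1 ≤ (1 + ‖σ‖) * r := one_le_mul_of_one_le_of_one_le (by linarith [norm_nonneg σ]) hr
  have h3 : ‖z - σ‖ ^ (m + 1) ≤ ((1 + ‖σ‖) * r) ^ (m + 1) := by gcongr
  have h4 : ‖z - σ‖ ≤ ((1 + ‖σ‖) * r) ^ (m + 1) := by
    refine h1.trans ?_
    rw [pow_succ]
    exact le_mul_of_one_le_left (by linarith) (one_le_pow₀ h2)
  rw [canonicalProduct, norm_mul, norm_pow]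
  have h5 : ‖z - σ‖ ^ k σ ≤ Real.exp (k σ * ((1 + ‖σ‖) * r) ^ (m + 1)) := by
    have : ‖z - σ‖ ≤ Real.exp (((1 + ‖σ‖) * r) ^ (m + 1)) :=
      h4.trans (by linarith [Real.add_one_le_exp (((1 + ‖σ‖) * r) ^ (m + 1))])
    rw [Real.exp_nat_mul]
    gcongr
  have h6 := norm_weierstrassProduct_le (tendsto_norm_sub hf σ) hs (z - σ)
  refine (mul_le_mul h5 h6 (norm_nonneg _) (Real.exp_nonneg _)).trans ?_
  rw [← Real.exp_add, Real.exp_le_exp, ← hT]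
  calc _ ≤ (k σ : ℝ) * ((1 + ‖σ‖) * r) ^ (m + 1) +
        factorConst m * T * ((1 + ‖σ‖) * r) ^ (m + 1) := by gcongr
    _ = _ := by rw [hK, mul_pow]; ring

/-- The multiplicities of the zeros. -/
def zeroMult (f : ℂ → ℂ) (s : ℂ) : ℕ := (mult f s).toNat

/-- The multiplicities of the poles. -/
def poleMult (f : ℂ → ℂ) (s : ℂ) : ℕ := (-mult f s).toNat

lemma zeroMult_le (f : ℂ → ℂ) (s : ℂ) : (zeroMult f s : ℝ) ≤ |(mult f s : ℝ)| := by
  rw [← Int.cast_abs]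
  have : (zeroMult f s : ℤ) ≤ |mult f s| := by
    have h1 := le_abs_self (mult f s)
    have h2 := neg_le_abs (mult f s)
    unfold zeroMult
    omega
  exact_mod_cast this

lemma poleMult_le (f : ℂ → ℂ) (s : ℂ) : (poleMult f s : ℝ) ≤ |(mult f s : ℝ)| := by
  rw [← Int.cast_abs]
  have : (poleMult f s : ℤ) ≤ |mult f s| := by
    have h1 := le_abs_self (mult f s)
    have h2 := neg_le_abs (mult f s)
    unfold poleMult
    omega
  exact_mod_cast this

lemma zeroMult_sub_poleMult (f : ℂ → ℂ) (s : ℂ) :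
    (zeroMult f s : ℤ) - poleMult f s = mult f s := by
  unfold zeroMult poleMult
  omega

lemma mult_eq_zero_of_analyticAt {s : ℂ} (ha : AnalyticAt ℂ f s) (h0 : f s ≠ 0) :
    mult f s = 0 := by
  rw [mult, ha.meromorphicNFAt.meromorphicOrderAt_eq_zero_iff.2 h0]
  rfl

lemma hasProd_weierstrassFactor_zpow (hf : Meromorphic f) (h : HasFiniteOrder f) {s : ℂ}
    (hs : mult f s = 0) :
    HasProd (fun ρ : ↥(divisorSet f \ {σ}) =>
      weierstrassFactor (convergenceExponent f - 1) ((s - σ) / ((ρ : ℂ) - σ)) ^ mult f ρ)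
      (weierstrassProduct (convergenceExponent f - 1)
        (fun ρ : ↥(divisorSet f \ {σ}) => (ρ : ℂ) - σ) (fun ρ => zeroMult f ρ) (s - σ) /
      weierstrassProduct (convergenceExponent f - 1)
        (fun ρ : ↥(divisorSet f \ {σ}) => (ρ : ℂ) - σ) (fun ρ => poleMult f ρ) (s - σ)) := by
  have h1 := hasProd_weierstrassProduct (tendsto_norm_sub hf σ)
    (summable_natCast_div hf h σ (zeroMult_le f)) (s - σ)
  have h2 := hasProd_weierstrassProduct (tendsto_norm_sub hf σ)
    (summable_natCast_div hf h σ (poleMult_le f)) (s - σ)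
  have h3 := h2.inv₀ (weierstrassProduct_sub_ne_zero hf h (poleMult_le f)
    (Or.inr (by simp [poleMult, hs])))
  rw [div_eq_mul_inv]
  refine (h1.mul h3).congr_fun fun ρ => ?_
  have hne : weierstrassFactor (convergenceExponent f - 1) ((s - σ) / ((ρ : ℂ) - σ)) ≠ 0 := by
    rw [ne_eq, weierstrassFactor_eq_zero_iff, div_eq_one_iff_eq (sub_ne_zero.2 ρ.2.2), sub_left_inj]
    rintro rfl
    exact ρ.2.1 hs
  rw [← zeroMult_sub_poleMult f ρ, zpow_sub₀ hne, zpow_natCast, zpow_natCast, div_eq_mul_inv]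

open ValueDistribution in
/-- The Hadamard factorization of a meromorphic function of finite order. -/
theorem exists_isHadamardExponent (hf : Meromorphic f) (h : HasFiniteOrder f)
    (htop : ∀ z, meromorphicOrderAt f z ≠ ⊤) (σ : ℂ) :
    ∃ Q : Polynomial ℂ, IsHadamardExponent f σ Q := by
  set P := canonicalProduct f σ (zeroMult f) with hP
  set N := canonicalProduct f σ (poleMult f) with hN
  have hPd : Differentiable ℂ P := differentiable_canonicalProduct hf h (zeroMult_le f)
  have hNd : Differentiable ℂ N := differentiable_canonicalProduct hf h (poleMult_le f)
  have hPm : Meromorphic P := fun z => (hPd.analyticAt z).meromorphicAt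
  have hNm : Meromorphic N := fun z => (hNd.analyticAt z).meromorphicAt
  have hPo : ∀ z, meromorphicOrderAt P z = ((zeroMult f z : ℤ) : WithTop ℤ) :=
    meromorphicOrderAt_canonicalProduct hf h (zeroMult_le f)
  have hNo : ∀ z, meromorphicOrderAt N z = ((poleMult f z : ℤ) : WithTop ℤ) :=
    meromorphicOrderAt_canonicalProduct hf h (poleMult_le f)
  -- All zeros and poles cancel, so g₀ has order zero everywhere; its meromorphic normal form G is
  -- entire and zero-free, hence an exponential.
  set g₀ := f * N * P⁻¹ with hg₀
  have hfN : Meromorphic (f * N) := fun z => (hf z).mul (hNm z)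
  have hg₀m : Meromorphic g₀ := fun z => (hfN z).mul (hPm z).inv
  have hg₀o : ∀ z, meromorphicOrderAt g₀ z = 0 := by
    intro z
    rw [hg₀, meromorphicOrderAt_mul (hfN z) (hPm z).inv, meromorphicOrderAt_mul (hf z) (hNm z),
      meromorphicOrderAt_inv, hPo, hNo, ← WithTop.coe_untop₀_of_ne_top (htop z)]
    have h1 := zeroMult_sub_poleMult f z
    rw [mult] at h1
    rw [← h1]
    rw [← WithTop.LinearOrderedAddCommGroup.coe_neg, ← WithTop.coe_add, ← WithTop.coe_add]
    simp
  have hg₀' : MeromorphicOn g₀ univ := fun z _ => hg₀m z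
  set G := toMeromorphicNFOn g₀ univ with hG
  have hGnf : MeromorphicNFOn G univ := meromorphicNFOn_toMeromorphicNFOn g₀ univ
  have hGo : ∀ z, meromorphicOrderAt G z = 0 := fun z => by
    rw [hG, meromorphicOrderAt_toMeromorphicNFOn hg₀' (mem_univ z), hg₀o]
  have hGa : ∀ z, AnalyticAt ℂ G z := fun z =>
    (hGnf (mem_univ z)).meromorphicOrderAt_nonneg_iff_analyticAt.1 (hGo z).ge
  have hG0 : ∀ z, G z ≠ 0 := fun z =>
    (hGnf (mem_univ z)).meromorphicOrderAt_eq_zero_iff.1 (hGo z)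
  obtain ⟨Q, hQd, hQ⟩ := exists_differentiable_eq_exp (fun z => (hGa z).differentiableAt) hG0
  have hGg : g₀ =ᶠ[codiscrete ℂ] G := toMeromorphicNFOn_eqOn_codiscrete hg₀'
  obtain ⟨C₁, A₁, r₁, hC₁, hr₁, hb₁⟩ := exists_characteristic_le h
  obtain ⟨C₂, A₂, hC₂, hb₂⟩ := exists_characteristic_canonicalProduct_le (σ := σ) hf h
    (zeroMult_le f)
  obtain ⟨C₃, A₃, hC₃, hb₃⟩ := exists_characteristic_canonicalProduct_le (σ := σ) hf h
    (poleMult_le f)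
  obtain ⟨c, hc⟩ := exists_characteristic_inv_le hPd
  -- Up to a constant, T(r, e^Q) is at most T(r, f) + T(r, N) + T(r, P), using that the
  -- characteristics of P and 1/P differ boundedly. Each term is polynomially bounded.
  have hbound : ∀ᶠ r in atTop, Real.circleAverage (fun z => max (Q z).re 0) 0 r ≤
      (C₁ + C₂ + C₃ + |c|) * r ^ (A₁ + A₂ + A₃) := by
    filter_upwards [eventually_ge_atTop r₁] with r hr
    have hr1 : 1 ≤ r := hr₁.trans hr
    have hNtop : ∀ z, meromorphicOrderAt N z ≠ ⊤ := fun z => by rw [hNo]; exact WithTop.coe_ne_top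
    have hfNtop : ∀ z, meromorphicOrderAt (f * N) z ≠ ⊤ := fun z => by
      rw [meromorphicOrderAt_mul (hf z) (hNm z)]
      exact WithTop.add_ne_top.2 ⟨htop z, hNtop z⟩
    have hPinv : Meromorphic P⁻¹ := fun z => (hPm z).inv
    have hPinvtop : ∀ z, meromorphicOrderAt P⁻¹ z ≠ ⊤ := fun z => by
      rw [meromorphicOrderAt_inv, hPo]
      exact_mod_cast WithTop.coe_ne_top (a := (-(zeroMult f z : ℤ)))
    have h1 := circleAverage_max_re_le_characteristic hQ hr1
    rw [← characteristic_congr_codiscrete hGg (by linarith)] at h1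
    have h2 := characteristic_mul_top_le hr1 hfN hfNtop hPinv hPinvtop
    have h3 := characteristic_mul_top_le hr1 hf htop hNm hNtop
    rw [Pi.add_apply] at h2 h3
    have h4 := hc r
    have h5 := hb₁ r hr
    have h6 := hb₂ r hr1
    have h7 := hb₃ r hr1
    have hp : ∀ A ≤ A₁ + A₂ + A₃, r ^ A ≤ r ^ (A₁ + A₂ + A₃) := fun A hA =>
      pow_le_pow_right₀ hr1 hA
    have h8 := mul_le_mul_of_nonneg_left (hp A₁ (by omega)) hC₁
    have h9 := mul_le_mul_of_nonneg_left (hp A₂ (by omega)) hC₂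
    have h10 := mul_le_mul_of_nonneg_left (hp A₃ (by omega)) hC₃
    have h11 := mul_le_mul_of_nonneg_left (hp 0 (by omega)) (abs_nonneg c)
    rw [pow_zero, mul_one] at h11
    have h12 := le_abs_self c
    linarith
  obtain ⟨p, hp⟩ := exists_polynomial_of_circleAverage_re_le hQd hbound
  refine ⟨p, fun s hsa hs0 => ?_⟩
  have hm0 : mult f s = 0 := mult_eq_zero_of_analyticAt hsa hs0
  have hprod := hasProd_weierstrassFactor_zpow (σ := σ) hf h hm0
  refine ⟨hprod.multipliable, ?_⟩
  rw [hprod.tprod_eq]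
  have hP0 : P s ≠ 0 := canonicalProduct_ne_zero hf h (zeroMult_le f) (by simp [zeroMult, hm0])
  have hN0 : N s ≠ 0 := canonicalProduct_ne_zero hf h (poleMult_le f) (by simp [poleMult, hm0])
  -- Passing to the normal form may change isolated values. At s both functions are continuous, so
  -- their agreement on a punctured neighbourhood extends to s.
  have heq : g₀ s = G s := by
    have hga : AnalyticAt ℂ g₀ s := (hsa.mul (hNd.analyticAt s)).mul ((hPd.analyticAt s).inv hP0)
    have h1 : g₀ =ᶠ[𝓝[≠] s] G :=
      (MeromorphicOn.toMeromorphicNFOn_eq_self_on_nhdsNE hg₀' (mem_univ s)).symm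
    exact ((hga.continuousAt.eventuallyEq_nhds_iff_eventuallyEq_nhdsNE (hGa s).continuousAt).1
      h1).eq_of_nhds
  rw [hQ s, hp s, hg₀, Pi.mul_apply, Pi.mul_apply, Pi.inv_apply, ← div_eq_mul_inv,
    div_eq_iff hP0] at heq
  have hfs : f s = Complex.exp (p.eval s) * P s / N s := by rw [← heq, mul_div_cancel_right₀ _ hN0]
  rw [hfs, hP, hN, canonicalProduct, canonicalProduct]
  have hpow : (s - σ) ^ mult f σ = (s - σ) ^ zeroMult f σ / (s - σ) ^ poleMult f σ := by
    rcases eq_or_ne s σ with rfl | hne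
    · simp [hm0, zeroMult, poleMult]
    · rw [← zeroMult_sub_poleMult f σ, zpow_sub₀ (sub_ne_zero.2 hne), zpow_natCast, zpow_natCast]
  rw [hpow]
  field_simp

/-- The logarithmic derivative of the Hadamard factorization. -/
theorem IsHadamardExponent.hasSum_logDeriv {Q : Polynomial ℂ} (hQ : IsHadamardExponent f σ Q)
    (hf : Meromorphic f) (h : HasFiniteOrder f) {s : ℂ}
    (hs : ∀ᶠ z in 𝓝 s, AnalyticAt ℂ f z ∧ f z ≠ 0) (hsσ : s ≠ σ) :
    HasSum (fun ρ : ↥(divisorSet f \ {σ}) => (mult f ρ : ℂ) *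
        ((s - σ) ^ (convergenceExponent f - 1) /
          (((ρ : ℂ) - σ) ^ (convergenceExponent f - 1) * (s - ρ))))
      (logDeriv f s - (Q.derivative.eval s + mult f σ / (s - σ))) := by
  set m := convergenceExponent f - 1 with hm
  set τ : ↥(divisorSet f \ {σ}) → ℂ := fun ρ => (ρ : ℂ) - σ with hτ
  set P := weierstrassProduct m τ fun ρ => zeroMult f ρ with hP
  set N := weierstrassProduct m τ fun ρ => poleMult f ρ with hN
  have hsP := summable_natCast_div hf h σ (zeroMult_le f)
  have hsN := summable_natCast_div hf h σ (poleMult_le f)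
  have hPd : Differentiable ℂ P := differentiable_weierstrassProduct (tendsto_norm_sub hf σ) hsP
  have hNd : Differentiable ℂ N := differentiable_weierstrassProduct (tendsto_norm_sub hf σ) hsN
  have hs0 : mult f s = 0 := mult_eq_zero_of_analyticAt hs.self_of_nhds.1 hs.self_of_nhds.2
  have hP0 : P (s - σ) ≠ 0 := weierstrassProduct_sub_ne_zero hf h (zeroMult_le f)
    (Or.inr (by simp [zeroMult, hs0]))
  have hN0 : N (s - σ) ≠ 0 := weierstrassProduct_sub_ne_zero hf h (poleMult_le f)
    (Or.inr (by simp [poleMult, hs0]))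
  have hfe : f =ᶠ[𝓝 s] fun z => (z - σ) ^ mult f σ * Complex.exp (Q.eval z) *
      (P (z - σ) / N (z - σ)) := by
    filter_upwards [hs] with z hz
    have h1 := hasProd_weierstrassFactor_zpow (σ := σ) hf h (mult_eq_zero_of_analyticAt hz.1 hz.2)
    rw [(hQ z hz.1 hz.2).2, h1.tprod_eq]
  have hsub : s - σ ≠ 0 := sub_ne_zero.2 hsσ
  have hPs : DifferentiableAt ℂ (fun z => P (z - σ)) s := (hPd.comp (differentiable_id.sub_const σ)) s
  have hNs : DifferentiableAt ℂ (fun z => N (z - σ)) s := (hNd.comp (differentiable_id.sub_const σ)) s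
  have hsd : DifferentiableAt ℂ (fun z => z - σ) s := by fun_prop
  have hed : DifferentiableAt ℂ (fun z => Complex.exp (Q.eval z)) s := Q.differentiable.cexp s
  have hzd : DifferentiableAt ℂ (fun z => (z - σ) ^ mult f σ) s := hsd.zpow (Or.inl hsub)
  have hl : logDeriv f s = mult f σ / (s - σ) + Q.derivative.eval s +
      (logDeriv P (s - σ) - logDeriv N (s - σ)) := by
    have hlf : logDeriv f s = logDeriv (fun z => (z - σ) ^ mult f σ * Complex.exp (Q.eval z) *
        (P (z - σ) / N (z - σ))) s := by
      rw [logDeriv_apply, logDeriv_apply, hfe.deriv_eq, hfe.eq_of_nhds]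
    have hcomp : ∀ W : ℂ → ℂ, logDeriv (fun z => W (z - σ)) s = logDeriv W (s - σ) := by
      intro W
      rw [logDeriv_apply, logDeriv_apply, deriv_comp_sub_const]
    have hz0 : (s - σ) ^ mult f σ ≠ 0 := zpow_ne_zero _ hsub
    have he0 : Complex.exp (Q.eval s) ≠ 0 := Complex.exp_ne_zero _
    rw [hlf, logDeriv_mul (f := fun z => (z - σ) ^ mult f σ * Complex.exp (Q.eval z))
      (g := fun z => P (z - σ) / N (z - σ)) s (mul_ne_zero hz0 he0)
      (div_ne_zero hP0 hN0) (hzd.mul hed) (hPs.div hNs hN0),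
      logDeriv_mul (f := fun z => (z - σ) ^ mult f σ) (g := fun z => Complex.exp (Q.eval z)) s
        hz0 he0 hzd hed,
      logDeriv_div s hP0 hN0 hPs hNs, hcomp P, hcomp N, logDeriv_fun_zpow hsd]
    congr 2
    · rw [logDeriv_apply, deriv_sub_const, deriv_id'']
      simp only [mul_one_div]
    · rw [logDeriv_apply, deriv_cexp Q.differentiableAt, mul_div_cancel_left₀ _
        (Complex.exp_ne_zero _), Q.deriv]
  have hne : ∀ ρ, s - σ ≠ τ ρ := by
    intro ρ h1
    rw [hτ] at h1
    simp only [sub_left_inj] at h1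
    exact ρ.2.1 (h1 ▸ hs0)
  have hτ0 : ∀ ρ, τ ρ ≠ 0 := fun ρ => sub_ne_zero.2 ρ.2.2
  have h1 := logDeriv_weierstrassProduct (tendsto_norm_sub hf σ) hsP hτ0 hne
  have h2 := logDeriv_weierstrassProduct (tendsto_norm_sub hf σ) hsN hτ0 hne
  have h3 := h1.sub h2
  have hv : logDeriv f s - (Q.derivative.eval s + mult f σ / (s - σ)) =
      logDeriv P (s - σ) - logDeriv N (s - σ) := by
    rw [hl]
    ring
  rw [hv]
  refine h3.congr_fun fun ρ => ?_
  rw [← sub_mul, ← zeroMult_sub_poleMult f ρ]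
  push_cast
  rw [sub_sub_sub_cancel_right]

end Hadamard

/-! ### The multinomial theorem for infinite sums -/

section Multinomial

variable {R : Type*} [NormedField R]

lemma sum_finsuppAntidiag_multinomial (x : ℕ → R) (N j : ℕ) :
    ∑ k ∈ (Finset.range N).finsuppAntidiag j, (k.multinomial : R) * k.prod (fun i m => x i ^ m) =
      (∑ i ∈ Finset.range N, x i) ^ j := by
  rw [Finset.sum_pow_eq_sum_piAntidiag]
  refine Finset.sum_nbij (fun k : ℕ →₀ ℕ => ⇑k) (fun k hk => ?_) (fun k _ l _ h => ?_)
    (fun k hk => ?_) (fun k hk => ?_)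
  · rw [Finset.mem_finsuppAntidiag] at hk
    exact Finset.mem_piAntidiag.2 ⟨hk.1, fun i hi => hk.2 (Finsupp.mem_support_iff.2 hi)⟩
  · exact DFunLike.coe_injective h
  · rw [Finset.mem_coe, Finset.mem_piAntidiag] at hk
    refine ⟨Finsupp.onFinset (Finset.range N) k hk.2, ?_, rfl⟩
    rw [Finset.mem_coe, Finset.mem_finsuppAntidiag]
    exact ⟨hk.1, Finsupp.support_onFinset_subset⟩
  · rw [Finset.mem_finsuppAntidiag] at hk
    rw [Finsupp.multinomial_eq_of_support_subset hk.2, Finsupp.prod_of_support_subset k hk.2]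
    simp

lemma degree_eq_of_mem_finsuppAntidiag {s : Finset ℕ} {j : ℕ} {k : ℕ →₀ ℕ} :
    k ∈ s.finsuppAntidiag j ↔ k.degree = j ∧ k.support ⊆ s := by
  rw [Finset.mem_finsuppAntidiag, Finsupp.degree_apply]
  refine and_congr_left fun h => ?_
  rw [← Finset.sum_subset h fun i _ hi => by simpa using hi]

/-- The exhaustion of the multi-indices of degree `j` by those supported in `range N`. -/
def degreeExhaustion (j N : ℕ) : Finset {k : ℕ →₀ ℕ // k.degree = j} :=
  ((Finset.range N).finsuppAntidiag j).subtype _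

lemma tendsto_degreeExhaustion (j : ℕ) : Tendsto (degreeExhaustion j) atTop atTop := by
  refine tendsto_atTop_finset_of_monotone (fun M N hMN k hk => ?_) fun k => ?_
  · rw [degreeExhaustion, Finset.mem_subtype, degree_eq_of_mem_finsuppAntidiag] at hk ⊢
    exact ⟨hk.1, hk.2.trans (Finset.range_mono hMN)⟩
  · obtain ⟨N, hN⟩ := k.1.support.exists_nat_subset_range
    refine ⟨N, ?_⟩
    rw [degreeExhaustion, Finset.mem_subtype, degree_eq_of_mem_finsuppAntidiag]
    exact ⟨k.2, hN⟩

lemma sum_degreeExhaustion (x : ℕ → R) (j N : ℕ) :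
    ∑ k ∈ degreeExhaustion j N, ((k : ℕ →₀ ℕ).multinomial : R) *
      (k : ℕ →₀ ℕ).prod (fun i m => x i ^ m) = (∑ i ∈ Finset.range N, x i) ^ j := by
  rw [← sum_finsuppAntidiag_multinomial, degreeExhaustion,
    Finset.sum_subtype_of_mem (fun k : ℕ →₀ ℕ => (k.multinomial : R) * k.prod (fun i m => x i ^ m))
    fun k hk => (degree_eq_of_mem_finsuppAntidiag.1 hk).1]

lemma norm_finsupp_prod_pow (x : ℕ → ℂ) (k : ℕ →₀ ℕ) :
    ‖k.prod fun i m => x i ^ m‖ = k.prod fun i m => ‖x i‖ ^ m := by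
  simp [Finsupp.prod, norm_prod]

/-- The indices supported in `range N` sum to (∑_{i<N} y_i)^j by the finite multinomial theorem.
This bounds all finite sums, and letting N tend to infinity identifies the total. -/
lemma hasSum_multinomial_real {y : ℕ → ℝ} (hy0 : ∀ i, 0 ≤ y i) (hy : Summable y) (j : ℕ) :
    HasSum (fun k : {k : ℕ →₀ ℕ // k.degree = j} => ((k : ℕ →₀ ℕ).multinomial : ℝ) *
      (k : ℕ →₀ ℕ).prod (fun i m => y i ^ m)) ((∑' i, y i) ^ j) := by
  have h0 : ∀ k : {k : ℕ →₀ ℕ // k.degree = j}, 0 ≤ ((k : ℕ →₀ ℕ).multinomial : ℝ) *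
      (k : ℕ →₀ ℕ).prod (fun i m => y i ^ m) := fun k =>
    mul_nonneg (Nat.cast_nonneg _) (Finset.prod_nonneg fun i _ => pow_nonneg (hy0 i) _)
  have hs : Summable fun k : {k : ℕ →₀ ℕ // k.degree = j} => ((k : ℕ →₀ ℕ).multinomial : ℝ) *
      (k : ℕ →₀ ℕ).prod (fun i m => y i ^ m) := by
    refine summable_of_sum_le (c := (∑' i, y i) ^ j) h0 fun S => ?_
    obtain ⟨N, hN⟩ := ((tendsto_degreeExhaustion j).eventually_ge_atTop S).exists
    refine (Finset.sum_le_sum_of_subset_of_nonneg hN fun k _ _ => h0 k).trans ?_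
    rw [sum_degreeExhaustion]
    exact pow_le_pow_left₀ (Finset.sum_nonneg fun i _ => hy0 i)
      (hy.sum_le_tsum _ fun i _ => hy0 i) _
  have h1 := hs.hasSum.comp (tendsto_degreeExhaustion j)
  have h2 := hy.hasSum.tendsto_sum_nat.pow j
  have h3 := tendsto_nhds_unique (h1.congr fun N => sum_degreeExhaustion y j N) h2
  exact h3 ▸ hs.hasSum

lemma hasSum_multinomial {x : ℕ → ℂ} (hx : Summable fun i => ‖x i‖) (j : ℕ) :
    HasSum (fun k : {k : ℕ →₀ ℕ // k.degree = j} => ((k : ℕ →₀ ℕ).multinomial : ℂ) *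
      (k : ℕ →₀ ℕ).prod (fun i m => x i ^ m)) ((∑' i, x i) ^ j) := by
  have hs : Summable fun k : {k : ℕ →₀ ℕ // k.degree = j} => ((k : ℕ →₀ ℕ).multinomial : ℂ) *
      (k : ℕ →₀ ℕ).prod (fun i m => x i ^ m) := by
    refine Summable.of_norm ((hasSum_multinomial_real (fun i => norm_nonneg (x i)) hx j).summable.congr
      fun k => ?_)
    rw [norm_mul, norm_finsupp_prod_pow, Complex.norm_natCast]
  have h1 := hs.hasSum.comp (tendsto_degreeExhaustion j)
  have h2 := hx.of_norm.hasSum.tendsto_sum_nat.pow j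
  have h3 := tendsto_nhds_unique (h1.congr fun N => sum_degreeExhaustion x j N) h2
  exact h3 ▸ hs.hasSum

lemma natCast_multinomial {K : Type*} [Field K] [CharZero K] (k : ℕ →₀ ℕ) :
    (k.multinomial : K) = (k.degree.factorial : K) / k.prod fun _ m => (m.factorial : K) := by
  have h := Nat.multinomial_spec k.support k
  have h0 : (k.prod fun _ m => (m.factorial : K)) ≠ 0 :=
    Finset.prod_ne_zero_iff.2 fun i _ => Nat.cast_ne_zero.2 (Nat.factorial_ne_zero _)
  rw [eq_div_iff h0, Finsupp.multinomial_eq, Finsupp.degree_apply, ← h, Finsupp.prod, mul_comm]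
  push_cast
  rfl

end Multinomial

lemma logCoeff_eq (a : ℕ → ℂ) (k : ℕ →₀ ℕ) :
    logCoeff a k = (-1) ^ k.degree / (k.degree : ℂ) *
      ((k.multinomial : ℂ) * k.prod fun j m => a j ^ m) := by
  rw [logCoeff, natCast_multinomial, mul_assoc]

/-- The terms of degree j have norms adding up to (1/j)(∑ ‖x_i‖)^j, dominated by a geometric series.
-/
lemma summable_norm_logCoeff {x : ℕ → ℂ} (hx : Summable fun i => ‖x i‖) (h1 : ∑' i, ‖x i‖ < 1) :
    Summable fun k => ‖logCoeff x k‖ := by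
  rw [← (Equiv.sigmaFiberEquiv (fun k : ℕ →₀ ℕ => k.degree)).summable_iff,
    summable_sigma_of_nonneg (f := (fun k => ‖logCoeff x k‖) ∘
      Equiv.sigmaFiberEquiv fun k : ℕ →₀ ℕ => k.degree) fun _ => norm_nonneg _]
  have h0 : 0 ≤ ∑' i, ‖x i‖ := tsum_nonneg fun _ => norm_nonneg _
  have hfib : ∀ j : ℕ, HasSum (fun k : {k : ℕ →₀ ℕ // k.degree = j} =>
      ‖logCoeff x (k : ℕ →₀ ℕ)‖) (1 / (j : ℝ) * (∑' i, ‖x i‖) ^ j) := by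
    intro j
    refine ((hasSum_multinomial_real (fun i => norm_nonneg (x i)) hx j).mul_left
      (1 / (j : ℝ))).congr_fun fun k => ?_
    rw [logCoeff_eq, norm_mul, norm_mul, norm_finsupp_prod_pow, Complex.norm_natCast, norm_div,
      norm_pow, norm_neg, norm_one, one_pow, Complex.norm_natCast, k.2]
  refine ⟨fun j => (hfib j).summable, ?_⟩
  refine (summable_geometric_of_lt_one h0 h1).of_nonneg_of_le
    (fun j => tsum_nonneg fun _ => norm_nonneg _) fun j => ?_
  refine (hfib j).tsum_eq.le.trans ?_
  refine mul_le_of_le_one_left (pow_nonneg h0 _) ?_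
  -- In degree zero the factor 1/0 is 0 by convention, so the index k = 0 contributes nothing.
  rcases Nat.eq_zero_or_pos j with rfl | hj
  · simp
  · rw [div_le_one (by exact_mod_cast hj)]
    exact_mod_cast hj

/-- Grouped by degree, the terms become the Taylor series of -log(1 + z) at z = ∑ x_i; absolute
summability permits the regrouping. -/
lemma hasSum_logCoeff {x : ℕ → ℂ} (hx : Summable fun i => ‖x i‖) (h1 : ∑' i, ‖x i‖ < 1) :
    HasSum (logCoeff x) (-Complex.log (1 + ∑' i, x i)) := by
  rw [← (Equiv.sigmaFiberEquiv (fun k : ℕ →₀ ℕ => k.degree)).hasSum_iff]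
  have hX : ‖∑' i, x i‖ < 1 := (norm_tsum_le_tsum_norm hx).trans_lt h1
  refine HasSum.sigma_of_hasSum (Complex.hasSum_taylorSeries_log hX).neg (fun j => ?_) ?_
  · have h2 := (hasSum_multinomial hx j).mul_left ((-1 : ℂ) ^ j / (j : ℂ))
    convert! h2 using 1
    · ext k
      simp only [Function.comp, Equiv.sigmaFiberEquiv_apply, logCoeff_eq, k.2]
    · ring
  · exact ((Equiv.sigmaFiberEquiv (fun k : ℕ →₀ ℕ => k.degree)).summable_iff.2
      (summable_norm_logCoeff hx h1).of_norm)

/-! ### The logarithmic derivative of a Dirichlet series -/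

section Dirichlet

variable {lam : ℕ → ℝ} {a : ℕ → ℂ}

lemma natPairing_eq (lam : ℕ → ℝ) (k : ℕ →₀ ℕ) :
    natPairing lam k = ∑ i ∈ k.support, lam i * k i := rfl

lemma natPairing_nonneg (hlam : ∀ n, 0 ≤ lam n) (k : ℕ →₀ ℕ) : 0 ≤ natPairing lam k :=
  Finset.sum_nonneg fun i _ => mul_nonneg (hlam i) (Nat.cast_nonneg _)

lemma logCoeff_mul_exp (lam : ℕ → ℝ) (a : ℕ → ℂ) (k : ℕ →₀ ℕ) (s : ℂ) :
    logCoeff (fun n => a n * Complex.exp (-(lam n * s))) k =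
      logCoeff a k * Complex.exp (-(natPairing lam k * s)) := by
  have : (k.prod fun j m => (a j * Complex.exp (-(lam j * s))) ^ m) =
      (k.prod fun j m => a j ^ m) * Complex.exp (-(natPairing lam k * s)) := by
    simp only [Finsupp.prod, mul_pow, Finset.prod_mul_distrib]
    rw [natPairing_eq]
    push_cast
    rw [Finset.sum_mul, ← Finset.sum_neg_distrib, Complex.exp_sum]
    congr 1
    refine Finset.prod_congr rfl fun i _ => ?_
    rw [← Complex.exp_nat_mul]
    ring_nf
  rw [logCoeff, this, logCoeff, mul_assoc]
  ring

lemma norm_exp_neg_ofReal_mul (x : ℝ) (s : ℂ) :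
    ‖Complex.exp (-(x * s))‖ = Real.exp (-(x * s.re)) := by
  rw [Complex.norm_exp]
  simp

variable {σbar : ℝ}

lemma summable_norm_dirichlet (hlam : ∀ n, 0 ≤ lam n)
    (habs : Summable fun n => ‖a n‖ * Real.exp (-(lam n * σbar))) {c : ℝ} (hc : σbar ≤ c) :
    Summable fun n => ‖a n‖ * Real.exp (-(lam n * c)) := by
  refine habs.of_nonneg_of_le (fun n => by positivity) fun n => ?_
  have := mul_le_mul_of_nonneg_left hc (hlam n)
  gcongr

/-- Far to the right the Dirichlet series is dominated by its constant term. -/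
lemma exists_tsum_norm_dirichlet_le (hpos : 0 < lam 0) (hmono : StrictMono lam)
    (habs : Summable fun n => ‖a n‖ * Real.exp (-(lam n * σbar))) :
    ∃ c₀, σbar < c₀ ∧ ∑' n, ‖a n‖ * Real.exp (-(lam n * c₀)) < 1 := by
  set S := ∑' n, ‖a n‖ * Real.exp (-(lam n * σbar)) with hS
  have hlam : ∀ n, 0 ≤ lam n := fun n => hpos.le.trans (hmono.monotone (Nat.zero_le n))
  -- All frequencies are at least λ_0, so moving the abscissa from σbar to c gains at least the
  -- factor e^{-λ_0 (c - σbar)}.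
  have hlim : Tendsto (fun c : ℝ => S * Real.exp (-(lam 0 * (c - σbar)))) atTop (𝓝 (S * 0)) := by
    refine tendsto_const_nhds.mul (Real.tendsto_exp_neg_atTop_nhds_zero.comp ?_)
    exact (tendsto_atTop_add_const_right _ (-σbar) tendsto_id).const_mul_atTop hpos
  rw [mul_zero] at hlim
  obtain ⟨c, hc1, hc2⟩ := ((hlim.eventually (gt_mem_nhds one_pos)).and
    (eventually_gt_atTop σbar)).exists
  refine ⟨c, hc2, lt_of_le_of_lt ?_ hc1⟩
  rw [hS, ← tsum_mul_right]
  refine (summable_norm_dirichlet hlam habs hc2.le).tsum_le_tsum (fun n => ?_) (habs.mul_right _)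
  rw [mul_assoc, ← Real.exp_add]
  have h1 : lam 0 * (c - σbar) ≤ lam n * (c - σbar) :=
    mul_le_mul_of_nonneg_right (hmono.monotone (Nat.zero_le n)) (by linarith)
  refine mul_le_mul_of_nonneg_left (Real.exp_le_exp.2 ?_) (norm_nonneg _)
  linarith

lemma summable_norm_logCoeff_mul_exp {c₀ : ℝ}
    (hs : Summable fun n => ‖a n‖ * Real.exp (-(lam n * c₀)))
    (hc : ∑' n, ‖a n‖ * Real.exp (-(lam n * c₀)) < 1) :
    Summable fun k => ‖logCoeff a k‖ * Real.exp (-(natPairing lam k * c₀)) := by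
  have hn : ∀ n, ‖a n * Complex.exp (-(lam n * (c₀ : ℂ)))‖ =
      ‖a n‖ * Real.exp (-(lam n * c₀)) := fun n => by
    rw [norm_mul, norm_exp_neg_ofReal_mul, Complex.ofReal_re]
  have := summable_norm_logCoeff (x := fun n => a n * Complex.exp (-(lam n * (c₀ : ℂ))))
    (by simpa only [hn] using hs) (by simpa only [hn] using hc)
  refine this.congr fun k => ?_
  rw [logCoeff_mul_exp, norm_mul, norm_exp_neg_ofReal_mul, Complex.ofReal_re]

/-- To the right of `c₀` the sum of the Dirichlet series is analytic without zeros, and its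
logarithmic derivative is the sum of the differentiated logarithmic series. -/
lemma dirichlet_logDeriv (hlam : ∀ n, 0 ≤ lam n) {f : ℂ → ℂ} {c₀ : ℝ}
    (hs : Summable fun n => ‖a n‖ * Real.exp (-(lam n * c₀)))
    (hc : ∑' n, ‖a n‖ * Real.exp (-(lam n * c₀)) < 1)
    (hf : ∀ s : ℂ, c₀ < s.re → f s = 1 + ∑' n, a n * Complex.exp (-(lam n * s))) {s : ℂ}
    (hsc : c₀ < s.re) :
    AnalyticAt ℂ f s ∧ f s ≠ 0 ∧
      HasSum (fun k => (natPairing lam k : ℂ) * logCoeff a k *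
        Complex.exp (-(natPairing lam k * s))) (logDeriv f s) := by
  set U : Set ℂ := {s | c₀ < s.re} with hU
  have hUo : IsOpen U := isOpen_lt continuous_const Complex.continuous_re
  set F : (ℕ →₀ ℕ) → ℂ → ℂ := fun k s => logCoeff a k * Complex.exp (-(natPairing lam k * s))
    with hF
  have hsum := summable_norm_logCoeff_mul_exp hs hc
  have hFd : ∀ k, DifferentiableOn ℂ (F k) U := fun k => by
    refine Differentiable.differentiableOn ?_
    simp only [hF]
    fun_prop
  have hFle : ∀ k, ∀ w ∈ U, ‖F k w‖ ≤ ‖logCoeff a k‖ * Real.exp (-(natPairing lam k * c₀)) := by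
    intro k w hw
    rw [hF, norm_mul, norm_exp_neg_ofReal_mul]
    have := mul_le_mul_of_nonneg_left (le_of_lt hw : c₀ ≤ w.re) (natPairing_nonneg hlam k)
    gcongr
  set L : ℂ → ℂ := fun s => ∑' k, F k s with hL
  have hLd : DifferentiableOn ℂ L U := Complex.differentiableOn_tsum_of_summable_norm hsum hFd hUo hFle
  -- This exponential form gives at once analyticity, absence of zeros and f'/f = -L', where L can
  -- be differentiated termwise.
  have hfL : ∀ w ∈ U, f w = Complex.exp (-L w) := by
    intro w hw
    have hn : ∀ n, ‖a n * Complex.exp (-(lam n * w))‖ ≤ ‖a n‖ * Real.exp (-(lam n * c₀)) := by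
      intro n
      rw [norm_mul, norm_exp_neg_ofReal_mul]
      have := mul_le_mul_of_nonneg_left (le_of_lt hw : c₀ ≤ w.re) (hlam n)
      gcongr
    have hx : Summable fun n => ‖a n * Complex.exp (-(lam n * w))‖ :=
      hs.of_nonneg_of_le (fun _ => norm_nonneg _) hn
    have hx1 : ∑' n, ‖a n * Complex.exp (-(lam n * w))‖ < 1 := (hx.tsum_le_tsum hn hs).trans_lt hc
    have h1 := (hasSum_logCoeff hx hx1).tsum_eq
    simp only [logCoeff_mul_exp] at h1
    rw [show L w = _ from h1, neg_neg, Complex.exp_log, hf w hw]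
    intro h0
    have h2 : ‖∑' n, a n * Complex.exp (-(lam n * w))‖ < 1 := (norm_tsum_le_tsum_norm hx).trans_lt hx1
    rw [← eq_neg_iff_add_eq_zero] at h0
    rw [← norm_neg, ← h0, norm_one] at h2
    exact lt_irrefl _ h2
  have hfe : f =ᶠ[𝓝 s] fun w => Complex.exp (-L w) := by
    filter_upwards [hUo.mem_nhds hsc] with w hw using hfL w hw
  have hLs : DifferentiableAt ℂ L s := hLd.differentiableAt (hUo.mem_nhds hsc)
  refine ⟨?_, ?_, ?_⟩
  · have : DifferentiableOn ℂ f U := (hLd.neg.cexp).congr hfL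
    exact this.analyticAt (hUo.mem_nhds hsc)
  · rw [hfL s hsc]
    exact Complex.exp_ne_zero _
  · have h1 := (Complex.hasSum_deriv_of_summable_norm hsum hFd hUo hFle hsc).neg
    have h2 : logDeriv f s = -deriv L s := by
      rw [logDeriv_apply, hfe.deriv_eq, hfe.eq_of_nhds, deriv_cexp hLs.fun_neg, deriv.fun_neg,
        mul_div_cancel_left₀ _ (Complex.exp_ne_zero _)]
    rw [h2]
    refine h1.congr_fun fun k => ?_
    have h3 : HasDerivAt (F k) (logCoeff a k * (Complex.exp (-(natPairing lam k * s)) *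
        (-(natPairing lam k * 1)))) s :=
      ((((hasDerivAt_id s).const_mul (natPairing lam k : ℂ)).neg).cexp).const_mul _
    rw [h3.deriv]
    ring

end Dirichlet

/-! ### The convergence exponent is positive -/

/-- Functions on the real line which eventually agree with a rational function. -/
def EventuallyRational (h : ℝ → ℂ) : Prop :=
  ∃ B N : Polynomial ℂ, B ≠ 0 ∧ ∀ᶠ x : ℝ in atTop, B.eval (x : ℂ) * h x = N.eval (x : ℂ)

lemma EventuallyRational.add {g h : ℝ → ℂ} (hg : EventuallyRational g)
    (hh : EventuallyRational h) : EventuallyRational fun x => g x + h x := by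
  obtain ⟨B, N, hB, hN⟩ := hg
  obtain ⟨B', N', hB', hN'⟩ := hh
  refine ⟨B * B', B' * N + B * N', mul_ne_zero hB hB', ?_⟩
  filter_upwards [hN, hN'] with x h1 h2
  rw [Polynomial.eval_add, Polynomial.eval_mul, Polynomial.eval_mul, Polynomial.eval_mul, ← h1, ← h2]
  ring

lemma eventuallyRational_polynomial (p : Polynomial ℂ) :
    EventuallyRational fun x => p.eval (x : ℂ) :=
  ⟨1, p, one_ne_zero, by simp⟩

lemma eventuallyRational_div_sub (c ρ : ℂ) : EventuallyRational fun x => c / ((x : ℂ) - ρ) := by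
  refine ⟨Polynomial.X - Polynomial.C ρ, Polynomial.C c, Polynomial.X_sub_C_ne_zero ρ, ?_⟩
  filter_upwards [eventually_gt_atTop ρ.re] with x hx
  have : (x : ℂ) - ρ ≠ 0 := by
    intro h
    have := congrArg Complex.re h
    simp at this
    linarith
  simp only [Polynomial.eval_sub, Polynomial.eval_X, Polynomial.eval_C]
  field_simp

lemma eventuallyRational_sum {ι : Type*} (s : Finset ι) (h : ι → ℝ → ℂ)
    (hh : ∀ i ∈ s, EventuallyRational (h i)) : EventuallyRational fun x => ∑ i ∈ s, h i x := by
  classical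
  induction s using Finset.induction_on with
  | empty => simpa using eventuallyRational_polynomial 0
  | insert i s hi ih =>
    simp only [Finset.sum_insert hi]
    exact (hh i (Finset.mem_insert_self _ _)).add
      (ih fun j hj => hh j (Finset.mem_insert_of_mem hj))

lemma tendsto_norm_ofReal_atTop : Tendsto (fun x : ℝ => ‖(x : ℂ)‖) atTop atTop := by
  simpa using (tendsto_abs_atTop_atTop : Tendsto (abs : ℝ → ℝ) atTop atTop)

lemma polynomial_eq_zero_of_tendsto {N : Polynomial ℂ}
    (h : Tendsto (fun x : ℝ => N.eval (x : ℂ)) atTop (𝓝 0)) : N = 0 := by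
  rcases le_or_gt N.degree 0 with hd | hd
  · rw [Polynomial.eq_C_of_degree_le_zero hd] at h ⊢
    simp only [Polynomial.eval_C, tendsto_const_nhds_iff] at h
    rw [h, map_zero]
  · have h1 := N.tendsto_norm_atTop hd tendsto_norm_ofReal_atTop
    have h2 := h.norm
    rw [norm_zero] at h2
    exact absurd h2 (not_tendsto_nhds_of_tendsto_atTop h1 _)

lemma eventually_polynomial_eval_ne_zero {B : Polynomial ℂ} (hB : B ≠ 0) :
    ∀ᶠ x : ℝ in atTop, B.eval (x : ℂ) ≠ 0 := by
  rcases le_or_gt B.degree 0 with hd | hd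
  · rw [Polynomial.eq_C_of_degree_le_zero hd] at hB ⊢
    exact Eventually.of_forall fun _ => by simpa using hB
  · filter_upwards [(B.tendsto_norm_atTop hd tendsto_norm_ofReal_atTop).eventually_gt_atTop 0]
      with x hx using norm_pos_iff.1 hx

lemma tendsto_polynomial_mul_exp_neg (B : Polynomial ℂ) {ℓ : ℝ} (hℓ : 0 < ℓ) :
    Tendsto (fun x : ℝ => B.eval (x : ℂ) * (Real.exp (-(ℓ * x)) : ℂ)) atTop (𝓝 0) := by
  induction B using Polynomial.induction_on' with
  | add p q hp hq => simpa [add_mul] using hp.add hq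
  | monomial n c =>
    have h1 := tendsto_rpow_mul_exp_neg_mul_atTop_nhds_zero n ℓ hℓ
    have h2 := ((Complex.continuous_ofReal.tendsto 0).comp h1).const_mul c
    rw [Complex.ofReal_zero, mul_zero] at h2
    refine h2.congr fun x => ?_
    simp only [Function.comp, Polynomial.eval_monomial, Real.rpow_natCast]
    push_cast
    ring_nf

/-- A rational function does not have exact exponential decay. -/
lemma EventuallyRational.eq_zero_of_tendsto {h : ℝ → ℂ} (hh : EventuallyRational h) {ℓ : ℝ}
    (hℓ : 0 < ℓ) {A : ℂ} (hA : Tendsto (fun x : ℝ => (Real.exp (ℓ * x) : ℂ) * h x) atTop (𝓝 A)) :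
    A = 0 := by
  obtain ⟨B, N, hB, hN⟩ := hh
  -- The product of these two functions is eventually N(x), so N tends to 0 and vanishes; then h is
  -- eventually 0, and so is its limit A.
  have h1 := (tendsto_polynomial_mul_exp_neg B hℓ).mul hA
  rw [zero_mul] at h1
  have h2 : N = 0 := by
    refine polynomial_eq_zero_of_tendsto (h1.congr' ?_)
    filter_upwards [hN] with x hx
    have h3 : (Real.exp (-(ℓ * x)) : ℂ) * (Real.exp (ℓ * x) : ℂ) = 1 := by
      rw [← Complex.ofReal_mul, ← Real.exp_add]
      simp
    linear_combination B.eval (x : ℂ) * h x * h3 + hx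
  refine tendsto_nhds_unique (hA.congr' ?_) (tendsto_const_nhds (x := (0 : ℂ)))
  filter_upwards [hN, eventually_polynomial_eval_ne_zero hB] with x hx hx'
  rw [h2, Polynomial.eval_zero] at hx
  rw [(mul_eq_zero.1 hx).resolve_left hx', mul_zero]

/-! ### Leading exponential asymptotics along the real axis -/

section Asymptotics

variable {lam : ℕ → ℝ} {a : ℕ → ℂ}

/-- Dominated convergence: once the leading exponential is factored out, each later term decays in
x, and the norms at x = c serve as the bound. -/
lemma tendsto_exp_mul_tsum (hmono : StrictMono lam) {b : ℕ → ℂ} {c : ℝ}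
    (hs : Summable fun n => ‖b n‖ * Real.exp (-(lam n * c))) {n₀ : ℕ} (h0 : ∀ n < n₀, b n = 0) :
    Tendsto (fun x : ℝ => (Real.exp (lam n₀ * x) : ℂ) * ∑' n, b n * Complex.exp (-(lam n * x)))
      atTop (𝓝 (b n₀)) := by
  have hlim : Tendsto (fun x : ℝ => ∑' n, b n * Complex.exp (-((lam n - lam n₀ : ℝ) * (x : ℂ))))
      atTop (𝓝 (∑' n, if n = n₀ then b n₀ else 0)) := by
    refine tendsto_tsum_of_dominated_convergence
      (bound := fun n => Real.exp (lam n₀ * c) * (‖b n‖ * Real.exp (-(lam n * c))))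
      (hs.mul_left _) (fun n => ?_) ?_
    · rcases lt_trichotomy n n₀ with h | rfl | h
      · simp [h0 n h, h.ne]
      · simp
      · rw [if_neg h.ne']
        have hpos : 0 < lam n - lam n₀ := sub_pos.2 (hmono h)
        have h1 := Real.tendsto_exp_neg_atTop_nhds_zero.comp (tendsto_id.const_mul_atTop hpos)
        have h2 := ((Complex.continuous_ofReal.tendsto 0).comp h1).const_mul (b n)
        rw [Complex.ofReal_zero, mul_zero] at h2
        refine h2.congr fun x => ?_
        simp
    · filter_upwards [eventually_ge_atTop c] with x hx n
      rcases lt_or_ge n n₀ with h | h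
      · simp [h0 n h]
      · rw [norm_mul, norm_exp_neg_ofReal_mul, Complex.ofReal_re, mul_left_comm, ← Real.exp_add]
        have h1 : (lam n - lam n₀) * c ≤ (lam n - lam n₀) * x :=
          mul_le_mul_of_nonneg_left hx (sub_nonneg.2 (hmono.monotone h))
        refine mul_le_mul_of_nonneg_left (Real.exp_le_exp.2 ?_) (norm_nonneg _)
        linarith
  rw [tsum_ite_eq] at hlim
  refine hlim.congr fun x => ?_
  rw [← tsum_mul_left]
  refine tsum_congr fun n => ?_
  rw [mul_left_comm, Complex.ofReal_exp, ← Complex.exp_add]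
  congr 2
  push_cast
  ring

/-- The price of a termwise derivative: the factor ℓ i is absorbed by exp(ℓ i (c - c₀)) at the cost
(c - c₀)⁻¹. -/
lemma summable_mul_norm_mul_exp {ι : Type*} {ℓ : ι → ℝ} {b : ι → ℂ} (hℓ : ∀ i, 0 ≤ ℓ i)
    {c₀ c : ℝ} (hs : Summable fun i => ‖b i‖ * Real.exp (-(ℓ i * c₀))) (hc : c₀ < c) :
    Summable fun i => ℓ i * ‖b i‖ * Real.exp (-(ℓ i * c)) := by
  have hd : 0 < c - c₀ := by linarith
  refine (hs.mul_left (c - c₀)⁻¹).of_nonneg_of_le (fun k => ?_) fun k => ?_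
  · have := hℓ k
    positivity
  · have h1 : ℓ k ≤ (c - c₀)⁻¹ * Real.exp (ℓ k * (c - c₀)) := by
      rw [le_inv_mul_iff₀ hd]
      linarith [Real.add_one_le_exp (ℓ k * (c - c₀))]
    calc ℓ k * ‖b k‖ * Real.exp (-(ℓ k * c))
        ≤ (c - c₀)⁻¹ * Real.exp (ℓ k * (c - c₀)) * ‖b k‖ * Real.exp (-(ℓ k * c)) := by gcongr
      _ = (c - c₀)⁻¹ * (‖b k‖ * (Real.exp (ℓ k * (c - c₀)) * Real.exp (-(ℓ k * c)))) := by ring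
      _ = _ := by
        rw [← Real.exp_add]
        ring_nf

/-- The logarithmic derivative of a nonconstant Dirichlet series decays exponentially along the
positive real axis, with an exact rate. -/
lemma exists_tendsto_exp_mul_logDeriv (hpos : 0 < lam 0) (hmono : StrictMono lam)
    (hnonconst : ∃ n, a n ≠ 0) {f : ℂ → ℂ} {c₀ : ℝ}
    (hs : Summable fun n => ‖a n‖ * Real.exp (-(lam n * c₀)))
    (hf : ∀ s : ℂ, c₀ < s.re → f s = 1 + ∑' n, a n * Complex.exp (-(lam n * s))) :
    ∃ ℓ : ℝ, 0 < ℓ ∧ ∃ A : ℂ, A ≠ 0 ∧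
      Tendsto (fun x : ℝ => (Real.exp (ℓ * x) : ℂ) * logDeriv f (x : ℂ)) atTop (𝓝 A) := by
  classical
  have hlam : ∀ n, 0 < lam n := fun n => hpos.trans_le (hmono.monotone (Nat.zero_le n))
  -- The first nonzero coefficient fixes the leading term -λ_{n₀} a_{n₀} e^{-λ_{n₀} x} of f', while
  -- f tends to 1.
  set n₀ := Nat.find hnonconst with hn₀
  have hn0 : a n₀ ≠ 0 := Nat.find_spec hnonconst
  have hlt : ∀ n < n₀, a n = 0 := fun n hn => not_not.1 (Nat.find_min hnonconst hn)
  have hlim : Tendsto (fun x : ℝ => f (x : ℂ)) atTop (𝓝 1) := by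
    have h1 := tendsto_exp_mul_tsum hmono hs hlt
    have h2 := (Complex.continuous_ofReal.tendsto 0).comp
      (Real.tendsto_exp_neg_atTop_nhds_zero.comp (tendsto_id.const_mul_atTop (hlam n₀)))
    have h3 := (h2.mul h1).const_add 1
    simp only [Complex.ofReal_zero, zero_mul, add_zero] at h3
    refine h3.congr' ?_
    filter_upwards [eventually_gt_atTop c₀] with x hx
    rw [hf x (by simpa using hx), ← mul_assoc]
    simp only [Function.comp, id]
    rw [← Complex.ofReal_mul, ← Real.exp_add, neg_add_cancel, Real.exp_zero, Complex.ofReal_one,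
      one_mul]
  set U : Set ℂ := {s | c₀ < s.re} with hU
  have hUo : IsOpen U := isOpen_lt continuous_const Complex.continuous_re
  have hder : ∀ s ∈ U, deriv f s = ∑' n, (-(lam n * a n) : ℂ) * Complex.exp (-(lam n * s)) := by
    intro s hsU
    have h1 := Complex.hasSum_deriv_of_summable_norm (F := fun n s =>
      a n * Complex.exp (-(lam n * s))) (U := U) hs
      (fun n => Differentiable.differentiableOn (by fun_prop)) hUo (fun n w hw => by
        rw [norm_mul, norm_exp_neg_ofReal_mul]
        have := mul_le_mul_of_nonneg_left (le_of_lt hw : c₀ ≤ w.re) (hlam n).le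
        gcongr) hsU
    have h2 : f =ᶠ[𝓝 s] fun s => 1 + ∑' n, a n * Complex.exp (-(lam n * s)) := by
      filter_upwards [hUo.mem_nhds hsU] with w hw using hf w hw
    rw [h2.deriv_eq, deriv_const_add, ← h1.tsum_eq]
    refine tsum_congr fun n => ?_
    have h3 : HasDerivAt (fun s => a n * Complex.exp (-(lam n * s)))
        (a n * (Complex.exp (-(lam n * s)) * (-(lam n * 1)))) s :=
      ((((hasDerivAt_id s).const_mul (lam n : ℂ)).neg).cexp).const_mul _
    rw [h3.deriv]
    ring
  have hs' : Summable fun n => ‖(-(lam n * a n) : ℂ)‖ * Real.exp (-(lam n * (c₀ + 1))) := by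
    refine (summable_mul_norm_mul_exp (fun n => (hlam n).le) hs (lt_add_one c₀)).congr fun n => ?_
    rw [norm_neg, norm_mul, Complex.norm_real, Real.norm_of_nonneg (hlam n).le]
  refine ⟨lam n₀, hlam n₀, -(lam n₀ * a n₀), neg_ne_zero.2 (mul_ne_zero
    (by exact_mod_cast (hlam n₀).ne') hn0), ?_⟩
  have h4 := (tendsto_exp_mul_tsum hmono hs' (n₀ := n₀) fun n hn => by simp [hlt n hn]).div hlim
    one_ne_zero
  rw [div_one] at h4
  refine h4.congr' ?_
  filter_upwards [eventually_gt_atTop c₀] with x hx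
  simp only [Pi.div_apply]
  rw [logDeriv_apply, hder x (by simpa [hU] using hx), mul_div_assoc]

end Asymptotics

/-- With exponent 0 every summand is |n_ρ| ≥ 1, so summability leaves only finitely many. -/
lemma finite_divisorSet_of_convergenceExponent_eq_zero {f : ℂ → ℂ} (hf : Meromorphic f)
    (h : HasFiniteOrder f) (h0 : convergenceExponent f = 0) : (divisorSet f).Finite := by
  have h1 := summable_convergenceExponent hf h
  rw [h0] at h1
  have h2 := (h1.tendsto_cofinite_zero).eventually (gt_mem_nhds one_pos)
  rw [eventually_cofinite] at h2
  have h3 : {ρ : ↥(divisorSet f \ {0}) | ¬|(mult f ρ : ℝ)| / ‖(ρ : ℂ)‖ ^ 0 < 1} = univ := by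
    refine eq_univ_of_forall fun ρ => ?_
    rw [mem_ofPred_eq, pow_zero, div_one, not_lt, ← Int.cast_abs]
    exact_mod_cast Int.one_le_abs ρ.2.1
  rw [h3, finite_univ_iff] at h2
  have h4 : (divisorSet f \ {0}).Finite := toFinite _
  exact (h4.union (finite_singleton 0)).subset fun z hz => by
    by_cases hz0 : z = 0
    · exact Or.inr hz0
    · exact Or.inl ⟨hz, hz0⟩

/-- A nonconstant Dirichlet series does not have convergence exponent zero. -/
lemma one_le_convergenceExponent {lam : ℕ → ℝ} {a : ℕ → ℂ} (hpos : 0 < lam 0)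
    (hmono : StrictMono lam) (hnonconst : ∃ n, a n ≠ 0) {f : ℂ → ℂ} {c₀ : ℝ}
    (hs : Summable fun n => ‖a n‖ * Real.exp (-(lam n * c₀)))
    (hf : ∀ s : ℂ, c₀ < s.re → f s = 1 + ∑' n, a n * Complex.exp (-(lam n * s)))
    (hfa : ∀ s : ℂ, c₀ < s.re → AnalyticAt ℂ f s ∧ f s ≠ 0)
    (hmero : Meromorphic f) (hord : HasFiniteOrder f) {Q : Polynomial ℂ}
    (hQ : IsHadamardExponent f 0 Q) : 1 ≤ convergenceExponent f := by
  by_contra hd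
  have h0 : convergenceExponent f = 0 := by omega
  have hfin := finite_divisorSet_of_convergenceExponent_eq_zero hmero hord h0
  have : Finite ↥(divisorSet f \ {0}) := (hfin.subset sdiff_subset).to_subtype
  have := Fintype.ofFinite ↥(divisorSet f \ {0})
  have hrat : EventuallyRational fun x => logDeriv f (x : ℂ) := by
    have h1 : EventuallyRational fun x : ℝ => (Q.derivative.eval (x : ℂ) + mult f 0 / ((x : ℂ) - 0)) +
        ∑ ρ : ↥(divisorSet f \ {0}), (mult f ρ : ℂ) / ((x : ℂ) - ρ) :=
      ((eventuallyRational_polynomial _).add (eventuallyRational_div_sub _ _)).add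
        (eventuallyRational_sum _ _ fun ρ _ => eventuallyRational_div_sub _ _)
    obtain ⟨B, N, hB, hN⟩ := h1
    refine ⟨B, N, hB, ?_⟩
    filter_upwards [hN, eventually_gt_atTop c₀, eventually_gt_atTop 0] with x hx hxc hx0
    rw [← hx]
    congr 1
    have hev : ∀ᶠ z in 𝓝 (x : ℂ), AnalyticAt ℂ f z ∧ f z ≠ 0 := by
      filter_upwards [(isOpen_lt continuous_const Complex.continuous_re).mem_nhds
        (show c₀ < (x : ℂ).re by simpa using hxc)] with z hz using hfa z hz
    have h2 := hQ.hasSum_logDeriv hmero hord hev (by exact_mod_cast hx0.ne')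
    -- Truncation gives 0 - 1 = 0, so the Weierstrass factors are just 1 - z and the Hadamard
    -- formula is a finite sum of simple fractions plus a polynomial.
    rw [h0] at h2
    simp only [zero_tsub, pow_zero, one_mul, mul_one_div] at h2
    have h3 := h2.unique (hasSum_fintype _)
    rw [← h3]
    ring
  obtain ⟨ℓ, hℓ, A, hA, hlim⟩ := exists_tendsto_exp_mul_logDeriv hpos hmono hnonconst hs hf
  exact hA (hrat.eq_zero_of_tendsto hℓ hlim)

/-! ### The Fourier-Laplace transform of test functions -/

section FourierLaplace

open FourierTransform

/-- The two-sided Laplace transform `∫ χ(t) e^{s t} dt`. -/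
def laplace (χ : ℝ → ℂ) (s : ℂ) : ℂ := ∫ t : ℝ, χ t * Complex.exp (s * t)

/-- The parametrization `w ↦ c - 2 π i w` of the line `Re s = c`. -/
def vline (c w : ℝ) : ℂ := (c : ℂ) - 2 * Real.pi * w * Complex.I

@[simp]
lemma vline_re (c w : ℝ) : (vline c w).re = c := by simp [vline]

lemma continuous_vline (c : ℝ) : Continuous (vline c) := by
  unfold vline
  fun_prop

lemma norm_exp_neg_vline_mul (c w x : ℝ) :
    ‖Complex.exp (-(vline c w * x))‖ = Real.exp (-(c * x)) := by
  rw [Complex.norm_exp]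
  simp

variable {χ : ℝ → ℂ}

lemma integrable_mul_cexp (hχ : Continuous χ) (hc : HasCompactSupport χ) (s : ℂ) :
    Integrable fun t : ℝ => χ t * Complex.exp (s * t) :=
  (hχ.mul (by fun_prop)).integrable_of_hasCompactSupport hc.mul_right

lemma laplace_deriv (hχ : ContDiff ℝ ∞ χ) (hc : HasCompactSupport χ) (s : ℂ) :
    laplace (deriv χ) s = -s * laplace χ s := by
  have hd : Continuous (deriv χ) := hχ.continuous_deriv (by simp)
  have h1 : ∀ t : ℝ, HasDerivAt (fun t : ℝ => Complex.exp (s * t)) (s * Complex.exp (s * t)) t := by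
    intro t
    have h2 : HasDerivAt (fun t : ℝ => s * (t : ℂ)) (s * 1) t :=
      (Complex.ofRealCLM.hasDerivAt (x := t)).const_mul s
    exact h2.cexp.congr_deriv (by ring)
  have h3 := integral_mul_deriv_eq_deriv_mul_of_integrable (u := fun t : ℝ => Complex.exp (s * t))
    (v := χ) (u' := fun t : ℝ => s * Complex.exp (s * t)) (v' := deriv χ)
    (fun t _ => h1 t) (fun t _ => ((hχ.differentiable (by simp)) t).hasDerivAt)
    ((integrable_mul_cexp hd hc.deriv s).congr (.of_forall fun t => mul_comm _ _))
    (((integrable_mul_cexp hχ.continuous hc s).const_mul s).congr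
      (.of_forall fun t => by simp only [Pi.mul_apply]; ring))
    ((integrable_mul_cexp hχ.continuous hc s).congr (.of_forall fun t => mul_comm _ _))
  calc laplace (deriv χ) s = ∫ t : ℝ, Complex.exp (s * t) * deriv χ t := by
        simp only [laplace, mul_comm]
    _ = -∫ t : ℝ, s * Complex.exp (s * t) * χ t := h3
    _ = -s * laplace χ s := by
        rw [laplace, neg_mul, ← integral_const_mul]
        congr 2 with t
        ring

lemma contDiff_iteratedDeriv (hχ : ContDiff ℝ ∞ χ) (n : ℕ) : ContDiff ℝ ∞ (iteratedDeriv n χ) := by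
  induction n with
  | zero => simpa using hχ
  | succ n ih =>
    rw [iteratedDeriv_succ]
    exact (contDiff_infty_iff_deriv.1 ih).2

lemma hasCompactSupport_iteratedDeriv (hc : HasCompactSupport χ) (n : ℕ) :
    HasCompactSupport (iteratedDeriv n χ) := by
  induction n with
  | zero => simpa using hc
  | succ n ih =>
    rw [iteratedDeriv_succ]
    exact ih.deriv

lemma laplace_iteratedDeriv (hχ : ContDiff ℝ ∞ χ) (hc : HasCompactSupport χ) (s : ℂ) (n : ℕ) :
    laplace (iteratedDeriv n χ) s = (-s) ^ n * laplace χ s := by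
  induction n with
  | zero => simp
  | succ n ih =>
    rw [iteratedDeriv_succ, laplace_deriv (contDiff_iteratedDeriv hχ n)
      (hasCompactSupport_iteratedDeriv hc n), ih]
    ring

/-- The factor -2π in `vline` matches the normalization of `𝓕`, so Schwartz decay and Fourier
inversion for χ(t) e^{ct} carry over to vertical lines. -/
lemma laplace_vline (χ : ℝ → ℂ) (c w : ℝ) :
    laplace χ (vline c w) = 𝓕 (fun t : ℝ => χ t * Complex.exp (c * t)) w := by
  rw [Real.fourier_real_eq_integral_exp_smul, laplace]
  congr 1 with t
  rw [smul_eq_mul, mul_left_comm, ← Complex.exp_add]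
  congr 2
  simp only [vline]
  push_cast
  ring

lemma contDiff_mul_cexp (hχ : ContDiff ℝ ∞ χ) (s : ℂ) :
    ContDiff ℝ ∞ fun t : ℝ => χ t * Complex.exp (s * t) :=
  hχ.mul (contDiff_const.mul Complex.ofRealCLM.contDiff).cexp

lemma integrable_laplace_vline (hχ : ContDiff ℝ ∞ χ) (hc : HasCompactSupport χ) (c : ℝ) :
    Integrable fun w : ℝ => laplace χ (vline c w) := by
  simp only [laplace_vline]
  have h1 : HasCompactSupport fun t : ℝ => χ t * Complex.exp (c * t) := hc.mul_right
  exact (𝓕 (h1.toSchwartzMap (contDiff_mul_cexp hχ c))).integrable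

lemma continuous_laplace_vline (hχ : ContDiff ℝ ∞ χ) (hc : HasCompactSupport χ) (c : ℝ) :
    Continuous fun w : ℝ => laplace χ (vline c w) := by
  simp only [laplace_vline]
  have h1 : HasCompactSupport fun t : ℝ => χ t * Complex.exp (c * t) := hc.mul_right
  exact (𝓕 (h1.toSchwartzMap (contDiff_mul_cexp hχ c))).continuous

lemma integrable_pow_mul_laplace_vline (hχ : ContDiff ℝ ∞ χ) (hc : HasCompactSupport χ) (c : ℝ)
    (n : ℕ) : Integrable fun w : ℝ => (-vline c w) ^ n * laplace χ (vline c w) := by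
  simp only [← laplace_iteratedDeriv hχ hc]
  exact integrable_laplace_vline (contDiff_iteratedDeriv hχ n)
    (hasCompactSupport_iteratedDeriv hc n) c

lemma integral_laplace_vline (hχ : ContDiff ℝ ∞ χ) (hc : HasCompactSupport χ) (c t : ℝ) :
    ∫ w : ℝ, laplace χ (vline c w) * Complex.exp (-(vline c w * t)) = χ t := by
  have h1 : HasCompactSupport fun t : ℝ => χ t * Complex.exp (c * t) := hc.mul_right
  have h2 := (contDiff_mul_cexp hχ c).continuous
  have h3 := congrFun (h2.fourierInv_fourier_eq (h2.integrable_of_hasCompactSupport h1)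
    ((integrable_laplace_vline hχ hc c).congr (.of_forall fun w => laplace_vline χ c w))) t
  rw [Real.fourierInv_eq'] at h3
  calc ∫ w : ℝ, laplace χ (vline c w) * Complex.exp (-(vline c w * t))
      = Complex.exp (-(c * t)) * ∫ w : ℝ, Complex.exp (↑(2 * Real.pi * inner ℝ w t) * Complex.I) •
          𝓕 (fun t : ℝ => χ t * Complex.exp (c * t)) w := by
        rw [← integral_const_mul]
        congr 1 with w
        rw [← laplace_vline, smul_eq_mul, ← mul_assoc, ← Complex.exp_add, mul_comm]
        congr 2
        simp only [vline, RCLike.inner_apply, conj_trivial]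
        push_cast
        ring
    _ = χ t := by
        rw [h3, mul_left_comm, ← Complex.exp_add]
        simp

lemma integral_pow_mul_laplace_vline (hχ : ContDiff ℝ ∞ χ) (hc : HasCompactSupport χ) (c t : ℝ)
    (n : ℕ) : ∫ w : ℝ, (-vline c w) ^ n * laplace χ (vline c w) * Complex.exp (-(vline c w * t)) =
      iteratedDeriv n χ t := by
  simp only [← laplace_iteratedDeriv hχ hc]
  exact integral_laplace_vline (contDiff_iteratedDeriv hχ n)
    (hasCompactSupport_iteratedDeriv hc n) c t

/-- The action `∑ c_j ⟨δ_0^{(j)}, ψ⟩` of the differential operator with symbol `P = ∑ c_j s^j` -/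
def diffEval (P : Polynomial ℂ) (ψ : ℝ → ℂ) : ℂ :=
  P.sum fun j c => c * ((-1) ^ j * iteratedDeriv j ψ 0)

lemma integrable_polynomial_mul_laplace_vline (P : Polynomial ℂ) (hχ : ContDiff ℝ ∞ χ)
    (hc : HasCompactSupport χ) (c : ℝ) :
    Integrable fun w : ℝ => P.eval (vline c w) * laplace χ (vline c w) := by
  simp only [Polynomial.eval_eq_sum, Polynomial.sum, Finset.sum_mul]
  refine integrable_finsetSum _ fun j _ => ?_
  refine ((integrable_pow_mul_laplace_vline hχ hc c j).const_mul (P.coeff j * (-1) ^ j)).congr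
    (.of_forall fun w => ?_)
  simp only
  rw [neg_pow (vline c w)]
  have h1 : ((-1 : ℂ) ^ j) * (-1) ^ j = 1 := by rw [← mul_pow]; simp
  linear_combination P.coeff j * vline c w ^ j * laplace χ (vline c w) * h1

/-- A power (-s)^j of the variable is a j-th derivative of χ, and inversion is applied at t = 0. -/
lemma integral_polynomial_mul_laplace_vline (P : Polynomial ℂ) (hχ : ContDiff ℝ ∞ χ)
    (hc : HasCompactSupport χ) (c : ℝ) :
    ∫ w : ℝ, P.eval (vline c w) * laplace χ (vline c w) = diffEval P χ := by
  have h0 : ∀ j (w : ℝ), P.coeff j * vline c w ^ j * laplace χ (vline c w) =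
      P.coeff j * (-1) ^ j * ((-vline c w) ^ j * laplace χ (vline c w)) := by
    intro j w
    rw [neg_pow (vline c w)]
    have h1 : ((-1 : ℂ) ^ j) * (-1) ^ j = 1 := by rw [← mul_pow]; simp
    linear_combination -(P.coeff j * vline c w ^ j * laplace χ (vline c w) * h1)
  simp only [Polynomial.eval_eq_sum, Polynomial.sum, Finset.sum_mul, h0, diffEval]
  rw [integral_finsetSum _ fun j _ => (integrable_pow_mul_laplace_vline hχ hc c j).const_mul _]
  refine Finset.sum_congr rfl fun j _ => ?_
  rw [integral_const_mul, ← integral_pow_mul_laplace_vline hχ hc c 0 j]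
  simp [mul_assoc]

/-- If the Laplace transform of `F`, multiplied by `s^d`, is the sum of a polynomial and of a
general Dirichlet series, then the `d`-th derivative of `F` in the sense of distributions is a sum
of derivatives of `δ_0` and of Dirac distributions. -/
theorem hasSum_of_laplace_eq {ι : Type*} [Countable ι] {F : ℝ → ℂ} {c : ℝ} (hF : Continuous F)
    (hFc : Integrable fun t : ℝ => ‖F t‖ * Real.exp (-(c * t))) (d : ℕ) (R : Polynomial ℂ)
    {μ : ι → ℂ} {ℓ : ι → ℝ} (hμ : Summable fun k => ‖μ k‖ * Real.exp (-(c * ℓ k)))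
    (hlap : ∀ s : ℂ, s.re = c → HasSum (fun k => μ k * Complex.exp (-(s * ℓ k)))
      (s ^ d * (∫ t : ℝ, F t * Complex.exp (-(s * t))) - R.eval s))
    (hχ : ContDiff ℝ ∞ χ) (hc : HasCompactSupport χ) :
    HasSum (fun k => μ k * χ (ℓ k))
      ((-1) ^ d * (∫ t : ℝ, F t * iteratedDeriv d χ t) - diffEval R χ) := by
  have hint := integrable_laplace_vline hχ hc c
  -- Inversion writes the d-th derivative of χ as an integral over the line. Fubini applies because
  -- F is integrable against e^{-ct} and the Laplace transform, even times s^d, is integrable on the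
  -- line.
  have hprod : Integrable (Function.uncurry fun t w : ℝ => F t *
      ((-vline c w) ^ d * laplace χ (vline c w) * Complex.exp (-(vline c w * t))))
      (volume.prod volume) := by
    have h2 := hFc.mul_prod (integrable_pow_mul_laplace_vline hχ hc c d).norm
    refine h2.mono' ?_ (.of_forall fun p => ?_)
    · have h3 := continuous_laplace_vline hχ hc c
      have h4 := continuous_vline c
      have h5 : Continuous fun p : ℝ × ℝ => laplace χ (vline c p.2) := h3.comp continuous_snd
      have h6 : Continuous fun p : ℝ × ℝ => F p.1 *
          ((-vline c p.2) ^ d * laplace χ (vline c p.2) *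
            Complex.exp (-(vline c p.2 * p.1))) := by fun_prop
      exact h6.aestronglyMeasurable
    · simp only [Function.uncurry, norm_mul, norm_exp_neg_vline_mul]
      exact le_of_eq (by ring)
  have hpull : ∀ w : ℝ, ∫ t : ℝ, F t *
      ((-vline c w) ^ d * laplace χ (vline c w) * Complex.exp (-(vline c w * t))) =
      (-vline c w) ^ d * laplace χ (vline c w) *
        ∫ t : ℝ, F t * Complex.exp (-(vline c w * t)) := by
    intro w
    rw [← integral_const_mul]
    refine integral_congr_ae (.of_forall fun t => ?_)
    simp only
    ring
  have h1 : ∫ t : ℝ, F t * iteratedDeriv d χ t =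
      ∫ w : ℝ, (-vline c w) ^ d * laplace χ (vline c w) *
        ∫ t : ℝ, F t * Complex.exp (-(vline c w * t)) := by
    simp only [← integral_pow_mul_laplace_vline hχ hc c, ← integral_const_mul]
    rw [integral_integral_swap hprod]
    simp only [hpull, ← integral_const_mul]
  have h2 : ∀ k, Integrable fun w : ℝ => laplace χ (vline c w) *
      (μ k * Complex.exp (-(vline c w * ℓ k))) := by
    intro k
    refine hint.mul_bdd (c := ‖μ k‖ * Real.exp (-(c * ℓ k))) ?_ (.of_forall fun w => ?_)
    · have := continuous_vline c
      exact Continuous.aestronglyMeasurable (by fun_prop)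
    · rw [norm_mul, norm_exp_neg_vline_mul]
  have h3 : Summable fun k => ∫ w : ℝ, ‖laplace χ (vline c w) *
      (μ k * Complex.exp (-(vline c w * ℓ k)))‖ := by
    simp only [norm_mul, norm_exp_neg_vline_mul, integral_mul_const]
    exact hμ.mul_left _
  -- On the line every exponential has constant modulus, so the series can be integrated term by
  -- term; inversion at ℓ k then gives μ k * χ (ℓ k).
  have h4 := hasSum_integral_of_summable_integral_norm h2 h3
  convert! h4 using 1
  · funext k
    rw [← integral_laplace_vline hχ hc c (ℓ k), ← integral_const_mul]
    congr 1 with w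
    ring
  · rw [h1, ← integral_polynomial_mul_laplace_vline R hχ hc c, ← integral_const_mul]
    simp only [tsum_mul_left, (hlap _ (vline_re c _)).tsum_eq]
    rw [← integral_sub]
    · congr 1 with w
      rw [neg_pow (vline c w)]
      have h1 : ((-1 : ℂ) ^ d) * (-1) ^ d = 1 := by rw [← mul_pow]; simp
      linear_combination vline c w ^ d * laplace χ (vline c w) *
        (∫ t : ℝ, F t * Complex.exp (-(vline c w * t))) * h1
    · have h5 := hprod.integral_prod_right
      simp only [Function.uncurry, hpull] at h5
      exact h5.const_mul _
    · exact integrable_polynomial_mul_laplace_vline R hχ hc c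

end FourierLaplace

/-! ### Sums of exponentials and their Laplace transforms -/

lemma integrableOn_pow_mul_cexp_neg (n : ℕ) {s : ℂ} (hs : 0 < s.re) :
    IntegrableOn (fun t : ℝ => (t : ℂ) ^ n * Complex.exp (-(s * t))) (Ioi 0) := by
  have hε : 0 < s.re / 2 := by linarith
  have h1 : IntegrableOn (fun t : ℝ => (n.factorial / (s.re / 2) ^ n) *
      Real.exp (-(s.re / 2) * t)) (Ioi 0) :=
    (integrableOn_exp_mul_Ioi (by linarith) 0).const_mul _
  refine h1.mono' (by fun_prop) ?_
  refine (ae_restrict_mem measurableSet_Ioi).mono fun t (ht : 0 < t) => ?_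
  rw [norm_mul, norm_pow, Complex.norm_real, Real.norm_of_nonneg ht.le, Complex.norm_exp]
  have h2 := Real.pow_div_factorial_le_exp (s.re / 2 * t) (by positivity) n
  rw [mul_pow, div_le_iff₀ (by positivity)] at h2
  have h3 : t ^ n ≤ n.factorial / (s.re / 2) ^ n * Real.exp (s.re / 2 * t) := by
    rw [div_mul_eq_mul_div, le_div_iff₀ (by positivity)]
    linarith
  calc t ^ n * Real.exp (-(s * t)).re
      ≤ n.factorial / (s.re / 2) ^ n * Real.exp (s.re / 2 * t) * Real.exp (-(s * t)).re := by gcongr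
    _ = _ := by
      rw [mul_assoc, ← Real.exp_add]
      congr 2
      simp
      ring

lemma tendsto_pow_mul_cexp_neg (n : ℕ) {s : ℂ} (hs : 0 < s.re) :
    Tendsto (fun t : ℝ => (t : ℂ) ^ n * Complex.exp (-(s * t))) atTop (𝓝 0) := by
  rw [tendsto_zero_iff_norm_tendsto_zero]
  refine (tendsto_rpow_mul_exp_neg_mul_atTop_nhds_zero n s.re hs).congr' ?_
  filter_upwards [eventually_ge_atTop 0] with t ht
  rw [norm_mul, norm_pow, Complex.norm_real, Real.norm_of_nonneg ht, Complex.norm_exp,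
    Real.rpow_natCast]
  simp

lemma integral_pow_mul_cexp_neg (n : ℕ) {s : ℂ} (hs : 0 < s.re) :
    ∫ t : ℝ in Ioi 0, (t : ℂ) ^ n * Complex.exp (-(s * t)) = n.factorial / s ^ (n + 1) := by
  have hs0 : s ≠ 0 := by
    rintro rfl
    simp at hs
  induction n with
  | zero =>
    have h1 := integral_exp_mul_complex_Ioi (a := -s) (by simpa using hs) 0
    simpa [hs0] using h1
  | succ n ih =>
    have hd : ∀ t : ℝ, HasDerivAt (fun t : ℝ => (t : ℂ) ^ (n + 1) * Complex.exp (-(s * t)))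
        ((n + 1 : ℂ) * ((t : ℂ) ^ n * Complex.exp (-(s * t))) -
          s * ((t : ℂ) ^ (n + 1) * Complex.exp (-(s * t)))) t := by
      intro t
      have h1 := Complex.ofRealCLM.hasDerivAt (x := t)
      have h2 := (h1.pow (n + 1)).mul (h1.const_mul s).neg.cexp
      refine h2.congr_deriv ?_
      simp
      ring
    have h2 := integral_Ioi_of_hasDerivAt_of_tendsto (a := 0) (hd 0).continuousAt.continuousWithinAt
      (fun t _ => hd t) (((integrableOn_pow_mul_cexp_neg n hs).const_mul _).sub
        ((integrableOn_pow_mul_cexp_neg (n + 1) hs).const_mul s))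
      (tendsto_pow_mul_cexp_neg (n + 1) hs)
    rw [integral_sub ((integrableOn_pow_mul_cexp_neg n hs).const_mul _)
        ((integrableOn_pow_mul_cexp_neg (n + 1) hs).const_mul s), integral_const_mul,
      integral_const_mul, ih] at h2
    simp only [Complex.ofReal_zero, ne_eq, Nat.add_eq_zero_iff, one_ne_zero, and_false,
      not_false_eq_true, zero_pow, zero_mul, sub_zero] at h2
    rw [Nat.factorial_succ, eq_div_iff (pow_ne_zero _ hs0), pow_succ _ (n + 1)]
    push_cast
    rw [sub_eq_zero] at h2
    calc _ = (s * ∫ t : ℝ in Ioi 0, (t : ℂ) ^ (n + 1) * Complex.exp (-(s * t))) * s ^ (n + 1) := by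
          ring
      _ = _ := by
        rw [← h2]
        field_simp

/-- This is the effect of subtracting K(0): the numerator τ cancels one power of the denominator
τ^d, and the denominator s one power of s^d, leaving the exponent d - 1 of the Hadamard side. -/
lemma integral_cexp_sub_one_mul_cexp_neg {s τ : ℂ} (hs : 0 < s.re) (hτ : τ.re < s.re) :
    IntegrableOn (fun t : ℝ => (Complex.exp (τ * t) - 1) * Complex.exp (-(s * t))) (Ioi 0) ∧
    ∫ t : ℝ in Ioi 0, (Complex.exp (τ * t) - 1) * Complex.exp (-(s * t)) =
      τ / (s * (s - τ)) := by
  have hs0 : s ≠ 0 := by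
    rintro rfl
    simp at hs
  have hsτ : s - τ ≠ 0 := by
    intro h
    have := congrArg Complex.re h
    simp at this
    linarith
  have h1 : (τ - s).re < 0 := by simpa using hτ
  have h2 : (-s).re < 0 := by simpa using hs
  have h3 : (fun t : ℝ => (Complex.exp (τ * t) - 1) * Complex.exp (-(s * t))) =
      fun t : ℝ => Complex.exp ((τ - s) * t) - Complex.exp (-s * t) := by
    funext t
    rw [sub_mul, ← Complex.exp_add]
    ring_nf
  rw [h3]
  refine ⟨(integrableOn_exp_mul_complex_Ioi h1 0).sub (integrableOn_exp_mul_complex_Ioi h2 0), ?_⟩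
  rw [integral_sub (integrableOn_exp_mul_complex_Ioi h1 0) (integrableOn_exp_mul_complex_Ioi h2 0),
    integral_exp_mul_complex_Ioi h1, integral_exp_mul_complex_Ioi h2]
  have h4 : τ - s ≠ 0 := fun h => hsτ (by rw [← neg_sub, h, neg_zero])
  simp only [Complex.ofReal_zero, mul_zero, Complex.exp_zero]
  field_simp
  ring

section ExponentialSum

variable {ι : Type*} {n τ : ι → ℂ} {d : ℕ} {κ : ℝ}

lemma norm_exponentialTerm_le (hτ : ∀ i, (τ i).re ≤ κ) {t : ℝ} (ht : 0 ≤ t) (i : ι) :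
    ‖n i / τ i ^ d * Complex.exp (τ i * t)‖ ≤ ‖n i‖ / ‖τ i‖ ^ d * Real.exp (κ * t) := by
  rw [norm_mul, norm_div, norm_pow, Complex.norm_exp]
  have : (τ i * t).re ≤ κ * t := by
    simpa using mul_le_mul_of_nonneg_right (hτ i) ht
  gcongr

lemma summable_exponentialTerm (hs : Summable fun i => ‖n i‖ / ‖τ i‖ ^ d)
    (hτ : ∀ i, (τ i).re ≤ κ) {t : ℝ} (ht : 0 ≤ t) :
    Summable fun i => n i / τ i ^ d * Complex.exp (τ i * t) :=
  (hs.mul_right _).of_norm_bounded (norm_exponentialTerm_le hτ ht)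

/-- The function `(K(t) - K(0)) 1_{[0, ∞)}(t)` with
`K(t) = n₀ t^d / d! + ∑ n_i τ_i^{-d} e^{τ_i t}`. -/
def exponentialPrimitive (n₀ : ℂ) (n τ : ι → ℂ) (d : ℕ) (t : ℝ) : ℂ :=
  (Ici (0 : ℝ)).indicator (fun t : ℝ =>
    (n₀ * (t : ℂ) ^ d / (d.factorial : ℂ) + ∑' i, n i / τ i ^ d * Complex.exp (τ i * t)) -
    (n₀ * ((0 : ℝ) : ℂ) ^ d / (d.factorial : ℂ) +
      ∑' i, n i / τ i ^ d * Complex.exp (τ i * (0 : ℝ)))) t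

lemma exponentialPrimitive_of_nonneg (hs : Summable fun i => ‖n i‖ / ‖τ i‖ ^ d)
    (hτ : ∀ i, (τ i).re ≤ κ) (hd : 1 ≤ d) (n₀ : ℂ) {t : ℝ} (ht : 0 ≤ t) :
    exponentialPrimitive n₀ n τ d t = n₀ * (t : ℂ) ^ d / (d.factorial : ℂ) +
      ∑' i, n i / τ i ^ d * (Complex.exp (τ i * t) - 1) := by
  have h1 := (summable_exponentialTerm hs hτ ht).hasSum.sub
    (summable_exponentialTerm hs hτ le_rfl).hasSum
  rw [exponentialPrimitive, indicator_of_mem (mem_Ici.2 ht), Complex.ofReal_zero,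
    zero_pow (by omega), mul_zero, zero_div, zero_add, add_sub_assoc, ← Complex.ofReal_zero,
    ← h1.tsum_eq]
  congr 1
  refine tsum_congr fun i => ?_
  simp
  ring

lemma exponentialPrimitive_of_neg (n₀ : ℂ) {t : ℝ} (ht : t < 0) :
    exponentialPrimitive n₀ n τ d t = 0 :=
  indicator_of_notMem (by simpa using ht) _

lemma continuous_exponentialPrimitive (hs : Summable fun i => ‖n i‖ / ‖τ i‖ ^ d)
    (hτ : ∀ i, (τ i).re ≤ κ) (hκ : 0 ≤ κ) (hd : 1 ≤ d) (n₀ : ℂ) :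
    Continuous (exponentialPrimitive n₀ n τ d) := by
  -- Re τ_i is bounded only from above, so the series is controlled only for t ≥ 0. Replacing t by
  -- `max t 0` removes the indicator, since K(t) - K(0) vanishes at t = 0.
  have h1 : Continuous fun t : ℝ =>
      ∑' i, n i / τ i ^ d * Complex.exp (τ i * ((max t 0 : ℝ) : ℂ)) := by
    rw [continuous_iff_continuousAt]
    intro t₀
    have h2 : ContinuousOn (fun t : ℝ =>
        ∑' i, n i / τ i ^ d * Complex.exp (τ i * ((max t 0 : ℝ) : ℂ))) (Iio (|t₀| + 1)) := by
      refine continuousOn_tsum (fun i => Continuous.continuousOn (by fun_prop))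
        (hs.mul_right (Real.exp (κ * (|t₀| + 1)))) fun i t (ht : t < _) => ?_
      refine (norm_exponentialTerm_le hτ (le_max_right _ _) i).trans ?_
      have h3 : max t 0 ≤ |t₀| + 1 := max_le ht.le (by positivity)
      gcongr
    exact h2.continuousAt (Iio_mem_nhds (by linarith [le_abs_self t₀]))
  have h4 : exponentialPrimitive n₀ n τ d = fun t : ℝ =>
      (n₀ * ((max t 0 : ℝ) : ℂ) ^ d / (d.factorial : ℂ) +
        ∑' i, n i / τ i ^ d * Complex.exp (τ i * ((max t 0 : ℝ) : ℂ))) -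
      ∑' i, n i / τ i ^ d * Complex.exp (τ i * (0 : ℝ)) := by
    funext t
    rcases le_or_gt 0 t with ht | ht
    · rw [exponentialPrimitive, indicator_of_mem (mem_Ici.2 ht), max_eq_left ht]
      simp [show d ≠ 0 by omega]
    · rw [exponentialPrimitive_of_neg n₀ ht, max_eq_right ht.le]
      simp [show d ≠ 0 by omega]
  rw [h4]
  fun_prop

/-- The rate κ handles the exponentials e^{τ_i t}; the additional 1 handles t^d/d! ≤ e^t. -/
lemma norm_exponentialPrimitive_le (hs : Summable fun i => ‖n i‖ / ‖τ i‖ ^ d)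
    (hτ : ∀ i, (τ i).re ≤ κ) (hκ : 0 ≤ κ) (hd : 1 ≤ d) (n₀ : ℂ) {t : ℝ} (ht : 0 ≤ t) :
    ‖exponentialPrimitive n₀ n τ d t‖ ≤
      (‖n₀‖ + 2 * ∑' i, ‖n i‖ / ‖τ i‖ ^ d) * Real.exp ((κ + 1) * t) := by
  have hS : 0 ≤ ∑' i, ‖n i‖ / ‖τ i‖ ^ d := tsum_nonneg fun i => by positivity
  have h1 : ‖n₀ * (t : ℂ) ^ d / (d.factorial : ℂ)‖ ≤ ‖n₀‖ * Real.exp ((κ + 1) * t) := by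
    rw [norm_div, norm_mul, norm_pow, Complex.norm_real, Real.norm_of_nonneg ht,
      Complex.norm_natCast, mul_div_assoc]
    have h2 : t ≤ (κ + 1) * t := by nlinarith
    exact mul_le_mul_of_nonneg_left ((Real.pow_div_factorial_le_exp t ht d).trans
      (Real.exp_le_exp.2 h2)) (norm_nonneg _)
  have h3 : ‖∑' i, n i / τ i ^ d * (Complex.exp (τ i * t) - 1)‖ ≤
      (∑' i, ‖n i‖ / ‖τ i‖ ^ d) * (2 * Real.exp ((κ + 1) * t)) := by
    refine tsum_of_norm_bounded (hs.hasSum.mul_right _) fun i => ?_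
    rw [norm_mul, norm_div, norm_pow]
    refine mul_le_mul_of_nonneg_left ?_ (by positivity)
    have h4 : ‖Complex.exp (τ i * t)‖ ≤ Real.exp ((κ + 1) * t) := by
      rw [Complex.norm_exp]
      refine Real.exp_le_exp.2 ?_
      have := mul_le_mul_of_nonneg_right (hτ i) ht
      simp
      linarith
    have h5 : 1 ≤ Real.exp ((κ + 1) * t) := Real.one_le_exp (by positivity)
    calc ‖Complex.exp (τ i * t) - 1‖ ≤ ‖Complex.exp (τ i * t)‖ + ‖(1 : ℂ)‖ := norm_sub_le _ _
      _ ≤ _ := by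
        rw [norm_one]
        linarith
  rw [exponentialPrimitive_of_nonneg hs hτ hd n₀ ht]
  exact (norm_add_le _ _).trans (by linarith)

lemma integrable_norm_exponentialPrimitive (hs : Summable fun i => ‖n i‖ / ‖τ i‖ ^ d)
    (hτ : ∀ i, (τ i).re ≤ κ) (hκ : 0 ≤ κ) (hd : 1 ≤ d) (n₀ : ℂ) {c : ℝ} (hc : κ + 1 < c) :
    Integrable fun t : ℝ => ‖exponentialPrimitive n₀ n τ d t‖ * Real.exp (-(c * t)) := by
  have h1 : IntegrableOn (fun t : ℝ => (‖n₀‖ + 2 * ∑' i, ‖n i‖ / ‖τ i‖ ^ d) *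
      Real.exp ((κ + 1 - c) * t)) (Ici 0) :=
    ((integrableOn_Ici_iff_integrableOn_Ioi (by simp)).2
      (integrableOn_exp_mul_Ioi (by linarith) 0)).const_mul _
  rw [← integrable_indicator_iff measurableSet_Ici] at h1
  have h2 := continuous_exponentialPrimitive hs hτ hκ hd n₀
  refine h1.mono' (Continuous.aestronglyMeasurable (by fun_prop)) (.of_forall fun t => ?_)
  rcases le_or_gt 0 t with ht | ht
  · rw [indicator_of_mem (mem_Ici.2 ht), norm_mul, norm_norm, Real.norm_of_nonneg (Real.exp_nonneg _),
      show (κ + 1 - c) * t = (κ + 1) * t + -(c * t) by ring, Real.exp_add, ← mul_assoc]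
    exact mul_le_mul_of_nonneg_right (norm_exponentialPrimitive_le hs hτ hκ hd n₀ ht)
      (Real.exp_nonneg _)
  · rw [exponentialPrimitive_of_neg n₀ ht, indicator_of_notMem (by simpa using ht)]
    simp

/-- The Laplace transform of the primitive: its product with `s^d` is a sum of simple fractions. -/
lemma hasSum_laplace_exponentialPrimitive [Countable ι]
    (hs : Summable fun i => ‖n i‖ / ‖τ i‖ ^ d) (hτ0 : ∀ i, τ i ≠ 0)
    (hτ : ∀ i, (τ i).re ≤ κ) (hκ : 0 ≤ κ) (hd : 1 ≤ d) (n₀ : ℂ) {s : ℂ} (hsκ : κ + 1 < s.re) :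
    HasSum (fun i => n i * (s ^ (d - 1) / (τ i ^ (d - 1) * (s - τ i))))
      (s ^ d * (∫ t : ℝ, exponentialPrimitive n₀ n τ d t * Complex.exp (-(s * t))) - n₀ / s) := by
  have hspos : 0 < s.re := by linarith
  have hs0 : s ≠ 0 := by
    rintro rfl
    simp at hspos
  have hτs : ∀ i, (τ i).re < s.re := fun i => (hτ i).trans_lt (by linarith)
  have hE : Integrable fun t : ℝ => exponentialPrimitive n₀ n τ d t * Complex.exp (-(s * t)) := by
    have h1 := continuous_exponentialPrimitive hs hτ hκ hd n₀
    refine (integrable_norm_exponentialPrimitive hs hτ hκ hd n₀ hsκ).mono'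
      (Continuous.aestronglyMeasurable (by fun_prop)) (.of_forall fun t => ?_)
    rw [norm_mul, Complex.norm_exp (-(s * t))]
    simp
  have hE0 : ∫ t : ℝ, exponentialPrimitive n₀ n τ d t * Complex.exp (-(s * t)) =
      ∫ t : ℝ in Ioi 0, exponentialPrimitive n₀ n τ d t * Complex.exp (-(s * t)) := by
    rw [← integral_Ici_eq_integral_Ioi, setIntegral_eq_integral_of_forall_compl_eq_zero]
    intro t ht
    rw [exponentialPrimitive_of_neg n₀ (by simpa using ht), zero_mul]
  -- The monomial n₀ t^d/d! has transform n₀/s^(d+1), which becomes the separate fraction n₀/s after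
  -- multiplication by s^d.
  have h1 : ∫ t : ℝ in Ioi 0,
      ∑' i, n i / τ i ^ d * ((Complex.exp (τ i * t) - 1) * Complex.exp (-(s * t))) =
      (∫ t : ℝ, exponentialPrimitive n₀ n τ d t * Complex.exp (-(s * t))) -
        n₀ / d.factorial * (d.factorial / s ^ (d + 1)) := by
    rw [hE0, ← integral_pow_mul_cexp_neg d hspos, ← integral_const_mul,
      ← integral_sub hE.integrableOn ((integrableOn_pow_mul_cexp_neg d hspos).const_mul _)]
    refine setIntegral_congr_fun measurableSet_Ioi fun t (ht : 0 < t) => ?_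
    rw [exponentialPrimitive_of_nonneg hs hτ hd n₀ ht.le, add_mul, ← tsum_mul_right]
    simp only [mul_assoc]
    ring
  have h2 : ∀ i, Integrable (fun t : ℝ => n i / τ i ^ d *
      ((Complex.exp (τ i * t) - 1) * Complex.exp (-(s * t)))) (volume.restrict (Ioi 0)) :=
    fun i => (integral_cexp_sub_one_mul_cexp_neg hspos (hτs i)).1.const_mul _
  have hexp : IntegrableOn (fun t : ℝ => 2 * Real.exp ((κ - s.re) * t)) (Ioi 0) :=
    (integrableOn_exp_mul_Ioi (by linarith) 0).const_mul _
  have h3 : Summable fun i => ∫ t : ℝ in Ioi 0, ‖n i / τ i ^ d *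
      ((Complex.exp (τ i * t) - 1) * Complex.exp (-(s * t)))‖ := by
    refine (hs.mul_right (∫ t : ℝ in Ioi 0, 2 * Real.exp ((κ - s.re) * t))).of_nonneg_of_le
      (fun i => integral_nonneg fun t => norm_nonneg _) fun i => ?_
    rw [← integral_const_mul]
    refine setIntegral_mono_on (h2 i).norm (hexp.const_mul _) measurableSet_Ioi
      fun t (ht : 0 < t) => ?_
    rw [norm_mul, norm_div, norm_pow]
    refine mul_le_mul_of_nonneg_left ?_ (by positivity)
    have h4 : ‖Complex.exp (τ i * t)‖ ≤ Real.exp (κ * t) := by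
      rw [Complex.norm_exp]
      refine Real.exp_le_exp.2 ?_
      simpa using mul_le_mul_of_nonneg_right (hτ i) ht.le
    have h5 : 1 ≤ Real.exp (κ * t) := Real.one_le_exp (by positivity)
    have h6 : ‖Complex.exp (τ i * t) - 1‖ ≤ 2 * Real.exp (κ * t) :=
      (norm_sub_le _ _).trans (by rw [norm_one]; linarith)
    rw [norm_mul, Complex.norm_exp (-(s * t)), sub_mul κ, sub_eq_add_neg (κ * t), Real.exp_add,
      ← mul_assoc]
    refine mul_le_mul h6 (le_of_eq ?_) (Real.exp_nonneg _) (by positivity)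
    simp
  have h4 := hasSum_integral_of_summable_integral_norm h2 h3
  rw [h1] at h4
  convert! h4.mul_left (s ^ d) using 1
  · funext i
    have hτi := hτ0 i
    have hsi : s - τ i ≠ 0 := by
      intro h
      have h6 := congrArg Complex.re h
      have h7 := hτs i
      simp at h6
      linarith
    obtain ⟨m, rfl⟩ : ∃ m, d = m + 1 := ⟨d - 1, by omega⟩
    rw [integral_const_mul, (integral_cexp_sub_one_mul_cexp_neg hspos (hτs i)).2,
      Nat.add_sub_cancel]
    field_simp
    ring
  · have h6 : (d.factorial : ℂ) ≠ 0 := by exact_mod_cast d.factorial_ne_zero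
    field_simp
    ring

end ExponentialSum

/-! ### Differential operators at the origin -/

lemma diffEval_monomial (j : ℕ) (c : ℂ) (ψ : ℝ → ℂ) :
    diffEval (Polynomial.monomial j c) ψ = c * ((-1) ^ j * iteratedDeriv j ψ 0) :=
  Polynomial.sum_monomial_index c _ (by simp)

lemma diffEval_add (P R : Polynomial ℂ) (ψ : ℝ → ℂ) :
    diffEval (P + R) ψ = diffEval P ψ + diffEval R ψ :=
  Polynomial.sum_add_index P R _ (by simp) fun _ _ _ => add_mul _ _ _

lemma diffEval_C_mul (c : ℂ) (P : Polynomial ℂ) (ψ : ℝ → ℂ) :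
    diffEval (Polynomial.C c * P) ψ = c * diffEval P ψ := by
  induction P using Polynomial.induction_on' with
  | add p q hp hq => rw [mul_add, diffEval_add, hp, hq, diffEval_add, mul_add]
  | monomial n b => rw [Polynomial.C_mul_monomial, diffEval_monomial, diffEval_monomial, mul_assoc]

/-- Multiplying the symbol by s differentiates the distribution, which moves to the test function
with a minus sign. -/
lemma diffEval_X_mul (P : Polynomial ℂ) (ψ : ℝ → ℂ) :
    diffEval (Polynomial.X * P) ψ = diffEval P fun t => -deriv ψ t := by
  induction P using Polynomial.induction_on' with
  | add p q hp hq => rw [mul_add, diffEval_add, hp, hq, diffEval_add]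
  | monomial n b =>
    rw [Polynomial.X_mul_monomial, diffEval_monomial, diffEval_monomial, iteratedDeriv_fun_neg,
      iteratedDeriv_succ']
    ring

lemma diffEval_linear_combination (P : Polynomial ℂ) {φ ψ : ℝ → ℂ} (hφ : ContDiff ℝ ∞ φ)
    (hψ : ContDiff ℝ ∞ ψ) (b c : ℂ) :
    diffEval P (fun t => b * φ t + c * ψ t) = b * diffEval P φ + c * diffEval P ψ := by
  induction P using Polynomial.induction_on' with
  | add p q hp hq =>
    simp only [diffEval_add, hp, hq]
    ring
  | monomial n a =>
    have h1 : ContDiff ℝ n φ := hφ.of_le (by exact_mod_cast le_top)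
    have h2 : ContDiff ℝ n ψ := hψ.of_le (by exact_mod_cast le_top)
    rw [diffEval_monomial, diffEval_monomial, diffEval_monomial, iteratedDeriv_fun_add
      (contDiff_const.mul h1).contDiffAt (contDiff_const.mul h2).contDiffAt,
      iteratedDeriv_const_mul_field, iteratedDeriv_const_mul_field]
    ring

/-- An affine change of the symbol corresponds to a scaling and a multiplication by an exponential
of the argument. -/
lemma diffEval_comp (P : Polynomial ℂ) {φ : ℝ → ℂ} (hφ : ContDiff ℝ ∞ φ) (α : ℝ) (β : ℂ) :
    diffEval (P.comp (Polynomial.C (α : ℂ) * Polynomial.X + Polynomial.C β)) φ =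
      diffEval P fun t => φ (α * t) * Complex.exp (-(β * t)) := by
  induction P using Polynomial.induction_on' with
  | add p q hp hq => rw [Polynomial.add_comp, diffEval_add, hp, hq, diffEval_add]
  | monomial n c =>
    rw [← Polynomial.C_mul_X_pow_eq_monomial, Polynomial.mul_comp, Polynomial.C_comp,
      diffEval_C_mul, diffEval_C_mul]
    congr 1
    -- One step uses -d/dt (φ(αt) e^{-βt}) = (α(-φ')(αt) + βφ(αt)) e^{-βt}, matching multiplication
    -- by αX + β; the induction hypothesis is applied to both φ and -φ'.
    induction n generalizing φ with
    | zero =>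
      rw [pow_zero, Polynomial.one_comp, ← Polynomial.monomial_zero_one, diffEval_monomial,
        diffEval_monomial]
      simp
    | succ n ih =>
      have hφ' : ContDiff ℝ ∞ (deriv φ) := (contDiff_infty_iff_deriv.1 hφ).2
      have hd : ∀ t : ℝ, deriv (fun t : ℝ => φ (α * t) * Complex.exp (-(β * t))) t =
          (α * deriv φ (α * t) - β * φ (α * t)) * Complex.exp (-(β * t)) := by
        intro t
        have h1 : HasDerivAt (fun t : ℝ => φ (α * t)) (α • deriv φ (α * t)) t := by
          have h2 := ((hφ.differentiable (by simp)) (α * t)).hasDerivAt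
          have h3 := h2.scomp t ((hasDerivAt_id t).const_mul α)
          simpa using! h3
        have h4 := ((Complex.ofRealCLM.hasDerivAt (x := t)).const_mul β).neg.cexp
        have h5 : HasDerivAt (fun t : ℝ => φ (α * t) * Complex.exp (-(β * t))) _ t := h1.mul h4
        rw [h5.deriv]
        simp
        ring
      rw [pow_succ', Polynomial.mul_comp, Polynomial.X_comp, add_mul, diffEval_add, mul_assoc,
        diffEval_C_mul, diffEval_C_mul, diffEval_X_mul, diffEval_X_mul, ih hφ, ih hφ'.neg,
        ← diffEval_linear_combination]
      · congr 1 with t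
        rw [hd]
        ring
      · have := hφ'.neg.comp (contDiff_const.mul contDiff_id : ContDiff ℝ ∞ fun t : ℝ => α * t)
        exact this.mul (contDiff_const.mul Complex.ofRealCLM.contDiff).neg.cexp
      · have := hφ.comp (contDiff_const.mul contDiff_id : ContDiff ℝ ∞ fun t : ℝ => α * t)
        exact this.mul (contDiff_const.mul Complex.ofRealCLM.contDiff).neg.cexp

/-! ### Evaluation of distributions -/

@[simp]
lemma dirac_apply (x : ℝ) (φ : TestFn) : dirac x φ = φ x := rfl

lemma regular_apply {F : ℝ → ℂ} (hF : Continuous F) (φ : TestFn) :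
    regular F φ = ∫ t : ℝ, φ t * F t :=
  TestFunction.integralAgainstBilinCLM_eq_integral (B := ContinuousLinearMap.mul ℂ ℂ)
    (hF.locallyIntegrable.locallyIntegrableOn _)

lemma Distr.expMul_apply (c : ℂ) (T : Distr) (φ : TestFn) :
    T.expMul c φ = T (testMul (fun t : ℝ => Complex.exp (c * t))
      ((contDiff_const.mul Complex.ofRealCLM.contDiff).cexp) φ) := rfl

/-- The `n`-th derivative of a distribution is evaluated on the test function `(-1)^n φ^{(n)}`. -/
lemma exists_testFn_iteratedDeriv (T : Distr) (n : ℕ) (φ : TestFn) :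
    ∃ ψ : TestFn, (∀ t, ψ t = (-1) ^ n * iteratedDeriv n φ t) ∧ Distr.deriv^[n] T φ = T ψ := by
  induction n generalizing T with
  | zero => exact ⟨φ, by simp, rfl⟩
  | succ n ih =>
    obtain ⟨ψ, hψ, h⟩ := ih T.deriv
    refine ⟨-TestFunction.lineDerivCLM ℂ (1 : ℝ) ψ, fun t => ?_, ?_⟩
    · have h1 : ⇑ψ = fun t => (-1 : ℂ) ^ n * iteratedDeriv n φ t := funext hψ
      have h2 : (TestFunction.lineDerivCLM ℂ (1 : ℝ) ψ : TestFn) t = deriv ψ t := by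
        rw [TestFunction.lineDerivCLM_apply_of_le (by simp)]
        simp [lineDeriv, deriv_comp_const_add]
      change -(TestFunction.lineDerivCLM ℂ (1 : ℝ) ψ : TestFn) t = _
      rw [h2, h1, deriv_const_mul_field, ← iteratedDeriv_succ]
      ring
    · rw [Function.iterate_succ_apply, h]
      rfl

/-! ### The Newton-Cramer distribution -/

/-- A summable family has countable support, and no term vanishes on the divisor. Countability is
needed to integrate the series termwise. -/
lemma countable_divisorSet_diff {f : ℂ → ℂ} (hf : Meromorphic f) (h : HasFiniteOrder f) (σ : ℂ) :
    Countable ↥(divisorSet f \ {σ}) := by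
  have h1 := (summable_mult_div_norm_sub_pow hf h σ le_rfl).countable_support
  rw [← countable_univ_iff]
  refine h1.mono fun ρ _ => ?_
  have h2 : (mult f ρ : ℝ) ≠ 0 := by exact_mod_cast ρ.2.1
  have h3 : (ρ : ℂ) - σ ≠ 0 := sub_ne_zero.2 ρ.2.2
  rw [Function.mem_support]
  positivity

section Formula

variable {f : ℂ → ℂ} {c₀ : ℝ}

/-- The divisor lies in Re s ≤ c₀. The maximum with 0 supplies the nonnegative growth rate κ
required by the exponential estimates. -/
lemma re_sub_le_of_mem_divisorSet (hfa : ∀ s : ℂ, c₀ < s.re → AnalyticAt ℂ f s ∧ f s ≠ 0) (σ : ℂ)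
    (ρ : ↥(divisorSet f \ {σ})) : ((ρ : ℂ) - σ).re ≤ max 0 (c₀ - σ.re) := by
  refine le_max_of_le_right ?_
  rw [Complex.sub_re, sub_le_sub_iff_right]
  by_contra! h1
  exact ρ.2.1 (mult_eq_zero_of_analyticAt (hfa ρ h1).1 (hfa ρ h1).2)

lemma summable_norm_mult_div (hf : Meromorphic f) (h : HasFiniteOrder f) (σ : ℂ) :
    Summable fun ρ : ↥(divisorSet f \ {σ}) =>
      ‖(mult f ρ : ℂ)‖ / ‖(ρ : ℂ) - σ‖ ^ convergenceExponent f := by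
  simpa only [Complex.norm_intCast] using summable_mult_div_norm_sub_pow hf h σ le_rfl

lemma summable_primitiveTerm (hf : Meromorphic f) (h : HasFiniteOrder f)
    (hfa : ∀ s : ℂ, c₀ < s.re → AnalyticAt ℂ f s ∧ f s ≠ 0) (σ : ℂ) {t : ℝ} (ht : 0 ≤ t) :
    Summable (primitiveTerm f σ t) :=
  summable_exponentialTerm (summable_norm_mult_div hf h σ) (re_sub_le_of_mem_divisorSet hfa σ) ht

/-- By unfolding, this is `exponentialPrimitive` with coefficients n_ρ and exponents ρ - σ. -/
lemma continuous_newtonCramerPrimitive (hf : Meromorphic f) (h : HasFiniteOrder f)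
    (hfa : ∀ s : ℂ, c₀ < s.re → AnalyticAt ℂ f s ∧ f s ≠ 0) (hd : 1 ≤ convergenceExponent f)
    (σ : ℂ) : Continuous (newtonCramerPrimitive f σ) :=
  continuous_exponentialPrimitive (summable_norm_mult_div hf h σ)
    (re_sub_le_of_mem_divisorSet hfa σ) (le_max_left _ _) hd _

variable {ι : Type*} [Countable ι] {ℓ : ι → ℝ} {b : ι → ℂ}

/-- The values of the Newton-Cramer distribution, for functions whose logarithmic derivative is a
general Dirichlet series. -/
theorem hasSum_newtonCramer (hf : Meromorphic f) (h : HasFiniteOrder f)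
    (hfa : ∀ s : ℂ, c₀ < s.re → AnalyticAt ℂ f s ∧ f s ≠ 0) (hd : 1 ≤ convergenceExponent f)
    (hℓ : ∀ k, 0 ≤ ℓ k) (hs : Summable fun k => ‖b k‖ * Real.exp (-(ℓ k * c₀)))
    (hlog : ∀ s : ℂ, c₀ < s.re →
      HasSum (fun k => (ℓ k : ℂ) * b k * Complex.exp (-(ℓ k * s))) (logDeriv f s))
    {σ : ℂ} {Q : Polynomial ℂ} (hQ : IsHadamardExponent f σ Q) (φ : TestFn) :
    HasSum (fun k => (ℓ k : ℂ) * b k * φ (ℓ k))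
      (newtonCramer f σ φ - diffEval (discrepancy Q) φ) := by
  have := countable_divisorSet_diff hf h σ
  set κ := max 0 (c₀ - σ.re) with hκ
  have hκ0 : 0 ≤ κ := le_max_left _ _
  have hκ1 : c₀ - σ.re ≤ κ := le_max_right _ _
  set d := convergenceExponent f
  set F := newtonCramerPrimitive f σ with hF
  have hsum := summable_norm_mult_div hf h σ
  have hre := re_sub_le_of_mem_divisorSet hfa σ
  -- The Laplace variable is centred at σ, so the discrepancy polynomial enters as its translate s ↦
  -- P(s + σ).
  set R : Polynomial ℂ := (discrepancy Q).comp
    (Polynomial.C ((1 : ℝ) : ℂ) * Polynomial.X + Polynomial.C σ) with hR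
  -- The abscissa κ + 2 exceeds κ + 1, as the Laplace transform requires, and puts s + σ to the
  -- right of c₀.
  have hlap : ∀ s : ℂ, s.re = κ + 2 →
      HasSum (fun k => (ℓ k : ℂ) * b k * Complex.exp (-(ℓ k * σ)) * Complex.exp (-(s * ℓ k)))
        (s ^ d * (∫ t : ℝ, F t * Complex.exp (-(s * t))) - R.eval s) := by
    intro s hsre
    have hsσ : c₀ < (s + σ).re := by
      rw [Complex.add_re, hsre]
      linarith
    have hs0 : s ≠ 0 := by
      rintro rfl
      simp at hsre
      linarith
    have h1 := hasSum_laplace_exponentialPrimitive hsum (fun ρ => sub_ne_zero.2 ρ.2.2) hre hκ0 hd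
      (mult f σ : ℂ) (s := s) (by linarith)
    have h2 := hQ.hasSum_logDeriv hf h (s := s + σ)
      (by
        filter_upwards [(isOpen_lt continuous_const Complex.continuous_re).mem_nhds hsσ] with z hz
          using hfa z hz) (by simpa using hs0)
    -- The Laplace transform and the Hadamard factorization yield the same series of simple
    -- fractions; uniqueness of sums links them.
    have h3 : s ^ d * (∫ t : ℝ, F t * Complex.exp (-(s * t))) - mult f σ / s =
        logDeriv f (s + σ) - (Q.derivative.eval (s + σ) + mult f σ / (s + σ - σ)) := by
      refine h1.unique (h2.congr_fun fun ρ => ?_)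
      simp only [add_sub_cancel_right, sub_sub_eq_add_sub]
    rw [add_sub_cancel_right] at h3
    have h4 : s ^ d * (∫ t : ℝ, F t * Complex.exp (-(s * t))) - R.eval s = logDeriv f (s + σ) := by
      have h5 : R.eval s = -Q.derivative.eval (s + σ) := by
        simp [hR, discrepancy, Polynomial.eval_comp]
      rw [h5]
      linear_combination h3
    rw [h4]
    refine (hlog _ hsσ).congr_fun fun k => ?_
    rw [mul_assoc _ (Complex.exp _), ← Complex.exp_add]
    ring_nf
  have hμ : Summable fun k => ‖(ℓ k : ℂ) * b k * Complex.exp (-(ℓ k * σ))‖ *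
      Real.exp (-((κ + 2) * ℓ k)) := by
    refine (summable_mul_norm_mul_exp hℓ hs (c := σ.re + κ + 2) (by linarith)).congr fun k => ?_
    rw [norm_mul, norm_mul, norm_exp_neg_ofReal_mul, Complex.norm_real, Real.norm_of_nonneg (hℓ k),
      mul_assoc _ (Real.exp _), ← Real.exp_add]
    ring_nf
  -- Testing against φ e^{σt} implements the factor e^{σt} of W_σ, cancels e^{-ℓσ} in the
  -- coefficients, and undoes the translation of R via `diffEval_comp`.
  set A := testMul (fun t : ℝ => Complex.exp (σ * t))
    ((contDiff_const.mul Complex.ofRealCLM.contDiff).cexp)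
  have hA : ∀ t, A φ t = φ t * Complex.exp (σ * t) := fun _ => rfl
  have hcont : Continuous F := continuous_newtonCramerPrimitive hf h hfa hd σ
  have hmain := hasSum_of_laplace_eq hcont
    (integrable_norm_exponentialPrimitive hsum hre hκ0 hd (mult f σ : ℂ)
      (show κ + 1 < κ + 2 by linarith)) d R hμ hlap (A φ).contDiff (A φ).hasCompactSupport
  convert! hmain using 1
  · funext k
    rw [hA, mul_assoc _ (Complex.exp _), mul_left_comm (Complex.exp _),
      ← Complex.exp_add, mul_comm σ, neg_add_cancel, Complex.exp_zero, mul_one]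
  · congr 1
    · rw [newtonCramer, Distr.expMul_apply]
      obtain ⟨ψ, hψ, h1⟩ := exists_testFn_iteratedDeriv (regular F) d (A φ)
      refine h1.trans ?_
      rw [regular_apply hcont, ← integral_const_mul]
      congr 1 with t
      rw [hψ]
      ring
    · rw [hR, diffEval_comp _ (A φ).contDiff]
      congr 1 with t
      rw [hA, one_mul, mul_assoc, ← Complex.exp_add]
      simp

end Formula

/-! ### Symmetrization -/

lemma diffEval_eq_sum_range {P : Polynomial ℂ} {N : ℕ} (hN : ∀ j, N ≤ j → P.coeff j = 0)
    (ψ : ℝ → ℂ) :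
    diffEval P ψ = ∑ j ∈ Finset.range N, P.coeff j * ((-1) ^ j * iteratedDeriv j ψ 0) := by
  refine Finset.sum_subset (fun j hj => ?_) fun j _ hj => ?_
  · rw [Finset.mem_range]
    by_contra! h
    exact Polynomial.mem_support_iff.1 hj (hN j h)
  · simp [Polynomial.notMem_support_iff.1 hj]

/-- Only the even derivatives survive the symmetrization. -/
lemma diffEval_add_diffEval_neg {P : Polynomial ℂ} {N : ℕ} (hN : ∀ j, N ≤ j → P.coeff j = 0)
    (φ : ℝ → ℂ) :
    diffEval P φ + diffEval P (fun t => φ (-t)) =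
      2 * ∑ l ∈ (Finset.range N).filter (fun l => 2 * l ≤ N - 1),
        P.coeff (2 * l) * iteratedDeriv (2 * l) φ 0 := by
  rw [diffEval_eq_sum_range hN, diffEval_eq_sum_range hN, ← Finset.sum_add_distrib, Finset.mul_sum]
  symm
  -- The surviving terms are the even j = 2l. For N = 0 the bound N - 1 truncates to 0, but the
  -- range is then empty.
  refine Finset.sum_of_injOn (fun l => 2 * l) (fun _ _ _ _ h => by simpa using h)
    (fun l hl => ?_) (fun j hj hj' => ?_) fun l _ => ?_
  · simp only [Finset.coe_filter, Finset.mem_range, mem_ofPred_eq] at hl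
    simp only [Finset.coe_range, mem_Iio]
    omega
  · have hodd : Odd j := by
      rw [← Nat.not_even_iff_odd]
      rintro ⟨l, rfl⟩
      rw [Finset.mem_range] at hj
      refine hj' ⟨l, ?_, by simp only; ring⟩
      simp only [Finset.coe_filter, Finset.mem_range, mem_ofPred_eq]
      omega
    rw [iteratedDeriv_comp_neg, hodd.neg_one_pow, hodd.neg_one_pow]
    simp
  · rw [iteratedDeriv_comp_neg]
    simp
    ring

/-- An affine substitution does not raise the degree, and the derivative has degree strictly below
deg Q ≤ g. A constant Q is separate since its derivative vanishes. -/
lemma coeff_paramDiscrepancy_eq_zero (f : ℂ → ℂ) (Q : Polynomial ℂ) (α β : ℝ) {j : ℕ}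
    (hj : genus f Q ≤ j) : (paramDiscrepancy Q α β).coeff j = 0 := by
  by_cases hQ : Q.natDegree = 0
  · simp [paramDiscrepancy, discrepancy, Polynomial.derivative_of_natDegree_zero hQ]
  · refine Polynomial.coeff_eq_zero_of_natDegree_lt (lt_of_lt_of_le ?_ hj)
    calc (paramDiscrepancy Q α β).natDegree
        ≤ ((discrepancy Q).comp
            (Polynomial.C (α : ℂ) * Polynomial.X + Polynomial.C (β : ℂ))).natDegree :=
          Polynomial.natDegree_C_mul_le _ _
      _ ≤ (discrepancy Q).natDegree *
            (Polynomial.C (α : ℂ) * Polynomial.X + Polynomial.C (β : ℂ)).natDegree :=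
          Polynomial.natDegree_comp_le
      _ ≤ (discrepancy Q).natDegree * 1 :=
          Nat.mul_le_mul_left _ Polynomial.natDegree_linear_le
      _ < Q.natDegree := by
          rw [mul_one, discrepancy, Polynomial.natDegree_neg]
          exact Polynomial.natDegree_derivative_lt hQ
      _ ≤ genus f Q := le_max_left _ _

/-- After transposition both halves carry the same weight e^{-βt}: the reflection reverses the sign
in e^{(β/α)t}. The factor α is the Jacobian. -/
lemma symmNewtonCramer_apply (f : ℂ → ℂ) (σ : ℂ) {α : ℝ} (β : ℝ) (hα : 0 < α) (φ : TestFn) :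
    ∃ ψ₁ ψ₂ : TestFn, (∀ t : ℝ, ψ₁ t = φ (α * t) * Complex.exp (-(β * t))) ∧
      (∀ t : ℝ, ψ₂ t = φ (-(α * t)) * Complex.exp (-(β * t))) ∧
      symmNewtonCramer f σ α β hα φ = α * newtonCramer f σ ψ₁ + α * newtonCramer f σ ψ₂ := by
  have hα0 : (α : ℂ) ≠ 0 := by exact_mod_cast hα.ne'
  refine ⟨testScale (α⁻¹)⁻¹ (inv_ne_zero (inv_ne_zero hα.ne')) (testMul (fun t : ℝ =>
      Complex.exp (-((β / α : ℝ) : ℂ) * t))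
      ((contDiff_const.mul Complex.ofRealCLM.contDiff).cexp) φ),
    testScale (-α⁻¹)⁻¹ (inv_ne_zero (neg_ne_zero.mpr (inv_ne_zero hα.ne'))) (testMul (fun t : ℝ =>
      Complex.exp (((β / α : ℝ) : ℂ) * t))
      ((contDiff_const.mul Complex.ofRealCLM.contDiff).cexp) φ), fun t => ?_, fun t => ?_, ?_⟩
  · rw [testScale_apply, inv_inv]
    change φ (α * t) * Complex.exp (-((β / α : ℝ) : ℂ) * ((α * t : ℝ) : ℂ)) = _
    congr 2
    push_cast
    field_simp
  · rw [testScale_apply, inv_neg, inv_inv, neg_mul]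
    change φ (-(α * t)) * Complex.exp (((β / α : ℝ) : ℂ) * ((-(α * t) : ℝ) : ℂ)) = _
    congr 2
    push_cast
    field_simp
  · have h1 : |α⁻¹|⁻¹ = α := by rw [abs_of_pos (inv_pos.2 hα), inv_inv]
    have h2 : |-α⁻¹|⁻¹ = α := by rw [abs_neg, h1]
    change ((|α⁻¹|⁻¹ : ℝ) : ℂ) * newtonCramer f σ _ + ((|-α⁻¹|⁻¹ : ℝ) : ℂ) * newtonCramer f σ _ = _
    rw [h1, h2]
    rfl

lemma iterate_deriv_dirac_apply (l : ℕ) (φ : TestFn) :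
    Distr.deriv^[2 * l] (dirac 0) φ = iteratedDeriv (2 * l) φ 0 := by
  obtain ⟨ψ, hψ, h⟩ := exists_testFn_iteratedDeriv (dirac 0) (2 * l) φ
  rw [h, dirac_apply, hψ]
  simp

/-! ### The index set -/

section IndexSet

lemma absIndex_natCast (k : ℕ →₀ ℕ) : absIndex (k.mapRange (Nat.cast : ℕ → ℤ) rfl) = k := by
  ext n
  simp [absIndex]

lemma absIndex_neg (k : ℕ →₀ ℤ) : absIndex (-k) = absIndex k := by
  ext n
  simp [absIndex]

lemma pairing_natCast (lam : ℕ → ℝ) (k : ℕ →₀ ℕ) :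
    pairing lam (k.mapRange (Nat.cast : ℕ → ℤ) rfl) = natPairing lam k := by
  rw [pairing, Finsupp.sum_mapRange_index (by simp)]
  simp [natPairing]

lemma pairing_neg (lam : ℕ → ℝ) (k : ℕ →₀ ℤ) : pairing lam (-k) = -pairing lam k := by
  rw [pairing, Finsupp.sum_neg_index (by simp), pairing, Finsupp.sum, Finsupp.sum,
    ← Finset.sum_neg_distrib]
  exact Finset.sum_congr rfl fun n _ => by push_cast; ring

lemma mapRange_natCast_injective :
    Function.Injective fun k : ℕ →₀ ℕ => k.mapRange (Nat.cast : ℕ → ℤ) rfl :=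
  Function.LeftInverse.injective absIndex_natCast

lemma mem_indexSet_natCast (k : ℕ →₀ ℕ) :
    k.mapRange (Nat.cast : ℕ → ℤ) rfl ∈ indexSet ↔ k ≠ 0 := by
  constructor
  · rintro h rfl
    exact h.2 (by simp)
  · intro h
    refine ⟨fun n => by simp, fun h0 => h ?_⟩
    exact mapRange_natCast_injective (by simpa using h0)

lemma exists_natCast_of_mem_indexSet {k : ℕ →₀ ℤ} (hk : k ∈ indexSet) :
    ∃ l : ℕ →₀ ℕ, l.mapRange (Nat.cast : ℕ → ℤ) rfl = k := by
  refine ⟨absIndex k, ?_⟩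
  ext n
  simpa [absIndex] using hk.1 n

lemma disjoint_indexSet : Disjoint indexSet (-indexSet) := by
  rw [Set.disjoint_left]
  intro k hk hk'
  refine hk.2 (le_antisymm ?_ hk.1)
  have := hk'.1
  simpa using this

/-- A sum over `Λ` is a sum over families of natural numbers. -/
lemma hasSum_indexSet {g : (ℕ →₀ ℤ) → ℂ} {A : ℂ} (h0 : g 0 = 0)
    (h : HasSum (fun k : ℕ →₀ ℕ => g (k.mapRange (Nat.cast : ℕ → ℤ) rfl)) A) :
    HasSum (g ∘ ((↑) : ↥indexSet → ℕ →₀ ℤ)) A := by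
  rw [hasSum_subtype_iff_indicator, ← mapRange_natCast_injective.hasSum_iff]
  · refine h.congr_fun fun k => ?_
    by_cases hk : k = 0
    · subst hk
      simp [h0]
    · simp only [Function.comp]
      rw [indicator_of_mem ((mem_indexSet_natCast k).2 hk)]
  · intro k hk
    refine indicator_of_notMem (fun h1 => hk ?_) _
    obtain ⟨l, hl⟩ := exists_natCast_of_mem_indexSet h1
    exact ⟨l, hl⟩

lemma hasSum_indexSet_union_neg {g : (ℕ →₀ ℤ) → ℂ} {A B : ℂ} (h0 : g 0 = 0)
    (hA : HasSum (fun k : ℕ →₀ ℕ => g (k.mapRange (Nat.cast : ℕ → ℤ) rfl)) A)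
    (hB : HasSum (fun k : ℕ →₀ ℕ => g (-k.mapRange (Nat.cast : ℕ → ℤ) rfl)) B) :
    HasSum (g ∘ ((↑) : ↥(indexSet ∪ -indexSet) → ℕ →₀ ℤ)) (A + B) := by
  refine (hasSum_indexSet h0 hA).add_disjoint disjoint_indexSet ?_
  have h1 := hasSum_indexSet (g := fun k => g (-k)) (by simpa using h0) hB
  rw [hasSum_subtype_iff_indicator] at h1 ⊢
  rw [← (Equiv.neg (ℕ →₀ ℤ)).hasSum_iff]
  refine h1.congr_fun fun k => ?_
  simp only [Function.comp, Equiv.neg_apply]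
  by_cases hk : k ∈ indexSet
  · rw [indicator_of_mem hk, indicator_of_mem (Set.neg_mem_neg.2 hk)]
  · rw [indicator_of_notMem hk, indicator_of_notMem fun h => hk (Set.neg_mem_neg.1 h)]

end IndexSet

/-! ### Assembly of the Poisson-Newton formula -/

lemma Distr.hasSum_iff {ι : Type*} {T : ι → Distr} {S : Distr} :
    HasSum T S ↔ ∀ φ : TestFn, HasSum (fun i => T i φ) (S φ) := by
  refine PointwiseConvergenceCLM.tendsto_iff_forall_tendsto.trans (forall_congr' fun φ => ?_)
  have : ∀ s : Finset ι, (∑ i ∈ s, T i) φ = ∑ i ∈ s, T i φ := fun s =>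
    map_sum (PointwiseConvergenceCLM.evalCLM (RingHom.id ℂ) ℂ φ) T s
  simp only [this]
  rfl

/-- The Poisson-Newton formula: the frequency part converges to the symmetric Newton-Cramer
distribution up to a combination of derivatives of `δ_0`. -/
theorem hasSum_frequencyTerm {f : ℂ → ℂ} {c₀ : ℝ} {lam : ℕ → ℝ} {a : ℕ → ℂ} (hf : Meromorphic f)
    (h : HasFiniteOrder f) (hfa : ∀ s : ℂ, c₀ < s.re → AnalyticAt ℂ f s ∧ f s ≠ 0)
    (hd : 1 ≤ convergenceExponent f) (hlam : ∀ n, 0 ≤ lam n)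
    (hs : Summable fun k => ‖logCoeff a k‖ * Real.exp (-(natPairing lam k * c₀)))
    (hlog : ∀ s : ℂ, c₀ < s.re → HasSum (fun k => (natPairing lam k : ℂ) * logCoeff a k *
      Complex.exp (-(natPairing lam k * s))) (logDeriv f s))
    {σ : ℂ} {Q : Polynomial ℂ} (hQ : IsHadamardExponent f σ Q) {α : ℝ} (β : ℝ) (hα : 0 < α) :
    HasSum (fun k : ↥(indexSet ∪ -indexSet) => frequencyTerm lam a α β k)
      (symmNewtonCramer f σ α β hα -
        (2 : ℂ) • ∑ l ∈ (Finset.range (genus f Q)).filter (fun l => 2 * l ≤ genus f Q - 1),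
          (paramDiscrepancy Q α β).coeff (2 * l) • Distr.deriv^[2 * l] (dirac 0)) := by
  rw [Distr.hasSum_iff]
  intro φ
  obtain ⟨ψ₁, ψ₂, h1, h2, hψ⟩ := symmNewtonCramer_apply f σ β hα φ
  have hψ₁ : diffEval (paramDiscrepancy Q α β) φ = α * diffEval (discrepancy Q) ψ₁ := by
    rw [paramDiscrepancy, diffEval_C_mul, diffEval_comp _ φ.contDiff]
    congr 2
    exact (funext h1).symm
  have hψ₂ : diffEval (paramDiscrepancy Q α β) (fun t => φ (-t)) =
      α * diffEval (discrepancy Q) ψ₂ := by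
    have hneg : ContDiff ℝ ∞ fun t => φ (-t) := φ.contDiff.comp contDiff_neg
    rw [paramDiscrepancy, diffEval_C_mul, diffEval_comp _ hneg]
    congr 2
    exact (funext h2).symm
  have hA := (hasSum_newtonCramer hf h hfa hd (natPairing_nonneg hlam) hs hlog hQ ψ₁).mul_left
    (α : ℂ)
  have hB := (hasSum_newtonCramer hf h hfa hd (natPairing_nonneg hlam) hs hlog hQ ψ₂).mul_left
    (α : ℂ)
  -- The identity for ψ₁ supplies the Dirac masses indexed by Λ, that for ψ₂ those indexed by -Λ.
  -- The index 0 may be included because ⟨λ, 0⟩ = 0.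
  have hsum := hasSum_indexSet_union_neg (g := fun k => frequencyTerm lam a α β k φ) ?_
    (hA.congr_fun fun k => ?_) (hB.congr_fun fun k => ?_)
  · convert! hsum using 1
    have hdelta : ((2 : ℂ) • ∑ l ∈ (Finset.range (genus f Q)).filter
        (fun l => 2 * l ≤ genus f Q - 1), (paramDiscrepancy Q α β).coeff (2 * l) •
          Distr.deriv^[2 * l] (dirac 0)) φ =
        2 * ∑ l ∈ (Finset.range (genus f Q)).filter (fun l => 2 * l ≤ genus f Q - 1),
          (paramDiscrepancy Q α β).coeff (2 * l) * iteratedDeriv (2 * l) φ 0 := by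
      have h3 := map_sum (PointwiseConvergenceCLM.evalCLM (RingHom.id ℂ) ℂ φ)
        (fun l => (paramDiscrepancy Q α β).coeff (2 * l) • Distr.deriv^[2 * l] (dirac 0))
        ((Finset.range (genus f Q)).filter (fun l => 2 * l ≤ genus f Q - 1))
      refine (congrArg (fun z : ℂ => 2 * z) h3).trans ?_
      congr 1
      refine Finset.sum_congr rfl fun l _ => ?_
      exact congrArg (fun z => (paramDiscrepancy Q α β).coeff (2 * l) * z)
        (iterate_deriv_dirac_apply l φ)
    refine (congrArg (fun z => symmNewtonCramer f σ α β hα φ - z) hdelta).trans ?_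
    rw [hψ, ← diffEval_add_diffEval_neg
      (fun j hj => coeff_paramDiscrepancy_eq_zero f Q α β hj), hψ₁, hψ₂]
    ring
  · change ((α * natPairing lam (absIndex 0) * Real.exp (-(natPairing lam (absIndex 0) * β)) : ℝ) *
      logCoeff a (absIndex 0)) * φ (α * pairing lam 0) = 0
    simp [absIndex, natPairing]
  · change ((α * natPairing lam (absIndex _) * Real.exp (-(natPairing lam (absIndex _) * β)) : ℝ) *
      logCoeff a (absIndex _)) * φ (α * pairing lam _) = _
    rw [absIndex_natCast, pairing_natCast, h1]
    push_cast
    ring_nf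
  · change ((α * natPairing lam (absIndex _) * Real.exp (-(natPairing lam (absIndex _) * β)) : ℝ) *
      logCoeff a (absIndex _)) * φ (α * pairing lam _) = _
    rw [absIndex_neg, absIndex_natCast, pairing_neg, pairing_natCast, h2, mul_neg]
    push_cast
    ring_nf

/-- Identity principle: on the connected plane, vanishing identically near one point would spread to
s. -/
lemma meromorphicOrderAt_ne_top_of_exists {f : ℂ → ℂ} (hf : Meromorphic f) {s : ℂ}
    (ha : AnalyticAt ℂ f s) (h0 : f s ≠ 0) (z : ℂ) : meromorphicOrderAt f z ≠ ⊤ := by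
  have h1 : meromorphicOrderAt f s ≠ ⊤ := by
    rw [ha.meromorphicNFAt.meromorphicOrderAt_eq_zero_iff.2 h0]
    simp
  exact MeromorphicOn.meromorphicOrderAt_ne_top_of_isPreconnected (U := univ) (fun w _ => hf w)
    isPreconnected_univ (mem_univ s) (mem_univ z) h1

end PoissonNewton

end

theorem mainTheorem4
    -- the Dirichlet series `1 + ∑ a_n e^{-λ_n s}`, absolutely convergent for `Re s ≥ σbar`
    (lam : ℕ → ℝ) (a : ℕ → ℂ) (σbar : ℝ)
    (hlam_pos : 0 < lam 0) (hlam_mono : StrictMono lam) (hlam_top : Tendsto lam atTop atTop)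
    (hnonconst : ∃ n, a n ≠ 0)
    (habs : Summable fun n => ‖a n‖ * Real.exp (-(lam n * σbar)))
    -- its meromorphic extension of finite order
    (f : ℂ → ℂ) (hmero : Meromorphic f) (hord : PoissonNewton.HasFiniteOrder f)
    (hext : ∀ s : ℂ, σbar < s.re → f s = 1 + ∑' n, a n * Complex.exp (-(lam n * s)))
    -- the parameters
    (σ : ℂ) (α β : ℝ) (hα : 0 < α) :
    -- the Newton-Cramer distribution is well defined
    1 ≤ PoissonNewton.convergenceExponent f ∧
    (∀ t : ℝ, 0 ≤ t → Summable (PoissonNewton.primitiveTerm f σ t)) ∧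
    Continuous (PoissonNewton.newtonCramerPrimitive f σ) ∧
    -- the discrepancy polynomial is defined
    (∃ Q : Polynomial ℂ, PoissonNewton.IsHadamardExponent f σ Q) ∧
    -- the Poisson-Newton formula
    ∀ Q : Polynomial ℂ, PoissonNewton.IsHadamardExponent f σ Q →
      Summable (fun k : ↥(PoissonNewton.indexSet ∪ -PoissonNewton.indexSet) =>
        PoissonNewton.frequencyTerm lam a α β k) ∧
      PoissonNewton.symmNewtonCramer f σ α β hα =
        (2 : ℂ) • (∑ l ∈ (Finset.range (PoissonNewton.genus f Q)).filter
            (fun l => 2 * l ≤ PoissonNewton.genus f Q - 1),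
          (PoissonNewton.paramDiscrepancy Q α β).coeff (2 * l) •
            PoissonNewton.Distr.deriv^[2 * l] (PoissonNewton.dirac 0)) +
        ∑' k : ↥(PoissonNewton.indexSet ∪ -PoissonNewton.indexSet),
          PoissonNewton.frequencyTerm lam a α β k := by
  have hlam : ∀ n, 0 ≤ lam n := fun n => hlam_pos.le.trans (hlam_mono.monotone (Nat.zero_le n))
  obtain ⟨c₀, hc₀, hlt⟩ := PoissonNewton.exists_tsum_norm_dirichlet_le hlam_pos hlam_mono habs
  have hs := PoissonNewton.summable_norm_dirichlet hlam habs hc₀.le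
  have hfs : ∀ s : ℂ, c₀ < s.re → f s = 1 + ∑' n, a n * Complex.exp (-(lam n * s)) :=
    fun s h => hext s (hc₀.trans h)
  have hfd := fun (s : ℂ) (h : c₀ < s.re) => PoissonNewton.dirichlet_logDeriv hlam hs hlt hfs h
  have hfa : ∀ s : ℂ, c₀ < s.re → AnalyticAt ℂ f s ∧ f s ≠ 0 :=
    fun s h => ⟨(hfd s h).1, (hfd s h).2.1⟩
  have hpt : c₀ < ((c₀ + 1 : ℝ) : ℂ).re := by simp
  have htop := PoissonNewton.meromorphicOrderAt_ne_top_of_exists hmero (hfa _ hpt).1 (hfa _ hpt).2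
  have hQ := PoissonNewton.exists_isHadamardExponent hmero hord htop
  -- The factorization at the origin 0 serves only to prove d ≥ 1; the formula itself uses the
  -- origin σ.
  obtain ⟨Q₀, hQ₀⟩ := hQ 0
  have hd := PoissonNewton.one_le_convergenceExponent hlam_pos hlam_mono hnonconst hs hfs hfa hmero
    hord hQ₀
  refine ⟨hd, fun t ht => PoissonNewton.summable_primitiveTerm hmero hord hfa σ ht,
    PoissonNewton.continuous_newtonCramerPrimitive hmero hord hfa hd σ, hQ σ, fun Q hQσ => ?_⟩
  have hsum := PoissonNewton.hasSum_frequencyTerm hmero hord hfa hd hlam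
    (PoissonNewton.summable_norm_logCoeff_mul_exp hs hlt) (fun s h => (hfd s h).2.2) hQσ β hα
  refine ⟨hsum.summable, ?_⟩
  rw [hsum.tsum_eq, add_sub_cancel]
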